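/- Consider the two-dimensional zero-pressure gas dynamics system $$\rho_t+(\rho u)_x+(\rho v)_y=0,\quad (\rho u)_t+(\rho u^2)_x+(\rho uv)_y=0,\quad (\rho v)_t+(\rho uv)_x+(\rho v^2)_y=0,$$ $$\Big(H+\tfrac{\rho}{2}(u^2+v^2)\Big)_t+\Big(\big(H+\tfrac{\rho}{2}(u^2+v^2)\big)u\Big)_x+\Big(\big(H+\tfrac{\rho}{2}(u^2+v^2)\big)v\Big)_y=0$$ with initial data $(\rho_1,u_1,v_1,H_1)$ for $x>0,y>0$, $(\rho_2,u_2,v_2,H_2)$ for $x<0,y>0$, $(\rho_3,u_3,v_3,H_3)$ for $y<0$, where $\rho_i>0$, $H_i\ge 0$. Put $U_i=\Xi_i=(u_i,v_i)$, $U^*_{ij}=\frac{\sqrt{\rho_i}U_i+\sqrt{\rho_j}U_j}{\sqrt{\rho_i}+\sqrt{\rho_j}}=(u^*_{ij},v^*_{ij})$, $(\xi,\eta)=(x/t,y/t)$, and $[P,Q,R]=\det\begin{pmatrix}P&1\\Q&1\\R&1\end{pmatrix}$. A *delta shock* with states $L$, $R$ on its left and right (followed towards decreasing $\sigma$) is a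 smooth simple curve $\Xi(\sigma)$, $\sigma=\ln(s/t)$ in an interval, with smooth velocity $U_\delta(\sigma)$ and weights $m(\sigma),n(\sigma)$, positive in the interior of the interval. It represents the surface $X=t\,\Xi(\ln(s/t))$ in space-time, carrying Dirac measures of $\rho$ and $H$ with weights $t\,m$ and $t\,n$ with respect to $ds\,dt$. For each pair $(G,g)$ of $(\rho,m)$, $(\rho u,mu_\delta)$, $(\rho v,mv_\delta)$, $(H+\frac{\rho}{2}|U|^2,\;n+\frac m2|U_\delta|^2)$ it satisfies $$\Xi-\Xi'=U_\delta,\qquad g-g'=\big(G_L[U_L,U_\delta,\Xi]-G_R[U_R,U_\delta,\Xi]\big)e^{-\sigma},\qquad [U_L,U_\delta,\Xi]>0>[U_R,U_\delta,\Xi].$$ The *exterior* delta shock $\delta_{ij}$ (with $L=i$, $R=j$) is the straight one with $U_\delta=U^*_{ij}$ and the weights of the one-dimensional Riemann solution; it lies on $\xi=u^*_{12}$ for $\delta_{12}$, and on $\eta=v^*_{ij}$ for $\delta_{23}$ and $\delta_{31}$. A *contact discontinuity* $J_{ij}$ is a straight piece of a line through $U_i$ and $U_j$ separating the states $i$ and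 $j$. In each of the following cases there is a global self-similar solution. The $(\xi,\eta)$-plane is the disjoint union of three open regions $\Omega_1,\Omega_2,\Omega_3$, the listed waves, and finitely many points where waves meet or end. The state on $\Omega_i$ is $(\rho_i,u_i,v_i,H_i)$. Each wave separates its two states, distinct waves meet at most in the listed points, and along every ray of direction in the $i$-th initial sector the state is eventually the $i$-th. The initial value problem holds in the sense of distributions on $[0,\infty)\times\mathbb R^2$, for all four equations and with the Dirac measures included. There is no vacuum, i.e. almost every point lies in some $\Omega_i$ and there has density $\rho_i>0$. Except in case (c), the new wave is determined at one interaction point $A$: it is a delta shock $\delta_{32}$ ($L=3$, $R=2$) defined for $-\infty<\sigma\le 0$, with $\Xi(0)=A$ and with $m$, $mU_\delta$, $n+\frac m2|U_\delta|^2$ at $\sigma=0$ equal to the sums of the same quantities over the delta shocks arriving at $A$, these being parametrized so that they too reach $A$ at $\sigma=0$. (a) (Case 3) $u_3<u_1<u_2$, $v_2<v_1<v_3$, $[\Xi_1,\Xi_2,\Xi_3]<0$. The exterior delta shocks $\delta_{12}$ and $\delta_{31}$ meet at $A=(u^*_{12},v^*_{31})$ and produce a new delta shock $\delta_{32}$,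 with $[U_2,U_3,A]<[U_2,U_3,U_\delta(0)]<0$. Along it $\Xi\to U^*_{23}$ and $U_\delta\to U^*_{23}$ as $\sigma\to-\infty$; the exterior delta shock $\delta_{23}$ also terminates at $U^*_{23}$. The waves are $\delta_{12},\delta_{31},\delta_{23},\delta_{32}$ and the points $A$, $U^*_{23}$. (b) (Case 4) $u_3<u_1=u_2$, $v_2<v_1<v_3$. The contact discontinuity $J_{12}$ (coming from infinity on $\xi=u_1$) and $\delta_{31}$ meet at $A=(u_1,v^*_{31})$ and produce a new delta shock $\delta_{32}$ with $\Xi,U_\delta\to U^*_{23}$ as $\sigma\to-\infty$, where $\delta_{23}$ also terminates. The waves are $J_{12},\delta_{31},\delta_{23},\delta_{32}$ and the points $A$, $U^*_{23}$. (c) (Case 7) $u_1<u_2$, $v_1=v_2=v_3$. The exterior delta shock $\delta_{12}$ terminates at $U^*_{12}$. If $u^*_{12}\le u_3$, the contact discontinuity $J_{23}$, coming from infinity on the left, meets $\delta_{12}$ at $U^*_{12}$; a new contact discontinuity $J_{13}$ continues on the same line from $U^*_{12}$ to $\Xi_3$ and there meets $J_{31}$, which comes from infinity on the right. If $u_3\le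 u^*_{12}$, the mirror image holds: $J_{31}$ meets $\delta_{12}$ at $U^*_{12}$, and a new contact discontinuity $J_{32}$ continues on the same line to $\Xi_3$, where it meets $J_{23}$. The points are $U^*_{12}$ and $\Xi_3$. (d) (Case 8) $u_3<u_1=u_2$, $v_2<v_1=v_3$. The contact discontinuities $J_{12}$ (on $\xi=u_1$) and $J_{31}$ (on $\eta=v_1$), coming from infinity, meet at $A=\Xi_1$ and produce a new delta shock $\delta_{32}$ with zero weights at $A$ and with $\Xi,U_\delta\to U^*_{23}$ as $\sigma\to-\infty$, where $\delta_{23}$ also terminates. The waves are $J_{12},J_{31},\delta_{23},\delta_{32}$ and the points $\Xi_1$, $U^*_{23}$. -/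

import Mathlib

open Set Filter Topology MeasureTheory
open scoped ContDiff

noncomputable section

namespace ZeroPressure

/-! ### States, determinants, densities -/

/-- A constant state: density, velocity components, internal energy. -/
structure GasState where
  ρ : ℝ
  u : ℝ
  v : ℝ
  H : ℝ

/-- The velocity of a state; also the point `Ξᵢ = (uᵢ, vᵢ)` of the self-similar plane. -/
def GasState.vel (S : GasState) : ℝ × ℝ := (S.u, S.v)

/-- Labels of the three constant states. -/
abbrev i₁ : Fin 3 := 0
/-- Label of the second state. -/
abbrev i₂ : Fin 3 := 1
/-- Label of the third state. -/
abbrev i₃ : Fin 3 := 2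

/-- The squared Euclidean norm of a planar vector. -/
def nsq (P : ℝ × ℝ) : ℝ := P.1 ^ 2 + P.2 ^ 2

/-- Rotation of a planar vector by a right angle, counterclockwise. -/
def rot (P : ℝ × ℝ) : ℝ × ℝ := (-P.2, P.1)

/-- The planar cross product. -/
def cross (P Q : ℝ × ℝ) : ℝ := P.1 * Q.2 - P.2 * Q.1

/-- The determinant `[P, Q, R]`. -/
def tri (P Q R : ℝ × ℝ) : ℝ :=
  Matrix.det !![P.1, P.2, 1; Q.1, Q.2, 1; R.1, R.2, 1]

/-- The four conserved densities `ρ, ρu, ρv, H + ρ(u² + v²)/2` of a state. -/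
def GasState.dens (S : GasState) (k : Fin 4) : ℝ :=
  ![S.ρ, S.ρ * S.u, S.ρ * S.v, S.H + S.ρ / 2 * nsq S.vel] k

/-- The weighted average `U*` of the velocities of two states. -/
def avg (L R : GasState) : ℝ × ℝ :=
  (√L.ρ + √R.ρ)⁻¹ • (√L.ρ • L.vel + √R.ρ • R.vel)

/-! ### Waves in the self-similar plane -/

/-- The data of a self-similar delta shock: the labels of the states on its left and on its
right when it is followed towards decreasing parameter, the range of the parameter `σ = ln (s/t)`,
and, as functions of `σ`, the curve `Ξ`, the velocity `U` and the weights `m`, `n` of the Dirac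
measures carried by `ρ` and `H`.  In space-time it is the surface
`X(t, s) = t Ξ(σ)`, with weights `w = t m(σ)`, `h = t n(σ)` with respect to `ds dt`. -/
structure DeltaShock where
  left : Fin 3
  right : Fin 3
  range : Set ℝ
  Ξ : ℝ → ℝ × ℝ
  U : ℝ → ℝ × ℝ
  m : ℝ → ℝ
  n : ℝ → ℝ

namespace DeltaShock

/-- The curve traced in the self-similar plane. -/
def support (δ : DeltaShock) : Set (ℝ × ℝ) := δ.Ξ '' δ.range

/-- The weights of the four conserved quantities on the delta shock:
`m, m u_δ, m v_δ, n + m |U_δ|² / 2`. -/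
def dens (δ : DeltaShock) (k : Fin 4) (σ : ℝ) : ℝ :=
  ![δ.m σ, δ.m σ * (δ.U σ).1, δ.m σ * (δ.U σ).2, δ.n σ + δ.m σ / 2 * nsq (δ.U σ)] k

/-- The parameters `(t, s)` of the surface in space-time. -/
def domain (δ : DeltaShock) : Set (ℝ × ℝ) :=
  {p | 0 < p.1 ∧ 0 < p.2 ∧ Real.log (p.2 / p.1) ∈ δ.range}

/-- The integrand of the contribution of the delta shock to the weak form of the `k`-th
conservation law: weight times `φ_t + u_δ φ_x + v_δ φ_y` at `(t, X(t, s))`. -/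
def integrand (δ : DeltaShock) (k : Fin 4) (φ : ℝ × ℝ × ℝ → ℝ) (p : ℝ × ℝ) : ℝ :=
  p.1 * δ.dens k (Real.log (p.2 / p.1)) *
    fderiv ℝ φ (p.1, p.1 • δ.Ξ (Real.log (p.2 / p.1))) (1, δ.U (Real.log (p.2 / p.1)))

/-- The curve and its velocity both tend to `P` as the parameter tends to `-∞`. -/
def TerminatesAt (δ : DeltaShock) (P : ℝ × ℝ) : Prop :=
  Tendsto δ.Ξ atBot (𝓝 P) ∧ Tendsto δ.U atBot (𝓝 P)

end DeltaShock

/-- The reformulated generalized Rankine–Hugoniot relations, with smoothness, positivity of the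
weights, and the strict entropy condition at every parameter of the range. -/
structure IsDeltaShock (S : Fin 3 → GasState) (δ : DeltaShock) : Prop where
  smooth_Ξ : ContDiffOn ℝ ∞ δ.Ξ δ.range
  smooth_U : ContDiffOn ℝ ∞ δ.U δ.range
  smooth_m : ContDiffOn ℝ ∞ δ.m δ.range
  smooth_n : ContDiffOn ℝ ∞ δ.n δ.range
  simple : InjOn δ.Ξ δ.range
  /-- `Ξ - Ξ' = U_δ`. -/
  curve : ∀ σ ∈ δ.range, HasDerivWithinAt δ.Ξ (δ.Ξ σ - δ.U σ) δ.range σ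
  /-- `g - g' = (G_L [U_L, U_δ, Ξ] - G_R [U_R, U_δ, Ξ]) e^{-σ}` for the four conserved weights. -/
  balance : ∀ k, ∀ σ ∈ δ.range, HasDerivWithinAt (δ.dens k)
    (δ.dens k σ -
      ((S δ.left).dens k * tri (S δ.left).vel (δ.U σ) (δ.Ξ σ)
        - (S δ.right).dens k * tri (S δ.right).vel (δ.U σ) (δ.Ξ σ)) * Real.exp (-σ))
    δ.range σ
  entropy : ∀ σ ∈ δ.range, 0 < tri (S δ.left).vel (δ.U σ) (δ.Ξ σ) ∧
    tri (S δ.right).vel (δ.U σ) (δ.Ξ σ) < 0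
  pos : ∀ σ ∈ interior δ.range, 0 < δ.m σ ∧ 0 < δ.n σ

/-- The straight delta shock between two states with curve `Ξ = U* + e^σ C`, constant velocity
`U*`, and weights equal to those of the one-dimensional Riemann solution.  For `C` of length one
and parallel to the initial discontinuity these are the usual weights per unit length; for a
general such `C` they are multiplied by the length of `C`. -/
def straightDelta (S : Fin 3 → GasState) (l r : Fin 3) (C : ℝ × ℝ) (I : Set ℝ) : DeltaShock where
  left := l
  right := r
  range := I
  Ξ := fun σ => avg (S l) (S r) + Real.exp σ • C
  U := fun _ => avg (S l) (S r)
  m := fun _ => √((S l).ρ * (S r).ρ) * cross ((S r).vel - (S l).vel) C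
  n := fun _ =>
    ((S l).ρ * (S r).ρ * nsq ((S l).vel - (S r).vel) / (2 * (√(S l).ρ + √(S r).ρ))
      + √(S r).ρ * (S l).H + √(S l).ρ * (S r).H)
      * (cross ((S r).vel - (S l).vel) C / (√(S l).ρ + √(S r).ρ))

/-- The data of a contact discontinuity: states on its left and right when it is followed in the
direction `dir`, and the straight piece `{base + τ dir | τ ∈ range}`. -/
structure Contact where
  left : Fin 3
  right : Fin 3
  base : ℝ × ℝ
  dir : ℝ × ℝ
  range : Set ℝ

/-- The points of a contact discontinuity. -/
def Contact.support (J : Contact) : Set (ℝ × ℝ) := (fun τ : ℝ => J.base + τ • J.dir) '' J.range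

/-- The Rankine–Hugoniot relations of a contact discontinuity: the line through every one of its
points in its own direction passes through the velocities of both adjacent states. -/
def IsContact (S : Fin 3 → GasState) (J : Contact) : Prop :=
  J.dir ≠ 0 ∧ ∀ P ∈ J.support,
    cross J.dir ((S J.left).vel - P) = 0 ∧ cross J.dir ((S J.right).vel - P) = 0

/-! ### Global solutions -/

/-- The part of the plane occupied initially by each of the states. -/
def sector : Fin 3 → Set (ℝ × ℝ) :=
  ![{P | 0 < P.1 ∧ 0 < P.2}, {P | P.1 < 0 ∧ 0 < P.2}, {P | P.2 < 0}]

/-- The part of space-time `(t, x, y)` with `t > 0` and `(x/t, y/t) ∈ Ω`. -/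
def cone (Ω : Set (ℝ × ℝ)) : Set (ℝ × ℝ × ℝ) :=
  {p | 0 < p.1 ∧ (p.2.1 / p.1, p.2.2 / p.1) ∈ Ω}

/-- The field equal to the `i`-th state on the `i`-th region, with Dirac measures on the
delta shocks of the list, solves the conservation laws of mass, both momenta and energy with the
three-piece initial data in the sense of distributions. -/
def IsWeakSolution (S : Fin 3 → GasState) (Ω : Fin 3 → Set (ℝ × ℝ)) (Δ : List DeltaShock) :
    Prop :=
  ∀ φ : ℝ × ℝ × ℝ → ℝ, ContDiff ℝ ∞ φ → HasCompactSupport φ → ∀ k : Fin 4,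
    (∀ δ ∈ Δ, IntegrableOn (δ.integrand k φ) δ.domain) ∧
    (∑ i, ∫ p in cone (Ω i), (S i).dens k * fderiv ℝ φ p (1, (S i).vel))
      + (Δ.map fun δ => ∫ p in δ.domain, δ.integrand k φ p).sum
      + (∑ i, ∫ X in sector i, (S i).dens k * φ (0, X)) = 0

/-- A global self-similar solution of the three-state Riemann problem: the states occupy the
regions `Ω`, whose complement consists of the delta shocks `Δ`, the contact discontinuities `Γ` and
the finitely many points `nodes` where waves meet or end. -/
structure IsGlobalSolution (S : Fin 3 → GasState) (Ω : Fin 3 → Set (ℝ × ℝ))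
    (Δ : List DeltaShock) (Γ : List Contact) (nodes : Set (ℝ × ℝ)) : Prop where
  isOpen : ∀ i, IsOpen (Ω i)
  disjoint : Pairwise fun i j => Disjoint (Ω i) (Ω j)
  compl : (⋃ i, Ω i)ᶜ = (⋃ δ ∈ Δ, δ.support) ∪ (⋃ J ∈ Γ, J.support) ∪ nodes
  /-- Distinct waves meet at most in the nodes. -/
  meet : (Δ.map DeltaShock.support ++ Γ.map Contact.support).Pairwise fun a b => a ∩ b ⊆ nodes
  /-- The data at infinity of the self-similar plane. -/
  farField : ∀ i, ∀ d ∈ sector i, ∀ᶠ r : ℝ in atTop, r • d ∈ Ω i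
  isDelta : ∀ δ ∈ Δ, IsDeltaShock S δ
  /-- The adjacent states of a delta shock; `U - Ξ` is tangent, towards decreasing parameter. -/
  deltaSides : ∀ δ ∈ Δ, ∀ σ ∈ interior δ.range, ∀ᶠ ε : ℝ in 𝓝[>] 0,
    δ.Ξ σ + ε • rot (δ.U σ - δ.Ξ σ) ∈ Ω δ.left ∧ δ.Ξ σ - ε • rot (δ.U σ - δ.Ξ σ) ∈ Ω δ.right
  isContact : ∀ J ∈ Γ, IsContact S J
  contactSides : ∀ J ∈ Γ, ∀ P ∈ J.support, ∀ᶠ ε : ℝ in 𝓝[>] 0,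
    P + ε • rot J.dir ∈ Ω J.left ∧ P - ε • rot J.dir ∈ Ω J.right
  weak : IsWeakSolution S Ω Δ
  /-- There is no vacuum: almost every point lies in a region of positive density. -/
  noVacuum : ∀ᵐ P : ℝ × ℝ, ∃ i, P ∈ Ω i ∧ 0 < (S i).ρ

/-- The delta shock `δ`, with parameter in `(-∞, 0]`, is produced at the point `A` by the incoming
delta shocks of the list: they all reach `A` at parameter `0`, and mass, momenta and energy are
conserved there.  For the empty list it starts with zero weights. -/
def EmergesFrom (δ : DeltaShock) (A : ℝ × ℝ) (incoming : List DeltaShock) : Prop :=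
  δ.range = Iic 0 ∧ δ.Ξ 0 = A ∧ (∀ d ∈ incoming, d.Ξ 0 = A) ∧
    ∀ k, δ.dens k 0 = (incoming.map fun d => d.dens k 0).sum

end ZeroPressure

end

open ZeroPressure

namespace ZeroPressure

/-! The heart of the matter is that the equations of the new delta shock can be solved in closed
form. Fix a particle label `s` and put `τ = t/s = exp (-σ)`. Let `W`, `p`, `X` be mass, momentum and
position at label `s`, divided by `s`, and change the clock by `dτ = W dl`. Then `τ' = W` and `X' =
p` with respect to `l`. The rates `α = (p - W U₃) × (X - τ U₃)` and `β = -(p - W U₂) × (X - τ U₂)`,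
which are the two entropy determinants up to positive factors, satisfy `W' = r₂ β + r₃ α`. The
quantity `(X - τ U₂) × (U₃ - U₂)` is affine in `l`, say `a + c l`, so that `α' = (a + c l) r₂ β` and
`β' = (a + c l) r₃ α`. This linear system is solved by hyperbolic functions of `√(r₂ r₃) (a l + c
l²/2)`. Positive initial rates stay positive, which is the entropy condition for all time. The
masses absorbed from the two sides differ from the ratio `√r₂ : √r₃` by a bounded amount, so
velocity and position tend to `U*₂₃`. A crude bound `W² ≤ C τ³` keeps the weak form integrable. All
this is `nonempty_accretion` and `exists_deltaShock`.

The geometry is governed by the slanted coordinate `ξ + μ η`, whose level lines are parallel to the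
line through `U₂` and `U₃`. The two entropy inequalities together say that it is strictly monotone
along the new shock. Hence this shock, the horizontal waves and the vertical waves all lie on two
graphs `lo` and `hi` over the slanted coordinate, and the three regions are cut out by these graphs
(`Profile`, `exists_profile`).

For the weak form, each region contributes its initial data and the fluxes through its bounding
graphs (`integral_cone_graph`, `sum_integral_region`). Each delta shock, integrated by parts along
its particle paths, contributes what it absorbs and a source at its end `A`
(`integral_integrand_Iic`, `integral_integrand_straight`). Since `Ξ - U_δ` is tangent to the graph,
the absorbed amounts are exactly the jumps of flux (`tri_eq_flux`, `integral_gain`), so everything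
cancels piece by piece. Contact discontinuities have zero flux, and the sources at `A` cancel by
conservation there.

When all `vᵢ` agree, no flux crosses the horizontal line and only `δ₁₂` matters. When two contacts
meet, the new shock is straight and starts with zero weights, and it is written down directly. -/

/-! ### Calculus on half-lines: comparison, inverses, smoothness. -/

/-- Comparison of two functions through their derivatives. -/
theorem le_of_hasDerivAt_le {f g f' g' : ℝ → ℝ} (hf : ∀ x, 0 ≤ x → HasDerivAt f (f' x) x)
    (hg : ∀ x, 0 ≤ x → HasDerivAt g (g' x) x) (h0 : f 0 ≤ g 0)
    (h : ∀ x, 0 ≤ x → f' x ≤ g' x) {x : ℝ} (hx : 0 ≤ x) : f x ≤ g x := by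
  have hd : ∀ y, 0 ≤ y → HasDerivAt (fun y => g y - f y) (g' y - f' y) y :=
    fun y hy => (hg y hy).sub (hf y hy)
  have : MonotoneOn (fun y => g y - f y) (Ici 0) := by
    refine monotoneOn_of_deriv_nonneg (convex_Ici 0)
      (fun y hy => (hd y hy).continuousAt.continuousWithinAt)
      (fun y hy => ?_) (fun y hy => ?_)
    · rw [interior_Ici] at hy
      exact (hd y (le_of_lt hy)).differentiableAt.differentiableWithinAt
    · rw [interior_Ici] at hy
      rw [(hd y (le_of_lt hy)).deriv]
      linarith [h y (le_of_lt hy)]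
  have := this (mem_Ici.2 le_rfl) (mem_Ici.2 hx) hx
  simp only at this
  linarith

/-- Extending `f` to the left of `a` by its tangent line gives an increasing differentiable
bijection of `ℝ`; its inverse therefore has a two-sided derivative even at the endpoint `f a`. It
serves to invert the clock of the new shock and to parametrize the curve by its slanted coordinate.
-/
theorem exists_inverse {f f' : ℝ → ℝ} {a : ℝ}
    (hf : ∀ x, a ≤ x → HasDerivWithinAt f (f' x) (Ici a) x) (hpos : ∀ x, a ≤ x → 0 < f' x)
    (htop : Tendsto f atTop atTop) :
    ∃ g : ℝ → ℝ, Continuous g ∧ Tendsto g atTop atTop ∧ (∀ x, a ≤ x → g (f x) = x) ∧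
      (∀ y, f a ≤ y → a ≤ g y ∧ f (g y) = y) ∧
      ∀ y, f a ≤ y → HasDerivAt g (f' (g y))⁻¹ y := by
  set F : ℝ → ℝ := fun x => if x ≤ a then f a + f' a * (x - a) else f x with hF
  set F' : ℝ → ℝ := fun x => if x ≤ a then f' a else f' x with hF'
  have hFa : ∀ x, a ≤ x → F x = f x := by
    intro x hx
    rcases hx.eq_or_lt with rfl | hx
    · simp [hF]
    · simp [hF, not_le.2 hx]
  have hFa' : ∀ x, a ≤ x → F' x = f' x := by
    intro x hx
    rcases hx.eq_or_lt with rfl | hx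
    · simp [hF']
    · simp [hF', not_le.2 hx]
  have hlin : ∀ x, HasDerivAt (fun x => f a + f' a * (x - a)) (f' a) x := by
    intro x
    simpa using (((hasDerivAt_id x).sub_const a).const_mul (f' a)).const_add (f a)
  have hd : ∀ x, HasDerivAt F (F' x) x := by
    intro x
    rcases lt_trichotomy x a with hx | rfl | hx
    · have : F' x = f' a := by simp [hF', hx.le]
      rw [this]
      refine (hlin x).congr_of_eventuallyEq ?_
      filter_upwards [Iio_mem_nhds hx] with y hy
      simp [hF, (mem_Iio.1 hy).le]
    · rw [hFa' x le_rfl]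
      have h1 : HasDerivWithinAt F (f' x) (Ici x) x :=
        (hf x le_rfl).congr (fun y hy => hFa y hy) (hFa x le_rfl)
      have h2 : HasDerivWithinAt F (f' x) (Iic x) x := by
        refine (hlin x).hasDerivWithinAt.congr (fun y hy => ?_) ?_
        · simp [hF, mem_Iic.1 hy]
        · simp [hF]
      simpa [Iic_union_Ici] using h2.union h1
    · rw [hFa' x hx.le]
      refine ((hf x hx.le).hasDerivAt (Ici_mem_nhds hx)).congr_of_eventuallyEq ?_
      filter_upwards [Ioi_mem_nhds hx] with y hy
      exact hFa y (le_of_lt hy)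
  have hF'pos : ∀ x, 0 < F' x := by
    intro x
    by_cases hx : x ≤ a
    · simpa [hF', hx] using hpos a le_rfl
    · simpa [hF', hx] using hpos x (not_le.1 hx).le
  have hmono : StrictMono F :=
    strictMono_of_deriv_pos fun x => by rw [(hd x).deriv]; exact hF'pos x
  have hcont : Continuous F := continuous_iff_continuousAt.2 fun x => (hd x).continuousAt
  have hFtop : Tendsto F atTop atTop :=
    htop.congr' (by filter_upwards [eventually_ge_atTop a] with x hx using (hFa x hx).symm)
  have hFbot : Tendsto F atBot atBot := by
    have h1 : Tendsto (fun x : ℝ => f a + f' a * (x - a)) atBot atBot := by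
      refine tendsto_atBot_add_const_left _ _ (Tendsto.const_mul_atBot (hpos a le_rfl) ?_)
      exact tendsto_atBot_add_const_right _ _ tendsto_id
    refine h1.congr' ?_
    filter_upwards [eventually_le_atBot a] with x hx
    simp [hF, hx]
  have hsurj : Function.Surjective F := hcont.surjective hFtop hFbot
  set e := hmono.orderIsoOfSurjective F hsurj with he
  have heF : ∀ x, e.symm (F x) = x := hmono.orderIsoOfSurjective_symm_apply_self F hsurj
  have hFe : ∀ y, F (e.symm y) = y := hmono.orderIsoOfSurjective_self_symm_apply F hsurj
  have hea : ∀ y, f a ≤ y → a ≤ e.symm y := by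
    intro y hy
    rw [← hmono.le_iff_le, hFe, hFa a le_rfl]
    exact hy
  have hec : Continuous e.symm := e.symm.continuous
  refine ⟨e.symm, hec, e.symm.tendsto_atTop, fun x hx => ?_, fun y hy => ⟨hea y hy, ?_⟩,
    fun y hy => ?_⟩
  · rw [← hFa x hx, heF]
  · rw [← hFa _ (hea y hy), hFe]
  · have := (hd (e.symm y)).of_local_left_inverse hec.continuousAt (hF'pos _).ne'
      (Eventually.of_forall hFe)
    rwa [hFa' _ (hea y hy)] at this

/-- Smooth functions have smooth antiderivatives. -/
theorem exists_smooth_antideriv {f : ℝ → ℝ} (hf : ContDiff ℝ ∞ f) :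
    ∃ F : ℝ → ℝ, ContDiff ℝ ∞ F ∧ F 0 = 0 ∧ ∀ x, HasDerivAt F (f x) x := by
  have hd : ∀ x, HasDerivAt (fun x => ∫ y in (0 : ℝ)..x, f y) (f x) x := fun x =>
    intervalIntegral.integral_hasDerivAt_right (hf.continuous.intervalIntegrable _ _)
      (hf.continuous.stronglyMeasurableAtFilter _ _) hf.continuous.continuousAt
  refine ⟨_, ?_, by simp, hd⟩
  rw [contDiff_infty_iff_deriv]
  refine ⟨fun x => (hd x).differentiableAt, ?_⟩
  have : deriv (fun x => ∫ y in (0 : ℝ)..x, f y) = f := funext fun x => (hd x).deriv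
  rwa [this]

/-- A solution on `(-∞, 0]` of an autonomous equation with smooth right-hand side is smooth. -/
theorem contDiffOn_of_autonomous {y F : ℝ → ℝ} {s : Set ℝ} (hF : ContDiffOn ℝ ∞ F s)
    (hy : ∀ x ∈ Iic (0 : ℝ), HasDerivWithinAt y (F (y x)) (Iic 0) x)
    (hs : MapsTo y (Iic 0) s) : ContDiffOn ℝ ∞ y (Iic 0) := by
  rw [contDiffOn_infty]
  intro n
  -- The equation gains one derivative at a time: if `y` is `C^n`, then so is its derivative `F ∘
  -- y`.
  induction n with
  | zero => exact contDiffOn_zero.2 fun x hx => (hy x hx).continuousWithinAt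
  | succ n ih =>
    have := (contDiffOn_succ_iff_derivWithin (𝕜 := ℝ) (f := y) (n := n)
      (uniqueDiffOn_Iic (0 : ℝ))).2 ⟨fun x hx => (hy x hx).differentiableWithinAt, by simp, ?_⟩
    · exact_mod_cast this
    · have h1 : ContDiffOn ℝ n (F ∘ y) (Iic 0) :=
        (hF.of_le (by exact_mod_cast le_top)).comp ih hs
      exact h1.congr fun x hx => (hy x hx).derivWithin (uniqueDiffOn_Iic 0 x hx)

/-! ### The accretion system and its closed-form solution. -/

/-- The accumulated masses on the two sides of a growing delta shock and their antiderivatives,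
together with the rates of accumulation. -/
structure Accretion (r₂ r₃ a c α₀ β₀ : ℝ) where
  α : ℝ → ℝ
  β : ℝ → ℝ
  M₂ : ℝ → ℝ
  M₃ : ℝ → ℝ
  N₂ : ℝ → ℝ
  N₃ : ℝ → ℝ
  smooth_M₂ : ContDiff ℝ ∞ M₂
  smooth_M₃ : ContDiff ℝ ∞ M₃
  smooth_N₂ : ContDiff ℝ ∞ N₂
  smooth_N₃ : ContDiff ℝ ∞ N₃
  hα : ∀ l, HasDerivAt α ((a + c * l) * (r₂ * β l)) l
  hβ : ∀ l, HasDerivAt β ((a + c * l) * (r₃ * α l)) l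
  hM₂ : ∀ l, HasDerivAt M₂ (r₂ * β l) l
  hM₃ : ∀ l, HasDerivAt M₃ (r₃ * α l) l
  hN₂ : ∀ l, HasDerivAt N₂ (M₂ l) l
  hN₃ : ∀ l, HasDerivAt N₃ (M₃ l) l
  α_zero : α 0 = α₀
  β_zero : β 0 = β₀
  M₂_zero : M₂ 0 = 0
  M₃_zero : M₃ 0 = 0
  N₂_zero : N₂ 0 = 0
  N₃_zero : N₃ 0 = 0
  α_ge : ∀ l, 0 ≤ l → α₀ ≤ α l
  β_ge : ∀ l, 0 ≤ l → β₀ ≤ β l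
  bounded : ∃ K, ∀ l, 0 ≤ l → |√r₂ * M₃ l - √r₃ * M₂ l| ≤ K

/-- Both rates share the factor `a + c l`, so in the variable `θ`, its antiderivative times `√(r₂
r₃)`, the system has constant coefficients and eigenvalues `1` and `-1`. The solution is a
combination of `cosh θ` and `sinh θ`, and all its coefficients are positive, which gives the lower
bounds. -/
theorem nonempty_accretion {r₂ r₃ a c α₀ β₀ : ℝ} (h₂ : 0 < r₂) (h₃ : 0 < r₃) (ha : 0 < a)
    (hc : 0 < c) (hα₀ : 0 < α₀) (hβ₀ : 0 < β₀) : Nonempty (Accretion r₂ r₃ a c α₀ β₀) := by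
  set p := √r₂ with hp
  set q := √r₃ with hq
  have hp0 : 0 < p := Real.sqrt_pos.2 h₂
  have hq0 : 0 < q := Real.sqrt_pos.2 h₃
  have hpp : r₂ = p * p := (Real.mul_self_sqrt h₂.le).symm
  have hqq : r₃ = q * q := (Real.mul_self_sqrt h₃.le).symm
  set θ : ℝ → ℝ := fun l => p * q * (a * l + c * l ^ 2 / 2) with hθ
  have hθd : ∀ l, HasDerivAt θ (p * q * (a + c * l)) l := by
    intro l
    have h1 := ((hasDerivAt_id l).const_mul a).add
      ((((hasDerivAt_id l).pow 2).const_mul c).div_const 2)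
    have h2 := h1.const_mul (p * q)
    refine h2.congr_deriv ?_
    simp only [id]
    push_cast
    ring
  have hθs : ContDiff ℝ ∞ θ := by fun_prop
  have hθ0 : ∀ l, 0 ≤ l → 0 ≤ θ l := fun l hl => by simp only [hθ]; positivity
  set α : ℝ → ℝ := fun l => α₀ * Real.cosh (θ l) + p / q * β₀ * Real.sinh (θ l) with hα
  set β : ℝ → ℝ := fun l => β₀ * Real.cosh (θ l) + q / p * α₀ * Real.sinh (θ l) with hβ
  have hαs : ContDiff ℝ ∞ α :=
    (contDiff_const.mul (Real.contDiff_cosh.comp hθs)).add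
      (contDiff_const.mul (Real.contDiff_sinh.comp hθs))
  have hβs : ContDiff ℝ ∞ β :=
    (contDiff_const.mul (Real.contDiff_cosh.comp hθs)).add
      (contDiff_const.mul (Real.contDiff_sinh.comp hθs))
  have hαd : ∀ l, HasDerivAt α ((a + c * l) * (r₂ * β l)) l := by
    intro l
    refine (((hθd l).cosh.const_mul α₀).add ((hθd l).sinh.const_mul (p / q * β₀))).congr_deriv ?_
    simp only [hβ]
    rw [hpp]
    field_simp
    ring
  have hβd : ∀ l, HasDerivAt β ((a + c * l) * (r₃ * α l)) l := by
    intro l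
    refine (((hθd l).cosh.const_mul β₀).add ((hθd l).sinh.const_mul (q / p * α₀))).congr_deriv ?_
    simp only [hα]
    rw [hqq]
    field_simp
    ring
  obtain ⟨M₂, hM₂s, hM₂0, hM₂⟩ := exists_smooth_antideriv (contDiff_const (c := r₂) |>.mul hβs)
  obtain ⟨M₃, hM₃s, hM₃0, hM₃⟩ := exists_smooth_antideriv (contDiff_const (c := r₃) |>.mul hαs)
  obtain ⟨N₂, hN₂s, hN₂0, hN₂⟩ := exists_smooth_antideriv hM₂s
  obtain ⟨N₃, hN₃s, hN₃0, hN₃⟩ := exists_smooth_antideriv hM₃s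
  have hbd : ∃ K, ∀ l, 0 ≤ l → |p * M₃ l - q * M₂ l| ≤ K := by
    -- In `q α - p β` the growing mode cancels, so the derivative of `p M₃ - q M₂` is `d exp (-θ)`.
    -- Since `θ l ≥ p q a l`, it is integrable on the half-line.
    set d := p * q * (q * α₀ - p * β₀) with hd
    have h1 : ∀ l, HasDerivAt (fun l => p * M₃ l - q * M₂ l) (d * Real.exp (-θ l)) l := by
      intro l
      refine (((hM₃ l).const_mul p).sub ((hM₂ l).const_mul q)).congr_deriv ?_
      simp only [hα, hβ, Real.cosh_eq, Real.sinh_eq]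
      rw [hpp, hqq, hd]
      field_simp
      ring
    set k := p * q * a with hk
    have hk0 : 0 < k := by positivity
    have h2 : ∀ l, 0 ≤ l → d * Real.exp (-θ l) ≤ |d| * Real.exp (-(k * l)) ∧
        -(d * Real.exp (-θ l)) ≤ |d| * Real.exp (-(k * l)) := by
      intro l hl
      have h3 : Real.exp (-θ l) ≤ Real.exp (-(k * l)) := by
        apply Real.exp_le_exp.2
        have : k * l ≤ θ l := by
          simp only [hθ, hk]
          have : 0 ≤ p * q * (c * l ^ 2 / 2) := by positivity
          nlinarith
        linarith
      have h4 : |d * Real.exp (-θ l)| ≤ |d| * Real.exp (-(k * l)) := by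
        rw [abs_mul, abs_of_pos (Real.exp_pos _)]
        exact mul_le_mul_of_nonneg_left h3 (abs_nonneg _)
      exact ⟨(le_abs_self _).trans h4, (neg_le_abs _).trans h4⟩
    have h3 : ∀ l, HasDerivAt (fun l => |d| / k * (1 - Real.exp (-(k * l))))
        (|d| * Real.exp (-(k * l))) l := by
      intro l
      have := ((((hasDerivAt_id l).const_mul k).neg.exp).const_sub 1).const_mul (|d| / k)
      refine this.congr_deriv ?_
      simp
      field_simp
    refine ⟨|d| / k, fun l hl => ?_⟩
    have h4 : |d| / k * (1 - Real.exp (-(k * l))) ≤ |d| / k := by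
      have h5 : 0 ≤ |d| / k := by positivity
      have h6 := Real.exp_pos (-(k * l))
      nlinarith
    rw [abs_le]
    constructor
    · have := le_of_hasDerivAt_le (f := fun l => -(p * M₃ l - q * M₂ l)) (x := l)
        (fun x _ => (h1 x).neg) (fun x _ => h3 x) (by simp [hM₂0, hM₃0])
        (fun x hx => (h2 x hx).2) hl
      linarith
    · have := le_of_hasDerivAt_le (x := l)
        (fun x _ => h1 x) (fun x _ => h3 x) (by simp [hM₂0, hM₃0]) (fun x hx => (h2 x hx).1) hl
      linarith
  refine ⟨⟨α, β, M₂, M₃, N₂, N₃, hM₂s, hM₃s, hN₂s, hN₃s, hαd, hβd, hM₂, hM₃, hN₂, hN₃,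
    by simp [hα, hθ], by simp [hβ, hθ], hM₂0, hM₃0, hN₂0, hN₃0, fun l hl => ?_, fun l hl => ?_,
    hbd⟩⟩
  · have h1 := Real.one_le_cosh (θ l)
    have h2 : 0 ≤ p / q * β₀ * Real.sinh (θ l) :=
      mul_nonneg (by positivity) (Real.sinh_nonneg_iff.2 (hθ0 l hl))
    simp only [hα]
    nlinarith
  · have h1 := Real.one_le_cosh (θ l)
    have h2 : 0 ≤ q / p * α₀ * Real.sinh (θ l) :=
      mul_nonneg (by positivity) (Real.sinh_nonneg_iff.2 (hθ0 l hl))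
    simp only [hβ]
    nlinarith

/-! ### Mass, momentum and position of the growing shock: identities, growth and limits. -/

namespace Accretion

variable {r₂ r₃ a c α₀ β₀ : ℝ} (E : Accretion r₂ r₃ a c α₀ β₀)

/-- The amount of a conserved quantity carried by a growing delta shock, from its initial amount
and its specific values on the two sides. -/
def total (w₀ w₂ w₃ l : ℝ) : ℝ := w₀ + E.M₂ l * w₂ + E.M₃ l * w₃

/-- The antiderivative of `total` with initial value `b`. -/
def primitive (b w₀ w₂ w₃ l : ℝ) : ℝ := b + w₀ * l + E.N₂ l * w₂ + E.N₃ l * w₃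

theorem hasDerivAt_total (w₀ w₂ w₃ l : ℝ) :
    HasDerivAt (E.total w₀ w₂ w₃) (r₂ * E.β l * w₂ + r₃ * E.α l * w₃) l := by
  have := (((E.hM₂ l).mul_const w₂).const_add w₀).add ((E.hM₃ l).mul_const w₃)
  exact this

theorem hasDerivAt_primitive (b w₀ w₂ w₃ l : ℝ) :
    HasDerivAt (E.primitive b w₀ w₂ w₃) (E.total w₀ w₂ w₃ l) l := by
  have := (((((hasDerivAt_id l).const_mul w₀).const_add b).add ((E.hN₂ l).mul_const w₂)).add
    ((E.hN₃ l).mul_const w₃))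
  refine this.congr_deriv ?_
  simp [total]

theorem contDiff_total (w₀ w₂ w₃ : ℝ) : ContDiff ℝ ∞ (E.total w₀ w₂ w₃) :=
  (contDiff_const.add (E.smooth_M₂.mul contDiff_const)).add (E.smooth_M₃.mul contDiff_const)

theorem contDiff_primitive (b w₀ w₂ w₃ : ℝ) : ContDiff ℝ ∞ (E.primitive b w₀ w₂ w₃) :=
  ((contDiff_const.add (contDiff_const.mul contDiff_id)).add
    (E.smooth_N₂.mul contDiff_const)).add (E.smooth_N₃.mul contDiff_const)

theorem total_zero (w₀ w₂ w₃ : ℝ) : E.total w₀ w₂ w₃ 0 = w₀ := by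
  simp [total, E.M₂_zero, E.M₃_zero]

theorem primitive_zero (b w₀ w₂ w₃ : ℝ) : E.primitive b w₀ w₂ w₃ 0 = b := by
  simp [primitive, E.N₂_zero, E.N₃_zero]

theorem M₂_nonneg (h₂ : 0 < r₂) (hβ₀ : 0 < β₀) {l : ℝ} (hl : 0 ≤ l) : 0 ≤ E.M₂ l := by
  refine le_of_hasDerivAt_le (f := fun _ => 0) (fun x _ => hasDerivAt_const x (0 : ℝ))
    (fun x _ => E.hM₂ x) E.M₂_zero.ge (fun x hx => ?_) hl
  exact mul_nonneg h₂.le (hβ₀.le.trans (E.β_ge x hx))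

theorem M₃_ge (h₃ : 0 < r₃) {l : ℝ} (hl : 0 ≤ l) : r₃ * α₀ * l ≤ E.M₃ l := by
  refine le_of_hasDerivAt_le (f := fun l => r₃ * α₀ * l) (f' := fun _ => r₃ * α₀)
    (fun x _ => by simpa using (hasDerivAt_id x).const_mul (r₃ * α₀))
    (fun x _ => E.hM₃ x) (by simp [E.M₃_zero]) (fun x hx => ?_) hl
  exact mul_le_mul_of_nonneg_left (E.α_ge x hx) h₃.le


/-- The left side is `(p - W U₂) × (X - τ U₂)`. The second factor has the first as derivative, so
that term drops out, and `(p - W U₂)' = r₃ α (U₃ - U₂)`. There remains `-r₃ α (X - τ U₂) × (U₃ -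
U₂)`. In this last product the mass absorbed from state 3 moves `X - τ U₂` along `U₃ - U₂` only and
does not contribute, which leaves the affine function `a + c l`. Thus both sides have the same
derivative, and they agree at `0`. -/
theorem cross_right {a c α₀ β₀ W₀ A₁ A₂ u₀ v₀ u₂ v₂ u₃ v₃ : ℝ} (E : Accretion r₂ r₃ a c α₀ β₀)
    (ha : a = (A₁ - u₂) * (v₃ - v₂) - (A₂ - v₂) * (u₃ - u₂))
    (hc : c = W₀ * ((u₀ - u₂) * (v₃ - v₂) - (v₀ - v₂) * (u₃ - u₂)))
    (hβ₀ : β₀ = -(W₀ * ((u₀ - u₂) * (A₂ - v₀) - (v₀ - v₂) * (A₁ - u₀)))) (l : ℝ) :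
    (E.total (W₀ * u₀) u₂ u₃ l - E.total W₀ 1 1 l * u₂) *
        (E.primitive A₂ (W₀ * v₀) v₂ v₃ l - E.primitive 1 W₀ 1 1 l * v₂) -
      (E.total (W₀ * v₀) v₂ v₃ l - E.total W₀ 1 1 l * v₂) *
        (E.primitive A₁ (W₀ * u₀) u₂ u₃ l - E.primitive 1 W₀ 1 1 l * u₂) = -E.β l := by
  set f : ℝ → ℝ := fun l => (E.total (W₀ * u₀) u₂ u₃ l - E.total W₀ 1 1 l * u₂) *
        (E.primitive A₂ (W₀ * v₀) v₂ v₃ l - E.primitive 1 W₀ 1 1 l * v₂) -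
      (E.total (W₀ * v₀) v₂ v₃ l - E.total W₀ 1 1 l * v₂) *
        (E.primitive A₁ (W₀ * u₀) u₂ u₃ l - E.primitive 1 W₀ 1 1 l * u₂) + E.β l with hf
  have hd : ∀ l, HasDerivAt f 0 l := by
    intro l
    have h := ((((E.hasDerivAt_total (W₀ * u₀) u₂ u₃ l).sub
      ((E.hasDerivAt_total W₀ 1 1 l).mul_const u₂)).mul
      ((E.hasDerivAt_primitive A₂ (W₀ * v₀) v₂ v₃ l).sub
        ((E.hasDerivAt_primitive 1 W₀ 1 1 l).mul_const v₂))).sub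
      (((E.hasDerivAt_total (W₀ * v₀) v₂ v₃ l).sub
      ((E.hasDerivAt_total W₀ 1 1 l).mul_const v₂)).mul
      ((E.hasDerivAt_primitive A₁ (W₀ * u₀) u₂ u₃ l).sub
        ((E.hasDerivAt_primitive 1 W₀ 1 1 l).mul_const u₂)))).add (E.hβ l)
    refine h.congr_deriv ?_
    simp only [Pi.sub_apply, total, primitive]
    linear_combination (r₃ * E.α l) * (ha + l * hc)
  have h0 : f l = f 0 := is_const_of_deriv_eq_zero (fun x => (hd x).differentiableAt)
    (fun x => (hd x).deriv) l 0
  have h1 : f 0 = 0 := by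
    simp only [hf, total_zero, primitive_zero, E.β_zero]
    rw [hβ₀]
    ring
  rw [h1] at h0
  simp only [hf] at h0
  linarith

/-- The mirror image of `cross_right`. The same `a + c l` appears because `X - τ U₂` and `X - τ U₃`
have equal cross products with `U₃ - U₂`. -/
theorem cross_left {a c α₀ β₀ W₀ A₁ A₂ u₀ v₀ u₂ v₂ u₃ v₃ : ℝ} (E : Accretion r₂ r₃ a c α₀ β₀)
    (ha : a = (A₁ - u₂) * (v₃ - v₂) - (A₂ - v₂) * (u₃ - u₂))
    (hc : c = W₀ * ((u₀ - u₂) * (v₃ - v₂) - (v₀ - v₂) * (u₃ - u₂)))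
    (hα₀ : α₀ = W₀ * ((u₀ - u₃) * (A₂ - v₀) - (v₀ - v₃) * (A₁ - u₀))) (l : ℝ) :
    (E.total (W₀ * u₀) u₂ u₃ l - E.total W₀ 1 1 l * u₃) *
        (E.primitive A₂ (W₀ * v₀) v₂ v₃ l - E.primitive 1 W₀ 1 1 l * v₃) -
      (E.total (W₀ * v₀) v₂ v₃ l - E.total W₀ 1 1 l * v₃) *
        (E.primitive A₁ (W₀ * u₀) u₂ u₃ l - E.primitive 1 W₀ 1 1 l * u₃) = E.α l := by
  set f : ℝ → ℝ := fun l => (E.total (W₀ * u₀) u₂ u₃ l - E.total W₀ 1 1 l * u₃) *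
        (E.primitive A₂ (W₀ * v₀) v₂ v₃ l - E.primitive 1 W₀ 1 1 l * v₃) -
      (E.total (W₀ * v₀) v₂ v₃ l - E.total W₀ 1 1 l * v₃) *
        (E.primitive A₁ (W₀ * u₀) u₂ u₃ l - E.primitive 1 W₀ 1 1 l * u₃) - E.α l with hf
  have hd : ∀ l, HasDerivAt f 0 l := by
    intro l
    have h := ((((E.hasDerivAt_total (W₀ * u₀) u₂ u₃ l).sub
      ((E.hasDerivAt_total W₀ 1 1 l).mul_const u₃)).mul
      ((E.hasDerivAt_primitive A₂ (W₀ * v₀) v₂ v₃ l).sub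
        ((E.hasDerivAt_primitive 1 W₀ 1 1 l).mul_const v₃))).sub
      (((E.hasDerivAt_total (W₀ * v₀) v₂ v₃ l).sub
      ((E.hasDerivAt_total W₀ 1 1 l).mul_const v₃)).mul
      ((E.hasDerivAt_primitive A₁ (W₀ * u₀) u₂ u₃ l).sub
        ((E.hasDerivAt_primitive 1 W₀ 1 1 l).mul_const u₃)))).sub (E.hα l)
    refine h.congr_deriv ?_
    simp only [Pi.sub_apply, total, primitive]
    linear_combination -(r₂ * E.β l) * (ha + l * hc)
  have h0 : f l = f 0 := is_const_of_deriv_eq_zero (fun x => (hd x).differentiableAt)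
    (fun x => (hd x).deriv) l 0
  have h1 : f 0 = 0 := by
    simp only [hf, total_zero, primitive_zero, E.α_zero]
    rw [hα₀]
    ring
  rw [h1] at h0
  simp only [hf] at h0
  linarith

theorem mass_ge (h₂ : 0 < r₂) (h₃ : 0 < r₃) (hβ₀ : 0 < β₀) {W₀ l : ℝ} (hl : 0 ≤ l) :
    W₀ + r₃ * α₀ * l ≤ E.total W₀ 1 1 l := by
  have h1 := E.M₂_nonneg h₂ hβ₀ hl
  have h2 := E.M₃_ge h₃ hl
  simp only [total]
  linarith

/-- Time elapses at least quadratically in the parameter. -/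
theorem clock_ge (h₂ : 0 < r₂) (h₃ : 0 < r₃) (hβ₀ : 0 < β₀) {W₀ l : ℝ} (hl : 0 ≤ l) :
    1 + W₀ * l + r₃ * α₀ / 2 * l ^ 2 ≤ E.primitive 1 W₀ 1 1 l := by
  refine le_of_hasDerivAt_le (f := fun l => 1 + W₀ * l + r₃ * α₀ / 2 * l ^ 2)
    (f' := fun l => W₀ + r₃ * α₀ * l) (fun x _ => ?_)
    (fun x _ => E.hasDerivAt_primitive 1 W₀ 1 1 x) (by simp [primitive_zero])
    (fun x hx => E.mass_ge h₂ h₃ hβ₀ hx) hl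
  have := (((hasDerivAt_id x).const_mul W₀).const_add 1).add
    (((hasDerivAt_id x).pow 2).const_mul (r₃ * α₀ / 2))
  refine this.congr_deriv ?_
  simp only [id]
  push_cast
  ring

/-- The mass of the growing delta shock is `O(t^(3/2))`. -/
theorem exists_mass_sq_le (h₂ : 0 < r₂) (h₃ : 0 < r₃) (ha : 0 < a) (hc : 0 < c) (hα₀ : 0 < α₀)
    (hβ₀ : 0 < β₀) {W₀ : ℝ} (hW₀ : 0 < W₀)
    (hsum : ∀ l, E.α l + E.β l = (a + c * l) * E.total W₀ 1 1 l - c * E.primitive 1 W₀ 1 1 l) :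
    ∃ C, 0 ≤ C ∧ ∀ l, 0 ≤ l → E.total W₀ 1 1 l ^ 2 ≤ C * E.primitive 1 W₀ 1 1 l ^ 3 := by
  set W := E.total W₀ 1 1 with hW
  set τ := E.primitive 1 W₀ 1 1 with hτ
  have hW0 : W 0 = W₀ := E.total_zero _ _ _
  have hτ0 : τ 0 = 1 := E.primitive_zero _ _ _ _
  set w : ℝ → ℝ := fun l => r₂ * E.β l * 1 + r₃ * E.α l * 1 with hw
  have hWd : ∀ l, HasDerivAt W (w l) l := E.hasDerivAt_total _ _ _
  have hτd : ∀ l, HasDerivAt τ (W l) l := E.hasDerivAt_primitive _ _ _ _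
  have hxd : ∀ l, HasDerivAt (fun l => a + c * l) c l := fun l => by
    simpa using ((hasDerivAt_id l).const_mul c).const_add a
  have hw₀ : ∀ l, 0 ≤ l → r₃ * α₀ ≤ w l := by
    intro l hl
    have h1 := E.α_ge l hl
    have h2 := E.β_ge l hl
    simp only [hw]
    nlinarith [mul_le_mul_of_nonneg_left h1 h₃.le, mul_pos h₂ (hβ₀.trans_le h2)]
  have hWpos : ∀ l, 0 ≤ l → 0 < W l := by
    intro l hl
    have := E.mass_ge h₂ h₃ hβ₀ (W₀ := W₀) hl
    have h2 : 0 ≤ r₃ * α₀ * l := by positivity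
    linarith
  have hτ1 : ∀ l, 0 ≤ l → 1 ≤ τ l := by
    intro l hl
    have := E.clock_ge h₂ h₃ hβ₀ (W₀ := W₀) hl
    have h2 : 0 ≤ W₀ * l + r₃ * α₀ / 2 * l ^ 2 := by positivity
    linarith
  set R := r₂ + r₃ with hR
  have hR0 : 0 < R := by positivity
  -- The rate of mass gain is at most `R (α + β)`, and in `hsum` the term `-c τ` is negative.
  have hwle : ∀ l, 0 ≤ l → w l ≤ R * ((a + c * l) * W l) := by
    intro l hl
    have h1 := E.α_ge l hl
    have h2 := E.β_ge l hl
    have h3 := hsum l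
    have h4 := hτ1 l hl
    have h5 : E.α l + E.β l ≤ (a + c * l) * W l := by
      rw [h3]
      nlinarith
    have h6 : w l ≤ R * (E.α l + E.β l) := by
      simp only [hw, hR]
      nlinarith [mul_pos h₂ (hα₀.trans_le h1), mul_pos h₃ (hβ₀.trans_le h2)]
    exact h6.trans (mul_le_mul_of_nonneg_left h5 hR0.le)
  -- A ladder of comparisons: `a + c l` is bounded by `W`, hence `(a + c l)²` by `τ`, hence `(a + c
  -- l) W` by `τ²`, hence `W²` by `τ³`. Each `Cᵢ` is chosen so that the inequality holds at `0` and
  -- between the derivatives, where the preceding rung is used.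
  set C₁ := a / W₀ + c / (r₃ * α₀) with hC₁
  have hC₁0 : 0 < C₁ := by positivity
  have s1 : ∀ l, 0 ≤ l → a + c * l ≤ C₁ * W l := fun l hl => by
    refine le_of_hasDerivAt_le (g := fun l => C₁ * W l) (fun x _ => hxd x)
      (fun x _ => (hWd x).const_mul C₁) ?_ (fun x hx => ?_) hl
    · simp only [hW0, hC₁]
      have : a / W₀ * W₀ = a := by field_simp
      have h2 : 0 ≤ c / (r₃ * α₀) * W₀ := by positivity
      nlinarith
    · have h1 := mul_le_mul_of_nonneg_left (hw₀ x hx) hC₁0.le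
      have h2 : c / (r₃ * α₀) * (r₃ * α₀) = c := by field_simp
      have h3 : 0 ≤ a / W₀ * (r₃ * α₀) := by positivity
      simp only [hC₁] at h1 ⊢
      nlinarith
  set C₂ := a ^ 2 + 2 * c * C₁ with hC₂
  have s2 : ∀ l, 0 ≤ l → (a + c * l) ^ 2 ≤ C₂ * τ l := fun l hl => by
    refine le_of_hasDerivAt_le (f := fun l => (a + c * l) ^ 2) (g := fun l => C₂ * τ l)
      (fun x _ => (hxd x).pow 2)
      (fun x _ => (hτd x).const_mul C₂) ?_ (fun x hx => ?_) hl
    · simp only [hτ0, hC₂]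
      have : 0 ≤ 2 * c * C₁ := by positivity
      nlinarith
    · have h1 := s1 x hx
      have h2 := hWpos x hx
      have h3 : 0 ≤ a ^ 2 * W x := by positivity
      have h4 := mul_le_mul_of_nonneg_left h1 hc.le
      push_cast
      simp only [hC₂]
      nlinarith
  set C₃ := a * W₀ + c + R * C₂ with hC₃
  have s3 : ∀ l, 0 ≤ l → (a + c * l) * W l ≤ C₃ * τ l ^ 2 := fun l hl => by
    refine le_of_hasDerivAt_le (f := fun l => (a + c * l) * W l) (g := fun l => C₃ * τ l ^ 2)
      (fun x _ => (hxd x).mul (hWd x))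
      (fun x _ => ((hτd x).pow 2).const_mul C₃) ?_ (fun x hx => ?_) hl
    · simp only [hτ0, hW0, hC₃]
      have h2 : 0 ≤ C₂ := by positivity
      have : 0 ≤ R * C₂ := by positivity
      nlinarith
    · have h1 := s2 x hx
      have h2 := hWpos x hx
      have h3 := hτ1 x hx
      have h4 := hwle x hx
      have hx0 : 0 < a + c * x := by positivity
      have h5 : (a + c * x) * w x ≤ R * C₂ * (τ x * W x) := by
        calc (a + c * x) * w x ≤ (a + c * x) * (R * ((a + c * x) * W x)) :=
              mul_le_mul_of_nonneg_left h4 hx0.le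
          _ = R * W x * (a + c * x) ^ 2 := by ring
          _ ≤ R * W x * (C₂ * τ x) := mul_le_mul_of_nonneg_left h1 (by positivity)
          _ = _ := by ring
      have h6 : c * W x ≤ c * (τ x * W x) := by
        refine mul_le_mul_of_nonneg_left ?_ hc.le
        nlinarith
      have h7 : 0 ≤ τ x * W x := by nlinarith
      have h8 : 0 ≤ a * W₀ := by positivity
      have h9 : 0 ≤ C₂ := by positivity
      have h10 : 0 ≤ C₃ * (τ x * W x) := by positivity
      have h11 : c * W x + (a + c * x) * w x ≤ C₃ * (τ x * W x) := by
        simp only [hC₃]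
        nlinarith [mul_nonneg h8 h7]
      push_cast
      nlinarith
  set C₄ := W₀ ^ 2 + R * C₃ with hC₄
  have hC₃0 : 0 ≤ C₃ := by positivity
  refine ⟨C₄, by positivity, fun l hl => ?_⟩
  refine le_of_hasDerivAt_le (f := fun l => W l ^ 2) (g := fun l => C₄ * τ l ^ 3)
    (fun x _ => (hWd x).pow 2)
    (fun x _ => ((hτd x).pow 3).const_mul C₄) ?_ (fun x hx => ?_) hl
  · simp only [hτ0, hW0, hC₄]
    have : 0 ≤ R * C₃ := by positivity
    nlinarith
  · have h1 := s3 x hx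
    have h2 := hWpos x hx
    have h3 := hτ1 x hx
    have h4 := hwle x hx
    have h5 : w x ≤ R * C₃ * τ x ^ 2 := by
      have := mul_le_mul_of_nonneg_left h1 hR0.le
      linarith
    have h6 : W x * w x ≤ W x * (R * C₃ * τ x ^ 2) := mul_le_mul_of_nonneg_left h5 h2.le
    have h7 : 0 ≤ W₀ ^ 2 * (W x * τ x ^ 2) := by positivity
    have h8 : 0 ≤ R * C₃ * (W x * τ x ^ 2) := by positivity
    have h9 : 2 * (W x * w x) ≤ 3 * (C₄ * (W x * τ x ^ 2)) := by
      rw [hC₄, add_mul]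
      linarith
    calc ((2 : ℕ) : ℝ) * W x ^ (2 - 1) * w x = 2 * (W x * w x) := by push_cast; ring
      _ ≤ 3 * (C₄ * (W x * τ x ^ 2)) := h9
      _ = C₄ * (((3 : ℕ) : ℝ) * τ x ^ (3 - 1) * W x) := by push_cast; ring

/-- In a growing delta shock the excess of momentum over its value at the limiting velocity is
bounded. -/
theorem exists_momentum_bound (h₂ : 0 < r₂) (h₃ : 0 < r₃) (W₀ y₀ y₂ y₃ y : ℝ)
    (hy : (√r₂ + √r₃) * y = √r₂ * y₂ + √r₃ * y₃) :
    ∃ K, 0 ≤ K ∧ ∀ l, 0 ≤ l → |E.total (W₀ * y₀) y₂ y₃ l - E.total W₀ 1 1 l * y| ≤ K := by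
  obtain ⟨K, hK⟩ := E.bounded
  have hp : 0 < √r₂ + √r₃ := by positivity
  refine ⟨|W₀ * (y₀ - y)| + K * |y₃ - y₂| / (√r₂ + √r₃), ?_, fun l hl => ?_⟩
  · have := (abs_nonneg _).trans (hK 0 le_rfl)
    positivity
  -- Since `y` is the `√r₂, √r₃`-weighted mean of `y₂` and `y₃`, the absorbed excess is a multiple
  -- of `√r₂ M₃ - √r₃ M₂`, which is bounded.
  have h1 : E.total (W₀ * y₀) y₂ y₃ l - E.total W₀ 1 1 l * y
      = W₀ * (y₀ - y) + (√r₂ * E.M₃ l - √r₃ * E.M₂ l) * (y₃ - y₂) / (√r₂ + √r₃) := by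
    have h2 : y = (√r₂ * y₂ + √r₃ * y₃) / (√r₂ + √r₃) := by
      rw [eq_div_iff hp.ne']
      linarith
    rw [h2]
    simp only [total]
    field_simp
    ring
  rw [h1]
  refine (abs_add_le _ _).trans (add_le_add le_rfl ?_)
  rw [abs_div, abs_mul, abs_of_pos hp]
  gcongr
  exact hK l hl

/-- The excess momentum is bounded while the mass grows at least linearly in `l`. -/
theorem tendsto_velocity (h₂ : 0 < r₂) (h₃ : 0 < r₃) (hα₀ : 0 < α₀) (hβ₀ : 0 < β₀) {W₀ : ℝ}
    (hW₀ : 0 < W₀) (y₀ y₂ y₃ y : ℝ) (hy : (√r₂ + √r₃) * y = √r₂ * y₂ + √r₃ * y₃) :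
    Tendsto (fun l => (E.total W₀ 1 1 l)⁻¹ * E.total (W₀ * y₀) y₂ y₃ l) atTop (𝓝 y) := by
  obtain ⟨K, hK0, hK⟩ := E.exists_momentum_bound h₂ h₃ W₀ y₀ y₂ y₃ y hy
  have hlin : Tendsto (fun l => W₀ + r₃ * α₀ * l) atTop atTop :=
    tendsto_atTop_add_const_left _ _ (tendsto_id.const_mul_atTop (by positivity))
  have h0 : Tendsto (fun l => K * (W₀ + r₃ * α₀ * l)⁻¹) atTop (𝓝 0) := by
    simpa using hlin.inv_tendsto_atTop.const_mul K
  rw [tendsto_iff_norm_sub_tendsto_zero]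
  refine squeeze_zero' (Eventually.of_forall fun _ => norm_nonneg _) ?_ h0
  filter_upwards [eventually_ge_atTop 0] with l hl
  have h1 := E.mass_ge h₂ h₃ hβ₀ (W₀ := W₀) hl
  have h2 : 0 < W₀ + r₃ * α₀ * l := by positivity
  have h3 : 0 < E.total W₀ 1 1 l := h2.trans_le h1
  have h4 : (E.total W₀ 1 1 l)⁻¹ * E.total (W₀ * y₀) y₂ y₃ l - y
      = (E.total (W₀ * y₀) y₂ y₃ l - E.total W₀ 1 1 l * y) * (E.total W₀ 1 1 l)⁻¹ := by
    field_simp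
  rw [h4, Real.norm_eq_abs, abs_mul, abs_of_pos (inv_pos.2 h3)]
  gcongr
  exact hK l hl

/-- The integrated excess of momentum grows at most linearly in `l`, while the elapsed time grows at
least quadratically. -/
theorem tendsto_position (h₂ : 0 < r₂) (h₃ : 0 < r₃) (hα₀ : 0 < α₀) (hβ₀ : 0 < β₀) {W₀ : ℝ}
    (hW₀ : 0 < W₀) (b y₀ y₂ y₃ y : ℝ) (hy : (√r₂ + √r₃) * y = √r₂ * y₂ + √r₃ * y₃) :
    Tendsto (fun l => (E.primitive 1 W₀ 1 1 l)⁻¹ * E.primitive b (W₀ * y₀) y₂ y₃ l) atTop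
      (𝓝 y) := by
  obtain ⟨K, hK0, hK⟩ := E.exists_momentum_bound h₂ h₃ W₀ y₀ y₂ y₃ y hy
  set B := |b - y| with hB
  have hB0 : 0 ≤ B := abs_nonneg _
  have hbd : ∀ l, 0 ≤ l →
      |E.primitive b (W₀ * y₀) y₂ y₃ l - E.primitive 1 W₀ 1 1 l * y| ≤ B + K * l := by
    intro l hl
    have hd : ∀ l, HasDerivAt
        (fun l => E.primitive b (W₀ * y₀) y₂ y₃ l - E.primitive 1 W₀ 1 1 l * y)
        (E.total (W₀ * y₀) y₂ y₃ l - E.total W₀ 1 1 l * y) l := fun l =>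
      (E.hasDerivAt_primitive _ _ _ _ l).sub ((E.hasDerivAt_primitive _ _ _ _ l).mul_const y)
    have hd2 : ∀ l, HasDerivAt (fun l => B + K * l) K l := fun l => by
      simpa using ((hasDerivAt_id l).const_mul K).const_add B
    rw [abs_le]
    constructor
    · have := le_of_hasDerivAt_le
        (f := fun l => -(E.primitive b (W₀ * y₀) y₂ y₃ l - E.primitive 1 W₀ 1 1 l * y))
        (fun x _ => (hd x).neg) (fun x _ => hd2 x)
        (by simpa [primitive_zero] using neg_le_abs (b - y))
        (fun x hx => (neg_le_abs _).trans (hK x hx)) hl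
      linarith
    · exact le_of_hasDerivAt_le (fun x _ => hd x) (fun x _ => hd2 x)
        (by simpa [primitive_zero] using le_abs_self (b - y))
        (fun x hx => (le_abs_self _).trans (hK x hx)) hl
  set w := r₃ * α₀ / 2 with hw
  have hw0 : 0 < w := by positivity
  -- The constant comes from `(B + K l)(1 + l) ≤ 2 (B + K)(1 + l²)` and `1 + l² ≤ (1 + 1/w)(1 + w
  -- l²)`.
  set C := 2 * (B + K) * (1 + 1 / w) with hC
  have h0 : Tendsto (fun l : ℝ => C * (1 + l)⁻¹) atTop (𝓝 0) := by
    have h1 : Tendsto (fun l : ℝ => 1 + l) atTop atTop :=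
      tendsto_atTop_add_const_left _ _ tendsto_id
    simpa using h1.inv_tendsto_atTop.const_mul C
  rw [tendsto_iff_norm_sub_tendsto_zero]
  refine squeeze_zero' (Eventually.of_forall fun _ => norm_nonneg _) ?_ h0
  filter_upwards [eventually_ge_atTop 0] with l hl
  have h1 := E.clock_ge h₂ h₃ hβ₀ (W₀ := W₀) hl
  rw [← hw] at h1
  have h2 : 1 + w * l ^ 2 ≤ E.primitive 1 W₀ 1 1 l := by
    have : 0 ≤ W₀ * l := by positivity
    linarith
  have h3 : 0 < E.primitive 1 W₀ 1 1 l := lt_of_lt_of_le (by positivity) h2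
  have h4 : (E.primitive 1 W₀ 1 1 l)⁻¹ * E.primitive b (W₀ * y₀) y₂ y₃ l - y
      = (E.primitive b (W₀ * y₀) y₂ y₃ l - E.primitive 1 W₀ 1 1 l * y) /
        E.primitive 1 W₀ 1 1 l := by
    field_simp
  rw [h4, Real.norm_eq_abs, abs_div, abs_of_pos h3, div_le_iff₀ h3]
  refine (hbd l hl).trans ?_
  have h5 : (B + K * l) * (1 + l) ≤ C * (1 + w * l ^ 2) := by
    have e1 : (1 + 1 / w) * (1 + w * l ^ 2) = 1 + l ^ 2 + w * l ^ 2 + 1 / w := by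
      field_simp
      ring
    have e2 : B + K * l ≤ (B + K) * (1 + l) := by nlinarith
    have e3 : (B + K) * (1 + l) * (1 + l) ≤ (B + K) * (2 * (1 + l ^ 2)) := by
      rw [mul_assoc]
      refine mul_le_mul_of_nonneg_left ?_ (by positivity)
      nlinarith [sq_nonneg (l - 1)]
    have e4 : (B + K) * (2 * (1 + l ^ 2)) ≤ C * (1 + w * l ^ 2) := by
      have : C * (1 + w * l ^ 2) = (B + K) * (2 * (1 + l ^ 2 + w * l ^ 2 + 1 / w)) := by
        rw [← e1, hC]; ring
      rw [this]
      refine mul_le_mul_of_nonneg_left ?_ (by positivity)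
      have : 0 ≤ w * l ^ 2 + 1 / w := by positivity
      linarith
    have e5 : (B + K * l) * (1 + l) ≤ (B + K) * (1 + l) * (1 + l) :=
      mul_le_mul_of_nonneg_right e2 (by positivity)
    linarith
  have hl1 : 0 < 1 + l := by positivity
  have hC0 : 0 ≤ C := by positivity
  calc B + K * l = (B + K * l) * (1 + l) * (1 + l)⁻¹ := by field_simp
    _ ≤ C * (1 + w * l ^ 2) * (1 + l)⁻¹ := by gcongr
    _ ≤ C * E.primitive 1 W₀ 1 1 l * (1 + l)⁻¹ := by gcongr
    _ = _ := by ring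

end Accretion

/-! ### The curved delta shock built from the accretion system. -/

theorem tri_eq (P Q R : ℝ × ℝ) :
    tri P Q R = (Q.1 - P.1) * (R.2 - Q.2) - (Q.2 - P.2) * (R.1 - Q.1) := by
  simp [tri, Matrix.det_fin_three]
  ring

theorem avg_fst (L R : GasState) : (avg L R).1 = (√L.ρ * L.u + √R.ρ * R.u) / (√L.ρ + √R.ρ) := by
  simp [avg, GasState.vel]
  field_simp

theorem avg_snd (L R : GasState) : (avg L R).2 = (√L.ρ * L.v + √R.ρ * R.v) / (√L.ρ + √R.ρ) := by
  simp [avg, GasState.vel]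
  field_simp

/-- The weights of a delta shock are `O(e^(-σ/2))` as `σ → -∞`. -/
def DeltaShock.SlowGrowth (δ : DeltaShock) : Prop :=
  ∃ C, ∀ k, ∀ σ ≤ 0, |δ.dens k σ| ≤ C * Real.exp (-σ / 2)

/-- Along a delta shock the cross product of the curve with the jump of velocity is monotone;
in particular the curve is simple. -/
theorem strictMonoOn_cross {Ξ U : ℝ → ℝ × ℝ} {L R : ℝ × ℝ} {I : Set ℝ} (hI : Convex ℝ I)
    (hΞ : ∀ σ ∈ I, HasDerivWithinAt Ξ (Ξ σ - U σ) I σ)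
    (hent : ∀ σ ∈ I, 0 < tri L (U σ) (Ξ σ) ∧ tri R (U σ) (Ξ σ) < 0) :
    StrictMonoOn (fun σ => cross (R - L) (Ξ σ)) I := by
  have hd : ∀ σ ∈ I, HasDerivWithinAt (fun σ => cross (R - L) (Ξ σ))
      (cross (R - L) (Ξ σ - U σ)) I σ := by
    intro σ hσ
    have h1 := (hasFDerivAt_fst (𝕜 := ℝ) (p := Ξ σ)).comp_hasDerivWithinAt σ (hΞ σ hσ)
    have h2 := (hasFDerivAt_snd (𝕜 := ℝ) (p := Ξ σ)).comp_hasDerivWithinAt σ (hΞ σ hσ)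
    exact (h2.const_mul (R - L).1).sub (h1.const_mul (R - L).2)
  refine strictMonoOn_of_deriv_pos hI (fun σ hσ => (hd σ hσ).continuousWithinAt) fun σ hσ => ?_
  have hσ' := interior_subset hσ
  rw [((hd σ hσ').hasDerivAt (mem_interior_iff_mem_nhds.1 hσ)).deriv]
  -- The difference of the two entropy determinants is `(R - L) × (Ξ - U)`, the derivative in
  -- question.
  obtain ⟨h1, h2⟩ := hent σ hσ'
  rw [tri_eq] at h1 h2
  simp only [cross, Prod.fst_sub, Prod.snd_sub]
  nlinarith

/-- The absorbed masses are nonnegative and sum with `W₀` to the total mass, so every conserved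
amount is controlled by the mass alone. -/
theorem Accretion.abs_total_le {r₂ r₃ a c α₀ β₀ : ℝ} (E : Accretion r₂ r₃ a c α₀ β₀) (h₂ : 0 < r₂)
    (h₃ : 0 < r₃) (hα₀ : 0 < α₀) (hβ₀ : 0 < β₀) {W₀ : ℝ} (hW₀ : 0 < W₀) {d w₂ w₃ l : ℝ}
    (hl : 0 ≤ l) :
    |E.total d w₂ w₃ l| ≤ (|d| / W₀ + |w₂| + |w₃|) * E.total W₀ 1 1 l := by
  have hM₂ := E.M₂_nonneg h₂ hβ₀ hl
  have hM₃ : 0 ≤ E.M₃ l := le_trans (by positivity) (E.M₃_ge h₃ hl)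
  have h2 : |E.total d w₂ w₃ l| ≤ |d| + E.M₂ l * |w₂| + E.M₃ l * |w₃| := by
    refine (abs_add_le _ _).trans (add_le_add ((abs_add_le _ _).trans (add_le_add le_rfl ?_)) ?_)
    · rw [abs_mul, abs_of_nonneg hM₂]
    · rw [abs_mul, abs_of_nonneg hM₃]
  have h3 : (|d| / W₀ + |w₂| + |w₃|) * E.total W₀ 1 1 l = |d| + E.M₂ l * |w₂| + E.M₃ l * |w₃| +
      (|d| / W₀ * (E.M₂ l + E.M₃ l) + |w₂| * (W₀ + E.M₃ l) + |w₃| * (W₀ + E.M₂ l)) := by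
    simp only [Accretion.total]
    field_simp
    ring
  rw [h3]
  exact h2.trans (le_add_of_nonneg_right (by positivity))

-- The hypotheses `hA` and `hU` make the affine coefficient `a + c l` positive on `l ≥ 0`, `hL` and
-- `hR` are the entropy condition at the starting point and make the initial rates positive, and
-- `he₀` says that the initial internal energy is positive. The shock is then read off from the
-- accretion system: `Ξ = X/τ`, `U = p/W`, `m = W/τ`, with `τ = exp (-σ)`.
set_option maxHeartbeats 1000000 in
theorem exists_deltaShock (S : Fin 3 → GasState) (hρ : ∀ i, 0 < (S i).ρ) (hH : ∀ i, 0 ≤ (S i).H)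
    (A U₀ : ℝ × ℝ) (W₀ e₀ : ℝ) (hW₀ : 0 < W₀) (he₀ : 0 < e₀ - W₀ / 2 * nsq U₀)
    (hA : 0 < cross (A - (S i₂).vel) ((S i₃).vel - (S i₂).vel))
    (hU : 0 < cross (U₀ - (S i₂).vel) ((S i₃).vel - (S i₂).vel))
    (hL : 0 < tri (S i₃).vel U₀ A) (hR : tri (S i₂).vel U₀ A < 0) :
    ∃ δ : DeltaShock, δ.left = i₃ ∧ δ.right = i₂ ∧ δ.range = Iic 0 ∧ δ.Ξ 0 = A ∧ δ.U 0 = U₀ ∧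
      (∀ k, δ.dens k 0 = ![W₀, W₀ * U₀.1, W₀ * U₀.2, e₀] k) ∧ IsDeltaShock S δ ∧
      δ.TerminatesAt (avg (S i₂) (S i₃)) ∧ δ.SlowGrowth := by
  obtain ⟨A₁, A₂⟩ := A
  obtain ⟨u₀, v₀⟩ := U₀
  rw [tri_eq] at hL hR
  simp only [cross, GasState.vel, Prod.fst_sub, Prod.snd_sub] at hA hU hL hR
  simp only [nsq] at he₀
  set u₂ := (S i₂).u with hu₂
  set v₂ := (S i₂).v with hv₂
  set u₃ := (S i₃).u with hu₃
  set v₃ := (S i₃).v with hv₃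
  set r₂ := (S i₂).ρ with hr₂
  set r₃ := (S i₃).ρ with hr₃
  have h₂ : 0 < r₂ := hρ _
  have h₃ : 0 < r₃ := hρ _
  -- `a` and `c` are the initial value and the constant slope of `(X - τ U₂) × (U₃ - U₂)`; `α₀` and
  -- `β₀` are the initial rates of absorption divided by the densities.
  obtain ⟨a, ha⟩ : ∃ a, a = (A₁ - u₂) * (v₃ - v₂) - (A₂ - v₂) * (u₃ - u₂) := ⟨_, rfl⟩
  obtain ⟨c, hc⟩ : ∃ c, c = W₀ * ((u₀ - u₂) * (v₃ - v₂) - (v₀ - v₂) * (u₃ - u₂)) := ⟨_, rfl⟩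
  obtain ⟨α₀, hα₀⟩ : ∃ α₀, α₀ = W₀ * ((u₀ - u₃) * (A₂ - v₀) - (v₀ - v₃) * (A₁ - u₀)) := ⟨_, rfl⟩
  obtain ⟨β₀, hβ₀⟩ : ∃ β₀, β₀ = -(W₀ * ((u₀ - u₂) * (A₂ - v₀) - (v₀ - v₂) * (A₁ - u₀))) :=
    ⟨_, rfl⟩
  have ha0 : 0 < a := ha ▸ hA
  have hc0 : 0 < c := hc ▸ mul_pos hW₀ hU
  have hα0 : 0 < α₀ := hα₀ ▸ mul_pos hW₀ hL
  have hβ0 : 0 < β₀ := by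
    have := mul_pos_of_neg_of_neg (neg_lt_zero.2 hW₀) hR
    rw [hβ₀]; linarith
  obtain ⟨E⟩ := nonempty_accretion h₂ h₃ ha0 hc0 hα0 hβ0
  set W := E.total W₀ 1 1 with hW
  set τ := E.primitive 1 W₀ 1 1 with hτ
  set p₁ := E.total (W₀ * u₀) u₂ u₃ with hp₁
  set p₂ := E.total (W₀ * v₀) v₂ v₃ with hp₂
  set X₁ := E.primitive A₁ (W₀ * u₀) u₂ u₃ with hX₁
  set X₂ := E.primitive A₂ (W₀ * v₀) v₂ v₃ with hX₂
  set ε₂ := (S i₂).dens 3 / r₂ with hε₂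
  set ε₃ := (S i₃).dens 3 / r₃ with hε₃
  set e := E.total e₀ ε₂ ε₃ with he
  have hτ0 : τ 0 = 1 := E.primitive_zero _ _ _ _
  have hW0 : W 0 = W₀ := E.total_zero _ _ _
  have hτd : ∀ l, HasDerivAt τ (W l) l := E.hasDerivAt_primitive _ _ _ _
  have hX₁d : ∀ l, HasDerivAt X₁ (p₁ l) l := E.hasDerivAt_primitive _ _ _ _
  have hX₂d : ∀ l, HasDerivAt X₂ (p₂ l) l := E.hasDerivAt_primitive _ _ _ _
  have hWpos : ∀ l, 0 ≤ l → 0 < W l := by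
    intro l hl
    have h1 := E.mass_ge h₂ h₃ hβ0 (W₀ := W₀) hl
    have h2 : 0 ≤ r₃ * α₀ * l := by positivity
    linarith
  have hτpos : ∀ l, 0 ≤ l → 1 + W₀ * l ≤ τ l := by
    intro l hl
    have h1 := E.clock_ge h₂ h₃ hβ0 (W₀ := W₀) hl
    have h2 : 0 ≤ r₃ * α₀ / 2 * l ^ 2 := by positivity
    linarith
  have hτtop : Tendsto τ atTop atTop := by
    refine tendsto_atTop_mono' _ ?_
      (tendsto_atTop_add_const_left _ (1 : ℝ) (tendsto_id.const_mul_atTop hW₀))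
    filter_upwards [eventually_ge_atTop 0] with l hl using hτpos l hl
  -- The clock `τ` is increasing with derivative `W`, so `τ l = exp (-σ)` can be solved for `l = Λ
  -- σ`.
  obtain ⟨lam, -, hlamtop, hlam1, hlam2, hlamd⟩ :=
    exists_inverse (a := 0) (fun l _ => (hτd l).hasDerivWithinAt) hWpos hτtop
  rw [hτ0] at hlam2 hlamd
  set Λ : ℝ → ℝ := fun σ => lam (Real.exp (-σ)) with hΛ
  have hexp : ∀ σ : ℝ, σ ≤ 0 → 1 ≤ Real.exp (-σ) := fun σ hσ =>
    Real.one_le_exp (by linarith)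
  have hΛ0 : ∀ σ, σ ≤ 0 → 0 ≤ Λ σ := fun σ hσ => (hlam2 _ (hexp σ hσ)).1
  have hτΛ : ∀ σ, σ ≤ 0 → τ (Λ σ) = Real.exp (-σ) := fun σ hσ => (hlam2 _ (hexp σ hσ)).2
  have hΛz : Λ 0 = 0 := by
    have := hlam1 0 le_rfl
    rw [hτ0] at this
    simpa [hΛ] using this
  have hΛd : ∀ σ, σ ≤ 0 → HasDerivAt Λ (-(τ (Λ σ)) / W (Λ σ)) σ := by
    intro σ hσ
    have h1 : HasDerivAt (fun σ : ℝ => Real.exp (-σ)) (Real.exp (-σ) * (-1)) σ :=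
      (hasDerivAt_neg σ).exp
    refine ((hlamd _ (hexp σ hσ)).comp σ h1).congr_deriv ?_
    rw [hτΛ σ hσ]
    change (W (Λ σ))⁻¹ * _ = _
    ring
  have hΛtop : Tendsto Λ atBot atTop :=
    hlamtop.comp (Real.tendsto_exp_atTop.comp tendsto_neg_atBot_atTop)
  have hWs : ContDiff ℝ ∞ W := E.contDiff_total _ _ _
  have hτs : ContDiff ℝ ∞ τ := E.contDiff_primitive _ _ _ _
  -- `Λ` solves the autonomous equation `Λ' = -τ(Λ)/W(Λ)`, which gives smoothness up to the endpoint
  -- `σ = 0`.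
  have hΛs : ContDiffOn ℝ ∞ Λ (Iic 0) :=
    contDiffOn_of_autonomous (F := fun l => -(τ l) / W l) (s := Ici 0)
      (hτs.neg.contDiffOn.div hWs.contDiffOn fun l hl => (hWpos l hl).ne')
      (fun σ hσ => (hΛd σ hσ).hasDerivWithinAt) hΛ0
  have hcomp : ∀ {f : ℝ → ℝ}, ContDiff ℝ ∞ f → ContDiffOn ℝ ∞ (fun σ => f (Λ σ)) (Iic 0) :=
    fun hf => hf.comp_contDiffOn hΛs
  have hW' : ∀ σ ∈ Iic (0 : ℝ), W (Λ σ) ≠ 0 := fun σ hσ => (hWpos _ (hΛ0 σ hσ)).ne'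
  have hp₁s : ContDiff ℝ ∞ p₁ := E.contDiff_total _ _ _
  have hp₂s : ContDiff ℝ ∞ p₂ := E.contDiff_total _ _ _
  have hexps : ContDiffOn ℝ ∞ Real.exp (Iic 0) := Real.contDiff_exp.contDiffOn
  have hinv : ∀ {f : ℝ → ℝ}, ContDiff ℝ ∞ f →
      ContDiffOn ℝ ∞ (fun σ => (W (Λ σ))⁻¹ * f (Λ σ)) (Iic 0) :=
    fun hf => ((hcomp hWs).inv hW').mul (hcomp hf)
  have hαpos : ∀ l, 0 ≤ l → 0 < E.α l := fun l hl => hα0.trans_le (E.α_ge l hl)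
  have hβpos : ∀ l, 0 ≤ l → 0 < E.β l := fun l hl => hβ0.trans_le (E.β_ge l hl)
  have hcl : ∀ l, (p₁ l - W l * u₃) * (X₂ l - τ l * v₃) - (p₂ l - W l * v₃) * (X₁ l - τ l * u₃)
      = E.α l := E.cross_left ha hc hα₀
  have hcr : ∀ l, (p₁ l - W l * u₂) * (X₂ l - τ l * v₂) - (p₂ l - W l * v₂) * (X₁ l - τ l * u₂)
      = -E.β l := E.cross_right ha hc hβ₀
  set Ξ : ℝ → ℝ × ℝ := fun σ => (Real.exp σ * X₁ (Λ σ), Real.exp σ * X₂ (Λ σ)) with hΞ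
  set U : ℝ → ℝ × ℝ := fun σ => ((W (Λ σ))⁻¹ * p₁ (Λ σ), (W (Λ σ))⁻¹ * p₂ (Λ σ)) with hUdef
  -- The weight `n` is the total energy less the kinetic energy `|p|²/(2W)`, so that the fourth
  -- density is `exp σ * e`, of the same form as the other three.
  set δ : DeltaShock := ⟨i₃, i₂, Iic 0, Ξ, U, fun σ => Real.exp σ * W (Λ σ),
    fun σ => Real.exp σ * (e (Λ σ) -
      (W (Λ σ))⁻¹ * (p₁ (Λ σ) * p₁ (Λ σ) + p₂ (Λ σ) * p₂ (Λ σ)) / 2)⟩ with hδ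
  set d₀ : Fin 4 → ℝ := ![W₀, W₀ * u₀, W₀ * v₀, e₀] with hd₀
  have hdens : ∀ k, ∀ σ ∈ Iic (0 : ℝ), δ.dens k σ = Real.exp σ *
      E.total (d₀ k) ((S i₂).dens k / r₂) ((S i₃).dens k / r₃) (Λ σ) := by
    intro k σ hσ
    have hw := hW' σ hσ
    have g1 : r₂ ≠ 0 := h₂.ne'
    have g2 : r₃ ≠ 0 := h₃.ne'
    fin_cases k
    · simp [DeltaShock.dens, hδ, hd₀, GasState.dens, ← hr₂, ← hr₃, div_self g1, div_self g2, hW]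
    · simp [DeltaShock.dens, hδ, hd₀, GasState.dens, ← hr₂, ← hr₃, hUdef, ← hu₂, ← hu₃,
        mul_div_cancel_left₀ _ g1, mul_div_cancel_left₀ _ g2, ← hp₁]
      field_simp
    · simp [DeltaShock.dens, hδ, hd₀, GasState.dens, ← hr₂, ← hr₃, hUdef, ← hv₂, ← hv₃,
        mul_div_cancel_left₀ _ g1, mul_div_cancel_left₀ _ g2, ← hp₂]
      field_simp
    · change Real.exp σ * (e (Λ σ) -
        (W (Λ σ))⁻¹ * (p₁ (Λ σ) * p₁ (Λ σ) + p₂ (Λ σ) * p₂ (Λ σ)) / 2) +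
        Real.exp σ * W (Λ σ) / 2 * nsq (U σ) = Real.exp σ * e (Λ σ)
      simp only [nsq, hUdef]
      field_simp
      ring
  -- The determinant is `(U - Uᵢ) × (Ξ - Uᵢ)`. With `U = p/W` and `Ξ = X/τ` it is the cross product
  -- of `cross_left` or `cross_right` divided by `W τ`.
  have htri : ∀ σ ≤ 0, tri (S i₃).vel (U σ) (Ξ σ) * Real.exp (-σ) * W (Λ σ) = E.α (Λ σ) ∧
      tri (S i₂).vel (U σ) (Ξ σ) * Real.exp (-σ) * W (Λ σ) = -E.β (Λ σ) := by
    intro σ hσ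
    have hw := hW' σ hσ
    have h1 : Real.exp σ * τ (Λ σ) = 1 := by
      rw [hτΛ σ hσ, ← Real.exp_add]; simp
    have h0 := hτpos (Λ σ) (hΛ0 σ hσ)
    have h0' : τ (Λ σ) ≠ 0 := fun h => by rw [h] at h1; simp at h1
    have h2 : Real.exp σ = (τ (Λ σ))⁻¹ := eq_inv_of_mul_eq_one_left h1
    rw [← hcl, ← hcr, tri_eq, tri_eq, ← hτΛ σ hσ]
    simp only [hUdef, hΞ, GasState.vel, ← hu₂, ← hu₃, ← hv₂, ← hv₃, h2]
    constructor
    · field_simp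
      ring
    · field_simp
      ring
  have hent : ∀ σ ∈ Iic (0 : ℝ),
      0 < tri (S i₃).vel (U σ) (Ξ σ) ∧ tri (S i₂).vel (U σ) (Ξ σ) < 0 := by
    intro σ hσ
    obtain ⟨h1, h2⟩ := htri σ hσ
    have h3 := hαpos _ (hΛ0 σ hσ)
    have h4 := hβpos _ (hΛ0 σ hσ)
    have h5 := hWpos _ (hΛ0 σ hσ)
    have h6 := Real.exp_pos (-σ)
    rw [mul_assoc] at h1 h2
    constructor
    · rw [← h1] at h3
      exact pos_of_mul_pos_left h3 (by positivity)
    · have : tri (S i₂).vel (U σ) (Ξ σ) * (Real.exp (-σ) * W (Λ σ)) < 0 := by linarith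
      exact neg_of_mul_neg_left this (by positivity)
  have hcurve : ∀ σ ∈ Iic (0 : ℝ), HasDerivWithinAt Ξ (Ξ σ - U σ) (Iic 0) σ := by
    intro σ hσ
    have hw := hW' σ hσ
    have key : ∀ {X p : ℝ → ℝ}, (∀ l, HasDerivAt X (p l) l) →
        HasDerivAt (fun σ => Real.exp σ * X (Λ σ))
          (Real.exp σ * X (Λ σ) - (W (Λ σ))⁻¹ * p (Λ σ)) σ := by
      intro X p hX
      refine ((Real.hasDerivAt_exp σ).mul ((hX (Λ σ)).comp σ (hΛd σ hσ))).congr_deriv ?_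
      have h1 : Real.exp σ * τ (Λ σ) = 1 := by
        rw [hτΛ σ hσ, ← Real.exp_add]; simp
      simp only [Function.comp]
      field_simp
      linear_combination -p (Λ σ) * h1
    exact ((key hX₁d).prodMk (key hX₂d)).hasDerivWithinAt
  refine ⟨δ, rfl, rfl, rfl, ?_, ?_, fun k => ?_, ?_, ⟨?_, ?_⟩, ?_⟩
  · simp [hδ, hΞ, hΛz, hX₁, hX₂, E.primitive_zero]
  · simp [hδ, hUdef, hΛz, hW0, hp₁, hp₂, E.total_zero]
    constructor <;> field_simp
  · rw [hdens k 0 (mem_Iic.2 le_rfl), hΛz, E.total_zero]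
    simp [hd₀]
  · refine ⟨?_, ?_, ?_, ?_, ?_, hcurve, ?_, hent, ?_⟩
    · exact (hexps.mul (hcomp (E.contDiff_primitive _ _ _ _))).prodMk
        (hexps.mul (hcomp (E.contDiff_primitive _ _ _ _)))
    · exact (hinv hp₁s).prodMk (hinv hp₂s)
    · exact hexps.mul (hcomp hWs)
    · have := hinv ((hp₁s.mul hp₁s).add (hp₂s.mul hp₂s))
      exact hexps.mul ((hcomp (E.contDiff_total e₀ ε₂ ε₃)).sub (this.div_const 2))
    · intro σ hσ σ' hσ' h
      refine (strictMonoOn_cross (convex_Iic 0) hcurve hent).injOn hσ hσ' ?_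
      change Ξ σ = Ξ σ' at h
      simp only [h]
    · intro k σ hσ
      obtain ⟨h1, h2⟩ := htri σ hσ
      have hw := hW' σ hσ
      have h3 : Real.exp σ * τ (Λ σ) = 1 := by
        rw [hτΛ σ hσ, ← Real.exp_add]; simp
      have hd := (Real.hasDerivAt_exp σ).mul ((E.hasDerivAt_total (d₀ k)
        ((S i₂).dens k / r₂) ((S i₃).dens k / r₃) (Λ σ)).comp σ (hΛd σ hσ))
      refine (hd.hasDerivWithinAt (s := Iic 0)).congr_deriv ?_ |>.congr
        (fun σ hσ => hdens k σ hσ) (hdens k σ hσ)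
      rw [hdens k σ hσ]
      change _ = _ - ((S i₃).dens k * tri (S i₃).vel (U σ) (Ξ σ)
        - (S i₂).dens k * tri (S i₂).vel (U σ) (Ξ σ)) * Real.exp (-σ)
      have h4 : tri (S i₃).vel (U σ) (Ξ σ) * Real.exp (-σ) = E.α (Λ σ) / W (Λ σ) := by
        rw [eq_div_iff hw, h1]
      have h5 : tri (S i₂).vel (U σ) (Ξ σ) * Real.exp (-σ) = -E.β (Λ σ) / W (Λ σ) := by
        rw [eq_div_iff hw, h2]
      have h6 : ((S i₃).dens k * tri (S i₃).vel (U σ) (Ξ σ)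
          - (S i₂).dens k * tri (S i₂).vel (U σ) (Ξ σ)) * Real.exp (-σ)
          = (S i₃).dens k * (E.α (Λ σ) / W (Λ σ)) - (S i₂).dens k * (-E.β (Λ σ) / W (Λ σ)) := by
        rw [← h4, ← h5]
        ring
      rw [h6]
      simp only [Function.comp]
      field_simp
      linear_combination -((S i₂).dens k * E.β (Λ σ) + (S i₃).dens k * E.α (Λ σ)) * h3
    · intro σ hσ
      have hσ' : σ ∈ Iic (0 : ℝ) := interior_subset hσ
      have hl := hΛ0 σ hσ'
      have hw := hWpos _ hl
      refine ⟨mul_pos (Real.exp_pos σ) hw, mul_pos (Real.exp_pos σ) ?_⟩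
      have hM₂ := E.M₂_nonneg h₂ hβ0 hl
      have hM₃ : 0 ≤ E.M₃ (Λ σ) := le_trans (by positivity) (E.M₃_ge h₃ hl)
      have e2 : ε₂ = (S i₂).H / r₂ + (u₂ ^ 2 + v₂ ^ 2) / 2 := by
        simp only [hε₂, GasState.dens, nsq, GasState.vel, ← hr₂, ← hu₂, ← hv₂]
        simp
        field_simp
      have e3 : ε₃ = (S i₃).H / r₃ + (u₃ ^ 2 + v₃ ^ 2) / 2 := by
        simp only [hε₃, GasState.dens, nsq, GasState.vel, ← hr₃, ← hu₃, ← hv₃]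
        simp
        field_simp
      have q2 : 0 ≤ (S i₂).H / r₂ := div_nonneg (hH _) h₂.le
      have q3 : 0 ≤ (S i₃).H / r₃ := div_nonneg (hH _) h₃.le
      -- Merging masses cannot increase kinetic energy: the defect is the sum over pairs of products
      -- of masses times squared velocity differences.
      have hkey : 0 ≤ (W₀ * (u₀ ^ 2 + v₀ ^ 2) + E.M₂ (Λ σ) * (u₂ ^ 2 + v₂ ^ 2)
          + E.M₃ (Λ σ) * (u₃ ^ 2 + v₃ ^ 2)) * W (Λ σ)
          - (p₁ (Λ σ) * p₁ (Λ σ) + p₂ (Λ σ) * p₂ (Λ σ)) := by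
        have : (W₀ * (u₀ ^ 2 + v₀ ^ 2) + E.M₂ (Λ σ) * (u₂ ^ 2 + v₂ ^ 2)
          + E.M₃ (Λ σ) * (u₃ ^ 2 + v₃ ^ 2)) * W (Λ σ)
          - (p₁ (Λ σ) * p₁ (Λ σ) + p₂ (Λ σ) * p₂ (Λ σ)) =
          W₀ * E.M₂ (Λ σ) * ((u₀ - u₂) ^ 2 + (v₀ - v₂) ^ 2) +
          W₀ * E.M₃ (Λ σ) * ((u₀ - u₃) ^ 2 + (v₀ - v₃) ^ 2) +
          E.M₂ (Λ σ) * E.M₃ (Λ σ) * ((u₂ - u₃) ^ 2 + (v₂ - v₃) ^ 2) := by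
          simp only [hW, hp₁, hp₂, Accretion.total]
          ring
        rw [this]
        positivity
      have hquot : (W (Λ σ))⁻¹ * (p₁ (Λ σ) * p₁ (Λ σ) + p₂ (Λ σ) * p₂ (Λ σ)) ≤
          W₀ * (u₀ ^ 2 + v₀ ^ 2) + E.M₂ (Λ σ) * (u₂ ^ 2 + v₂ ^ 2)
          + E.M₃ (Λ σ) * (u₃ ^ 2 + v₃ ^ 2) := by
        rw [inv_mul_le_iff₀ hw]
        linarith
      have hee : e (Λ σ) = e₀ + E.M₂ (Λ σ) * ε₂ + E.M₃ (Λ σ) * ε₃ := rfl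
      rw [hee, e2, e3]
      have := mul_nonneg hM₂ q2
      have := mul_nonneg hM₃ q3
      linarith
  · have hs : √r₂ + √r₃ ≠ 0 := by positivity
    refine Tendsto.prodMk_nhds ?_ ?_
    · have h := (E.tendsto_position h₂ h₃ hα0 hβ0 hW₀ A₁ u₀ u₂ u₃
        (avg (S i₂) (S i₃)).1 (by rw [avg_fst]; exact mul_div_cancel₀ _ hs)).comp hΛtop
      refine h.congr' ?_
      filter_upwards [eventually_le_atBot 0] with σ hσ
      change (τ (Λ σ))⁻¹ * X₁ (Λ σ) = _
      rw [hτΛ σ hσ, Real.exp_neg, inv_inv]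
    · have h := (E.tendsto_position h₂ h₃ hα0 hβ0 hW₀ A₂ v₀ v₂ v₃
        (avg (S i₂) (S i₃)).2 (by rw [avg_snd]; exact mul_div_cancel₀ _ hs)).comp hΛtop
      refine h.congr' ?_
      filter_upwards [eventually_le_atBot 0] with σ hσ
      change (τ (Λ σ))⁻¹ * X₂ (Λ σ) = _
      rw [hτΛ σ hσ, Real.exp_neg, inv_inv]
  · have hs : √r₂ + √r₃ ≠ 0 := by positivity
    refine Tendsto.prodMk_nhds ?_ ?_
    · exact (E.tendsto_velocity h₂ h₃ hα0 hβ0 hW₀ u₀ u₂ u₃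
        (avg (S i₂) (S i₃)).1 (by rw [avg_fst]; exact mul_div_cancel₀ _ hs)).comp hΛtop
    · exact (E.tendsto_velocity h₂ h₃ hα0 hβ0 hW₀ v₀ v₂ v₃
        (avg (S i₂) (S i₃)).2 (by rw [avg_snd]; exact mul_div_cancel₀ _ hs)).comp hΛtop
  -- With `D = U₃ - U₂`, bilinearity gives `α + β = W (X - τ U₂) × D - τ (p - W U₂) × D`. Here the
  -- first cross product is `a + c l` and the second is its derivative `c`.
  · obtain ⟨C, hC0, hC⟩ := E.exists_mass_sq_le h₂ h₃ ha0 hc0 hα0 hβ0 hW₀ (by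
      intro l
      rw [← hcl l]
      have h1 := hcr l
      have h2 : E.β l = -((p₁ l - W l * u₂) * (X₂ l - τ l * v₂)
        - (p₂ l - W l * v₂) * (X₁ l - τ l * u₂)) := by linarith
      rw [h2]
      simp only [hp₁, hp₂, hX₁, hX₂, hW, hτ, Accretion.total, Accretion.primitive]
      linear_combination -(W₀ + E.M₂ l * 1 + E.M₃ l * 1) * ha -
        (l * (W₀ + E.M₂ l * 1 + E.M₃ l * 1) - (1 + W₀ * l + E.N₂ l * 1 + E.N₃ l * 1)) * hc)
    set B : Fin 4 → ℝ := fun k => |d₀ k| / W₀ + |(S i₂).dens k / r₂| + |(S i₃).dens k / r₃| with hB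
    have hB0 : ∀ k, 0 ≤ B k := fun k => by positivity
    refine ⟨(∑ k, B k) * √C, fun k σ hσ => ?_⟩
    have hl := hΛ0 σ hσ
    have h1 : |E.total (d₀ k) ((S i₂).dens k / r₂) ((S i₃).dens k / r₃) (Λ σ)| ≤ B k * W (Λ σ) :=
      E.abs_total_le h₂ h₃ hα0 hβ0 hW₀ hl
    -- This is the square root of `W² ≤ C τ³` multiplied by `exp σ`, where `τ = exp (-σ)`.
    have h4 : Real.exp σ * W (Λ σ) ≤ √C * Real.exp (-σ / 2) := by
      have hw := hWpos _ hl
      refine abs_le_of_sq_le_sq' ?_ (by positivity) |>.2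
      have h5 := hC _ hl
      have h6 : Real.exp (-σ / 2) ^ 2 = Real.exp (-σ) := by
        rw [← Real.exp_nat_mul]
        congr 1
        push_cast
        ring
      rw [mul_pow, mul_pow, Real.sq_sqrt hC0, h6]
      change W (Λ σ) ^ 2 ≤ C * τ (Λ σ) ^ 3 at h5
      rw [hτΛ σ hσ] at h5
      calc Real.exp σ ^ 2 * W (Λ σ) ^ 2 ≤ Real.exp σ ^ 2 * (C * Real.exp (-σ) ^ 3) := by gcongr
        _ = C * Real.exp (-σ) * (Real.exp σ * Real.exp (-σ)) ^ 2 := by ring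
        _ = _ := by rw [← Real.exp_add]; simp
    rw [hdens k σ hσ, abs_mul, abs_of_pos (Real.exp_pos σ)]
    calc Real.exp σ * |E.total (d₀ k) ((S i₂).dens k / r₂) ((S i₃).dens k / r₃) (Λ σ)|
        ≤ Real.exp σ * (B k * W (Λ σ)) := by gcongr
      _ = B k * (Real.exp σ * W (Λ σ)) := by ring
      _ ≤ (∑ k, B k) * (√C * Real.exp (-σ / 2)) := by
          refine mul_le_mul (Finset.single_le_sum (fun i _ => hB0 i) (Finset.mem_univ k)) h4 ?_
            (Finset.sum_nonneg fun i _ => hB0 i)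
          exact mul_nonneg (Real.exp_pos _).le (hWpos _ hl).le
      _ = _ := by ring

/-! ### The weak form over a cone bounded by a graph -/

/-- The fundamental theorem of calculus on `(0, ∞)` for functions differentiable off a countable
set. -/
theorem integral_Ioi_of_hasDerivAt_off_countable {F F' : ℝ → ℝ} {s : Set ℝ} {a b : ℝ}
    (hs : s.Countable) (hc : ContinuousOn F (Ioi 0))
    (hd : ∀ t ∈ Ioi (0 : ℝ) \ s, HasDerivAt F (F' t) t) (hint : IntegrableOn F' (Ioi 0))
    (h0 : Tendsto F (𝓝[>] 0) (𝓝 a)) (htop : Tendsto F atTop (𝓝 b)) :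
    ∫ t in Ioi 0, F' t = b - a := by
  -- Nothing is assumed about `F` at `0` itself; giving it its limit there makes it continuous on
  -- closed intervals `[0, R]`.
  set G : ℝ → ℝ := Function.update F 0 a with hG
  have hGF : ∀ t, 0 < t → G t = F t := fun t ht => by simp [hG, ht.ne']
  have hGF' : ∀ t, 0 < t → G =ᶠ[𝓝 t] F := fun t ht => by
    filter_upwards [Ioi_mem_nhds ht] with u hu using hGF u hu
  have hGc : ∀ R : ℝ, ContinuousOn G (Icc 0 R) := by
    intro R t ht
    rcases ht.1.eq_or_lt with rfl | ht0
    · have h1 : ContinuousWithinAt G (Ioi 0) 0 := by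
        have : Tendsto G (𝓝[>] 0) (𝓝 a) :=
          h0.congr' (by filter_upwards [self_mem_nhdsWithin] with u hu using (hGF u hu).symm)
        simpa [ContinuousWithinAt, hG] using this
      have h2 : ContinuousWithinAt G (Ici 0) 0 := continuousWithinAt_Ioi_iff_Ici.1 h1
      exact h2.mono fun u hu => hu.1
    · exact ((hc.continuousAt (Ioi_mem_nhds ht0)).congr (hGF' t ht0).symm).continuousWithinAt
  have h1 : ∀ R, 0 < R → ∫ t in (0 : ℝ)..R, F' t = F R - a := by
    intro R hR
    rw [integral_eq_of_hasDerivAt_off_countable_of_le G F' hR.le hs (hGc R)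
      (fun t ht => ((hd t ⟨ht.1.1, ht.2⟩).congr_of_eventuallyEq (hGF' t ht.1.1)))
      ((intervalIntegrable_iff_integrableOn_Ioc_of_le hR.le).2
        (hint.mono_set Ioc_subset_Ioi_self)), hGF R hR]
    simp [hG]
  refine tendsto_nhds_unique (intervalIntegral_tendsto_integral_Ioi 0 hint tendsto_id) ?_
  refine (htop.sub_const a).congr' ?_
  filter_upwards [eventually_gt_atTop 0] with R hR using (h1 R hR).symm

theorem exists_support_bound {φ : ℝ × ℝ × ℝ → ℝ} (hφ : HasCompactSupport φ) :
    ∃ R, 0 < R ∧ ∀ t x y, φ (t, x, y) ≠ 0 → |t| ≤ R ∧ |x| ≤ R ∧ |y| ≤ R := by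
  obtain ⟨R, hR⟩ := hφ.isCompact.isBounded.exists_norm_le
  refine ⟨|R| + 1, by positivity, fun t x y h => ?_⟩
  have h1 := hR _ (subset_tsupport _ h)
  have h2 : R ≤ |R| + 1 := (le_abs_self R).trans (by linarith)
  simp only [Prod.norm_def, Real.norm_eq_abs, sup_le_iff] at h1
  exact ⟨h1.1.trans h2, h1.2.1.trans h2, h1.2.2.trans h2⟩

/-- The slanted shear `(x, c) ↦ (x - μ y, y)`, `y = h x + c`, preserves area. -/
theorem measurePreserving_shear (μ : ℝ) {h : ℝ → ℝ} (hh : Measurable h) :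
    MeasurePreserving (fun p : ℝ × ℝ => (p.1 - μ * (h p.1 + p.2), h p.1 + p.2)) := by
  have h1 : MeasurePreserving (fun p : ℝ × ℝ => (p.1, h p.1 + p.2)) :=
    (MeasurePreserving.id volume).skew_product (g := fun x c => h x + c)
      ((hh.comp measurable_fst).add measurable_snd)
      (ae_of_all _ fun x => (measurePreserving_add_left volume (h x)).map_eq)
  have h2 : MeasurePreserving (fun p : ℝ × ℝ => (p.1, p.2 - μ * p.1)) :=
    (MeasurePreserving.id volume).skew_product (g := fun y x => x - μ * y)
      (measurable_snd.sub (measurable_fst.const_mul μ))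
      (ae_of_all _ fun y => (measurePreserving_sub_right volume (μ * y)).map_eq)
  have hsw : MeasurePreserving (Prod.swap : ℝ × ℝ → ℝ × ℝ) := Measure.measurePreserving_swap
  exact (hsw.comp h2).comp (hsw.comp h1)

/-- The parametrization of space-time by the distance `c` to the cone over the graph of `q`. -/
noncomputable def graphMap (μ : ℝ) (q : ℝ → ℝ) (p : (ℝ × ℝ) × ℝ) : ℝ × ℝ × ℝ :=
  (p.1.1, p.1.2 - μ * (p.1.1 * q (p.1.2 / p.1.1) + p.2), p.1.1 * q (p.1.2 / p.1.1) + p.2)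

theorem measurePreserving_graphMap (μ : ℝ) {q : ℝ → ℝ} (hq : Measurable q) :
    MeasurePreserving (graphMap μ q) := by
  have h1 : MeasurePreserving (fun p : ℝ × ℝ × ℝ =>
      (p.1, (p.2.1 - μ * (p.1 * q (p.2.1 / p.1) + p.2.2), p.1 * q (p.2.1 / p.1) + p.2.2))) := by
    refine (MeasurePreserving.id volume).skew_product
      (g := fun t (p : ℝ × ℝ) => (p.1 - μ * (t * q (p.1 / t) + p.2), t * q (p.1 / t) + p.2)) ?_
      (ae_of_all _ fun t => (measurePreserving_shear μ (h := fun x => t * q (x / t))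
        (by fun_prop)).map_eq)
    have h2 : Measurable fun p : ℝ × ℝ × ℝ => p.1 * q (p.2.1 / p.1) + p.2.2 := by
      fun_prop
    exact (measurable_snd.fst.sub (h2.const_mul μ)).prodMk h2
  exact h1.comp volume_preserving_prodAssoc

theorem injective_graphMap (μ : ℝ) (q : ℝ → ℝ) : Function.Injective (graphMap μ q) := by
  rintro ⟨⟨t, x⟩, c⟩ ⟨⟨t', x'⟩, c'⟩ h
  simp only [graphMap, Prod.mk.injEq] at h
  obtain ⟨rfl, h2, h3⟩ := h
  have hx : x = x' := by
    rw [h3] at h2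
    linarith
  subst hx
  have hc : c = c' := by linarith
  rw [hc]

/-- The moving-frame rearrangement of the parameters of `graphMap`. -/
theorem measurePreserving_frame (f : ℝ) :
    MeasurePreserving (fun p : (ℝ × ℝ) × ℝ => (((p.2, p.1.1 + p.2 * f), p.1.2) : (ℝ × ℝ) × ℝ)) := by
  have h1 : MeasurePreserving (fun p : ℝ × ℝ × ℝ => (p.1, (p.2.1 + p.1 * f, p.2.2))) := by
    refine (MeasurePreserving.id volume).skew_product
      (g := fun t (p : ℝ × ℝ) => (p.1 + t * f, p.2)) (by fun_prop) (ae_of_all _ fun t => ?_)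
    exact ((measurePreserving_add_right volume (t * f)).prod (MeasurePreserving.id volume)).map_eq
  have hsw : MeasurePreserving (Prod.swap : (ℝ × ℝ) × ℝ → ℝ × ℝ × ℝ) :=
    Measure.measurePreserving_swap
  have h2 : MeasurePreserving (MeasurableEquiv.prodAssoc.symm : ℝ × ℝ × ℝ → (ℝ × ℝ) × ℝ) :=
    volume_preserving_prodAssoc.symm _
  exact (h2.comp h1).comp hsw

/-- The rate at which particles of velocity `U` cross the graph of `q` over the slanted coordinate
`x + μ y` in the self-similar plane. -/
noncomputable def flux (μ : ℝ) (q : ℝ → ℝ) (U : ℝ × ℝ) (ξ : ℝ) : ℝ :=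
  q ξ - U.2 - (ξ - (U.1 + μ * U.2)) * deriv q ξ

/-- The restriction of a function of space-time to the cone over the graph of `q`. -/
noncomputable def onGraph (μ : ℝ) (q : ℝ → ℝ) (φ : ℝ × ℝ × ℝ → ℝ) (p : ℝ × ℝ) : ℝ :=
  φ (p.1, p.2 - μ * (p.1 * q (p.2 / p.1)), p.1 * q (p.2 / p.1))

theorem measurable_flux (μ : ℝ) {q : ℝ → ℝ} (hq : Measurable q) (U : ℝ × ℝ) :
    Measurable (flux μ q U) :=
  (hq.sub_const _).sub ((measurable_id.sub_const _).mul (measurable_deriv q))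

/-- The weak form of a conservation law over the cone on one side of a graph, for a constant state
of velocity `U`: the contributions of the initial time and of the lateral boundary. -/
theorem integral_cone_graph {μ : ℝ} {q q₀ : ℝ → ℝ} {U : ℝ × ℝ} {E C : Set ℝ} {K ε : ℝ}
    (hq : Continuous q) (hE : E.Countable) (hqd : ∀ ξ ∉ E, DifferentiableAt ℝ q ξ)
    (hK : ∀ ξ, |flux μ q U ξ| ≤ K) (hq₀ : Measurable q₀)
    (hlim : ∀ x ≠ 0, Tendsto (fun t => t * q (x / t + (U.1 + μ * U.2))) (𝓝[>] 0) (𝓝 (q₀ x)))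
    (hC : MeasurableSet C)
    (hCε : ∀ ψ : ℝ → ℝ, ContDiff ℝ 1 ψ → HasCompactSupport ψ → ∫ c in C, deriv ψ c = ε * ψ 0)
    {φ : ℝ × ℝ × ℝ → ℝ} (hφ : ContDiff ℝ ∞ φ) (hφc : HasCompactSupport φ) :
    ∫ p in {p : ℝ × ℝ × ℝ | 0 < p.1 ∧ p.2.2 - p.1 * q ((p.2.1 + μ * p.2.2) / p.1) ∈ C},
      fderiv ℝ φ p (1, U) =
    -(∫ X in {X : ℝ × ℝ | X.2 - q₀ (X.1 + μ * X.2) ∈ C}, φ (0, X))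
      - ε * ∫ p in Ioi (0 : ℝ) ×ˢ univ, flux μ q U (p.2 / p.1) * onGraph μ q φ p := by
  obtain ⟨R, hR0, hR⟩ := exists_support_bound hφc
  set f₀ := U.1 + μ * U.2 with hf₀
  have hφd : Differentiable ℝ φ := hφ.differentiable (by simp)
  have hφ' : Continuous (fderiv ℝ φ) := hφ.continuous_fderiv (by simp)
  have hint : ∀ w, Integrable fun p => fderiv ℝ φ p w := fun w =>
    (hφ'.clm_apply continuous_const).integrable_of_hasCompactSupport
      ((hφc.fderiv (𝕜 := ℝ)).comp_left (g := fun L : ℝ × ℝ × ℝ →L[ℝ] ℝ => L w) (by simp))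
  set T := graphMap μ q with hT
  have hTp := measurePreserving_graphMap μ hq.measurable
  have hTe : MeasurableEmbedding T := hTp.measurable.measurableEmbedding (injective_graphMap μ q)
  set D : (ℝ × ℝ) × ℝ → ℝ := fun p => fderiv ℝ φ (T p) (1, U) with hD
  set D₀ : (ℝ × ℝ) × ℝ → ℝ := fun p => fderiv ℝ φ (T p) (0, -μ, 1) with hD₀
  have hDi : Integrable D := hTp.integrable_comp_of_integrable (hint (1, U))
  have hD₀i : Integrable D₀ := hTp.integrable_comp_of_integrable (hint (0, -μ, 1))
  set N : (ℝ × ℝ) × ℝ → ℝ := fun p => flux μ q U (p.1.2 / p.1.1) with hN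
  have hNm : Measurable N := (measurable_flux μ hq.measurable U).comp (by fun_prop)
  have hND : Integrable fun p => N p * D₀ p :=
    hD₀i.bdd_mul hNm.aestronglyMeasurable (ae_of_all _ fun p => hK _)
  have hG : Integrable fun p => D p + N p * D₀ p := hDi.add hND
  -- passing to the parameters
  have step1 : ∫ p in {p : ℝ × ℝ × ℝ | 0 < p.1 ∧ p.2.2 - p.1 * q ((p.2.1 + μ * p.2.2) / p.1) ∈ C},
      fderiv ℝ φ p (1, U) = ∫ p in (Ioi (0 : ℝ) ×ˢ univ) ×ˢ C, D p := by
    rw [← hTp.setIntegral_preimage_emb hTe]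
    congr 2
    ext ⟨⟨t, x⟩, c⟩
    simp [graphMap]
  -- the lateral boundary
  have step2 : ∫ p in (Ioi (0 : ℝ) ×ˢ univ) ×ˢ C, N p * D₀ p =
      ε * ∫ p in Ioi (0 : ℝ) ×ˢ univ, flux μ q U (p.2 / p.1) * onGraph μ q φ p := by
    have h1 := setIntegral_prod (μ := (volume : Measure (ℝ × ℝ))) (ν := (volume : Measure ℝ))
      (s := Ioi (0 : ℝ) ×ˢ univ) (t := C) (fun p => N p * D₀ p) hND.integrableOn
    rw [Measure.volume_eq_prod, h1, ← integral_const_mul]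
    congr 1
    ext ⟨t, x⟩
    simp only [hN]
    rw [integral_const_mul]
    set y := t * q (x / t) with hy
    set ψ : ℝ → ℝ := fun c => φ (t, x - μ * (y + c), y + c) with hψ
    have hl : ∀ c,
        HasDerivAt (fun c => ((t, x - μ * (y + c), y + c) : ℝ × ℝ × ℝ)) (0, -μ, 1) c := by
      intro c
      have e1 : HasDerivAt (fun c => y + c) 1 c := (hasDerivAt_id c).const_add y
      have e2 := (e1.const_mul μ).const_sub x
      rw [mul_one] at e2
      exact (hasDerivAt_const c t).prodMk (e2.prodMk e1)
    have hψd : ∀ c, HasDerivAt ψ (D₀ ((t, x), c)) c := fun c =>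
      (hφd _).hasFDerivAt.comp_hasDerivAt c (hl c)
    have hψs : ContDiff ℝ 1 ψ := by
      refine (hφ.of_le (by simp)).comp ?_
      fun_prop
    have hψc : HasCompactSupport ψ := by
      refine HasCompactSupport.of_support_subset_isCompact (isCompact_Icc (a := -R - y)
        (b := R - y)) fun c hc => ?_
      have := abs_le.1 (hR _ _ _ hc).2.2
      constructor <;> linarith
    have h2 : ∫ c in C, D₀ ((t, x), c) = ε * ψ 0 := by
      rw [← hCε ψ hψs hψc]
      congr 1
      ext c
      exact (hψd c).deriv.symm
    rw [h2]
    simp only [hψ, onGraph, ← hy, add_zero]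
    ring
  -- the initial time
  have step3 : ∫ p in (Ioi (0 : ℝ) ×ˢ univ) ×ˢ C, (D p + N p * D₀ p) =
      -(∫ X in {X : ℝ × ℝ | X.2 - q₀ (X.1 + μ * X.2) ∈ C}, φ (0, X)) := by
    -- For fixed `x` and `c`, let the slanted position be `x + t f₀`, so that it moves with the
    -- slanted speed of `U` while the distance `c` to the cone stays fixed. Along this curve `D + N
    -- D₀` is the derivative of `φ`, so the integral over `t` leaves only the value at `t = 0`.
    have hΘ := measurePreserving_frame f₀
    set Θ : (ℝ × ℝ) × ℝ → (ℝ × ℝ) × ℝ := fun p => ((p.2, p.1.1 + p.2 * f₀), p.1.2) with hΘdef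
    have hΘe : MeasurableEmbedding Θ := by
      refine hΘ.measurable.measurableEmbedding ?_
      rintro ⟨⟨x, c⟩, t⟩ ⟨⟨x', c'⟩, t'⟩ h
      simp only [hΘdef, Prod.mk.injEq] at h
      obtain ⟨⟨rfl, h2⟩, rfl⟩ := h
      have : x = x' := by linarith
      rw [this]
    have hpre : Θ ⁻¹' ((Ioi (0 : ℝ) ×ˢ univ) ×ˢ C) = (univ ×ˢ C) ×ˢ Ioi 0 := by
      ext ⟨⟨x, c⟩, t⟩
      simp [hΘdef, and_comm]
    have hGΘ : Integrable fun p => D (Θ p) + N (Θ p) * D₀ (Θ p) :=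
      hΘ.integrable_comp_of_integrable hG
    rw [← hΘ.setIntegral_preimage_emb hΘe, hpre, Measure.volume_eq_prod,
      setIntegral_prod (μ := (volume : Measure (ℝ × ℝ))) (ν := (volume : Measure ℝ)) _
        hGΘ.integrableOn]
    have hsh := measurePreserving_shear μ hq₀
    have hinner : ∀ᵐ p : ℝ × ℝ, ∫ t in Ioi (0 : ℝ), (D (Θ (p, t)) + N (Θ (p, t)) * D₀ (Θ (p, t)))
        = -φ (0, p.1 - μ * (q₀ p.1 + p.2), q₀ p.1 + p.2) := by
      have hae : ∀ᵐ p : ℝ × ℝ, Integrable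
          (fun t => D (Θ (p, t)) + N (Θ (p, t)) * D₀ (Θ (p, t))) := hGΘ.prod_right_ae
      have hx0 : ∀ᵐ p : ℝ × ℝ, p.1 ≠ 0 :=
        Measure.quasiMeasurePreserving_fst.ae (μa := (volume : Measure (ℝ × ℝ)))
          (p := fun x => x ≠ 0) (by simp [ae_iff])
      filter_upwards [hae, hx0] with ⟨x, c⟩ hi hx
      simp only at hx
      set y : ℝ → ℝ := fun t => t * q (x / t + f₀) + c with hy
      set F : ℝ → ℝ := fun t => φ (t, x + t * f₀ - μ * y t, y t) with hF
      have hdiv : ∀ t : ℝ, t ≠ 0 → (x + t * f₀) / t = x / t + f₀ := fun t ht => by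
        field_simp
      have hΘT : ∀ t, t ≠ 0 → T (Θ ((x, c), t)) = (t, x + t * f₀ - μ * y t, y t) := by
        intro t ht
        simp only [hT, graphMap, hΘdef, hdiv t ht, hy]
      have hyc : ContinuousOn y (Ioi 0) := by
        refine (continuousOn_id.mul (hq.comp_continuousOn ((continuousOn_const.div
          continuousOn_id fun t ht => (ne_of_gt ht)).add continuousOn_const))).add
          continuousOn_const
      have hcurve : ContinuousOn (fun t => ((t, x + t * f₀ - μ * y t, y t) : ℝ × ℝ × ℝ))
          (Ioi 0) :=
        continuousOn_id.prodMk (((by fun_prop : ContinuousOn (fun t => x + t * f₀) (Ioi 0)).sub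
          (hyc.const_mul μ)).prodMk hyc)
      have hF0 : Tendsto F (𝓝[>] 0) (𝓝 (φ (0, x - μ * (q₀ x + c), q₀ x + c))) := by
        have hy0 : Tendsto y (𝓝[>] 0) (𝓝 (q₀ x + c)) := (hlim x hx).add_const c
        have hid : Tendsto (fun t : ℝ => t) (𝓝[>] 0) (𝓝 0) := tendsto_nhdsWithin_of_tendsto_nhds
          tendsto_id
        have h1 : Tendsto (fun t : ℝ => x + t * f₀) (𝓝[>] 0) (𝓝 x) := by
          simpa using (hid.mul_const f₀).const_add x
        exact (hφ.continuous.tendsto _).comp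
          (hid.prodMk_nhds ((h1.sub (hy0.const_mul μ)).prodMk_nhds hy0))
      have hFtop : Tendsto F atTop (𝓝 0) := by
        refine tendsto_const_nhds.congr' ?_
        filter_upwards [eventually_gt_atTop R] with t ht
        by_contra h
        have := (abs_le.1 (hR _ _ _ (Ne.symm h)).1).2
        linarith
      -- The times at which the curve passes over a point where `q` need not be differentiable. As
      -- `x ≠ 0`, each point of `E` accounts for at most one time.
      set s : Set ℝ := (fun ξ => x / (ξ - f₀)) '' E with hs
      have hder : ∀ t ∈ Ioi (0 : ℝ) \ s,
          HasDerivAt F (D (Θ ((x, c), t)) + N (Θ ((x, c), t)) * D₀ (Θ ((x, c), t))) t := by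
        rintro t ⟨ht, hts⟩
        have ht0 : t ≠ 0 := ne_of_gt ht
        have hξ : x / t + f₀ ∉ E := by
          intro h
          refine hts ⟨_, h, ?_⟩
          simp only [add_sub_cancel_right]
          field_simp
        have e1 : HasDerivAt (fun t => x / t + f₀) (-(x / t ^ 2)) t := by
          have := ((hasDerivAt_const t x).div (hasDerivAt_id t) ht0).add_const f₀
          refine this.congr_deriv ?_
          simp only [id]
          field_simp
          ring
        have e2 := (hqd _ hξ).hasDerivAt.comp t e1
        have e3 := ((hasDerivAt_id t).mul e2).add_const c
        have hyd : HasDerivAt y (flux μ q U (x / t + f₀) + U.2) t := by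
          refine e3.congr_deriv ?_
          simp only [id, flux, ← hf₀, Function.comp]
          field_simp
          ring
        have e4 : HasDerivAt (fun t => x + t * f₀) f₀ t := by
          simpa using ((hasDerivAt_id t).mul_const f₀).const_add x
        have e5 := (hasDerivAt_id t).prodMk ((e4.sub (hyd.const_mul μ)).prodMk hyd)
        have e6 := (hφd (t, x + t * f₀ - μ * y t, y t)).hasFDerivAt.comp_hasDerivAt t e5
        refine e6.congr_deriv ?_
        have hNe : N (Θ ((x, c), t)) = flux μ q U (x / t + f₀) := by
          simp only [hN, hΘdef, hdiv t ht0]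
        simp only [hD, hD₀, hNe, hΘT t ht0]
        -- The curve keeps its distance to the graph, so its velocity is the particle velocity
        -- corrected by the flux times the direction `(0, -μ, 1)`, which leaves the slanted
        -- coordinate unchanged.
        have hvec : ((1, f₀ - μ * (flux μ q U (x / t + f₀) + U.2),
            flux μ q U (x / t + f₀) + U.2) : ℝ × ℝ × ℝ) =
            (1, U) + flux μ q U (x / t + f₀) • (0, -μ, 1) := by
          ext
          · simp
          · simp [hf₀]; ring
          · simp; ring
        rw [hvec, map_add, map_smul, smul_eq_mul]
      rw [integral_Ioi_of_hasDerivAt_off_countable (hE.image _)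
        (hφ.continuous.comp_continuousOn hcurve) hder hi.integrableOn hF0 hFtop]
      simp
    rw [setIntegral_congr_ae (g := fun p => -φ (0, p.1 - μ * (q₀ p.1 + p.2), q₀ p.1 + p.2))
      (MeasurableSet.univ.prod hC) (by filter_upwards [hinner] with p hp _ using hp),
      integral_neg]
    congr 1
    rw [← hsh.setIntegral_preimage_emb (hsh.measurable.measurableEmbedding ?_)
      (fun X => φ (0, X))]
    · congr 2
      ext ⟨x, c⟩
      simp
    · rintro ⟨x, c⟩ ⟨x', c'⟩ h
      simp only [Prod.mk.injEq] at h
      obtain ⟨h2, h3⟩ := h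
      have hx : x = x' := by
        rw [h3] at h2
        linarith
      subst hx
      have hc : c = c' := by linarith
      rw [hc]
  rw [step1, ← step3, ← step2, ← integral_sub hG.integrableOn hND.integrableOn]
  simp

/-! ### The contribution of a delta shock to the weak form -/

/-- The parameters `(t, s)` with `ln (s/t)` in a given set. -/
def paramCone (T : Set ℝ) : Set (ℝ × ℝ) := {p | 0 < p.1 ∧ 0 < p.2 ∧ Real.log (p.2 / p.1) ∈ T}

theorem measurable_logRatio : Measurable fun p : ℝ × ℝ => Real.log (p.2 / p.1) :=
  Real.measurable_log.comp (measurable_snd.div measurable_fst)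

theorem measurableSet_paramCone {T : Set ℝ} (hT : MeasurableSet T) :
    MeasurableSet (paramCone T) :=
  (measurableSet_lt measurable_const measurable_fst).inter
    ((measurableSet_lt measurable_const measurable_snd).inter (measurable_logRatio hT))

theorem continuousOn_logRatio (T : Set ℝ) :
    ContinuousOn (fun p : ℝ × ℝ => Real.log (p.2 / p.1)) (paramCone T) := by
  refine (continuousOn_snd.div continuousOn_fst fun p hp => hp.1.ne').log fun p hp => ?_
  exact (div_pos hp.2.1 hp.1).ne'

theorem det_lowerTriangular (A B : ℝ) :
    ((ContinuousLinearMap.fst ℝ ℝ ℝ).prod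
      (A • ContinuousLinearMap.fst ℝ ℝ ℝ + B • ContinuousLinearMap.snd ℝ ℝ ℝ)).det = B := by
  rw [ContinuousLinearMap.det, ← LinearMap.det_toMatrix (Module.Basis.finTwoProd ℝ),
    Matrix.det_fin_two]
  simp [LinearMap.toMatrix_apply]

/-- The self-similar change of variables `x = t χ(ln (s/t))` at fixed `t`. -/
theorem selfSimilar_changeOfVariables {χ χ' : ℝ → ℝ} {T : Set ℝ} (hT : IsOpen T)
    (hχ : ∀ σ ∈ T, HasDerivAt χ (χ' σ) σ) (hinj : InjOn χ T) (F : ℝ × ℝ → ℝ) :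
    (IntegrableOn F {p | 0 < p.1 ∧ p.2 / p.1 ∈ χ '' T} ↔
      IntegrableOn (fun p : ℝ × ℝ => |χ' (Real.log (p.2 / p.1)) * (p.1 / p.2)| *
        F (p.1, p.1 * χ (Real.log (p.2 / p.1)))) (paramCone T)) ∧
    ∫ p in {p : ℝ × ℝ | 0 < p.1 ∧ p.2 / p.1 ∈ χ '' T}, F p =
      ∫ p in paramCone T, |χ' (Real.log (p.2 / p.1)) * (p.1 / p.2)| *
        F (p.1, p.1 * χ (Real.log (p.2 / p.1))) := by
  set g : ℝ × ℝ → ℝ × ℝ := fun p => (p.1, p.1 * χ (Real.log (p.2 / p.1))) with hg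
  set g' : ℝ × ℝ → ℝ × ℝ →L[ℝ] ℝ × ℝ := fun p => (ContinuousLinearMap.fst ℝ ℝ ℝ).prod
    ((χ (Real.log (p.2 / p.1)) - χ' (Real.log (p.2 / p.1))) • ContinuousLinearMap.fst ℝ ℝ ℝ +
      (χ' (Real.log (p.2 / p.1)) * (p.1 / p.2)) • ContinuousLinearMap.snd ℝ ℝ ℝ) with hg'
  have hm : MeasurableSet (paramCone T) := measurableSet_paramCone hT.measurableSet
  have himg : g '' paramCone T = {p | 0 < p.1 ∧ p.2 / p.1 ∈ χ '' T} := by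
    ext ⟨t, x⟩
    constructor
    · rintro ⟨⟨t', s⟩, ⟨h1, h2, h3⟩, h⟩
      simp only [hg, Prod.mk.injEq] at h h1 h2 h3
      obtain ⟨rfl, rfl⟩ := h
      exact ⟨h1, _, h3, by field_simp⟩
    · rintro ⟨ht, σ, hσ, h⟩
      simp only at ht h
      have h1 : Real.log (t * Real.exp σ / t) = σ := by
        rw [mul_div_cancel_left₀ _ ht.ne', Real.log_exp]
      refine ⟨(t, t * Real.exp σ), ⟨ht, by positivity, by simpa only [h1] using hσ⟩, ?_⟩
      simp only [hg, h1, h, Prod.mk.injEq, true_and]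
      field_simp
  have hginj : InjOn g (paramCone T) := by
    rintro ⟨t, s⟩ ⟨h1, h2, h3⟩ ⟨t', s'⟩ ⟨h1', h2', h3'⟩ h
    simp only [hg, Prod.mk.injEq] at h h1 h2 h3 h1' h2' h3'
    obtain ⟨rfl, h⟩ := h
    have h4 := hinj h3 h3' (mul_left_cancel₀ h1.ne' h)
    have h5 := Real.log_injOn_pos (mem_Ioi.2 (div_pos h2 h1)) (mem_Ioi.2 (div_pos h2' h1)) h4
    have : s = s' := by field_simp at h5; exact h5
    rw [this]
  have hderiv : ∀ p ∈ paramCone T, HasFDerivWithinAt g (g' p) (paramCone T) p := by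
    rintro ⟨t, s⟩ ⟨h1, h2, h3⟩
    simp only at h1 h2 h3
    have e1 : HasFDerivAt (fun p : ℝ × ℝ => p.1) (ContinuousLinearMap.fst ℝ ℝ ℝ) (t, s) :=
      hasFDerivAt_fst
    have e2 : HasFDerivAt (fun p : ℝ × ℝ => p.2) (ContinuousLinearMap.snd ℝ ℝ ℝ) (t, s) :=
      hasFDerivAt_snd
    have e3 := (e2.log h2.ne').sub (e1.log h1.ne')
    have e4 : Real.log s - Real.log t = Real.log (s / t) := (Real.log_div h2.ne' h1.ne').symm
    have e5 := (e4 ▸ hχ _ h3 : HasDerivAt χ _ (Real.log s - Real.log t)).comp_hasFDerivAt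
      (t, s) e3
    have e6 := e1.prodMk (e1.mul e5)
    refine (e6.hasFDerivWithinAt (s := paramCone T)).congr_fderiv ?_ |>.congr ?_ ?_
    · ext
      · simp [hg']
      · simp [hg', e4]; field_simp; ring
      · simp [hg']
      · simp [hg', e4]; field_simp
    · rintro ⟨t', s'⟩ ⟨h1', h2', -⟩
      simp only at h1' h2'
      simp [hg, Real.log_div h2'.ne' h1'.ne']
    · simp [hg, e4]
  have hdet : ∀ p, (g' p).det = χ' (Real.log (p.2 / p.1)) * (p.1 / p.2) := fun p =>
    det_lowerTriangular _ _
  rw [← himg]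
  constructor
  · rw [integrableOn_image_iff_integrableOn_abs_det_fderiv_smul volume hm hderiv hginj]
    simp only [hdet, smul_eq_mul, hg]
  · rw [integral_image_eq_integral_abs_det_fderiv_smul volume hm hderiv hginj]
    simp only [hdet, smul_eq_mul, hg]

/-- The parameter `σ = 0` corresponds to the diagonal `s = t`, a null set. -/
theorem paramCone_ae_eq {T T' : Set ℝ} (h : T ⊆ T') (h' : T' ⊆ insert 0 T) :
    paramCone T' =ᵐ[volume] paramCone T := by
  have hnull : volume {p : ℝ × ℝ | p.2 = p.1} = 0 := by
    rw [Measure.volume_eq_prod, Measure.measure_prod_null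
      (measurableSet_eq_fun measurable_snd measurable_fst)]
    refine ae_of_all _ fun x => ?_
    have : Prod.mk x ⁻¹' {p : ℝ × ℝ | p.2 = p.1} = {x} := by
      ext y
      simp
    simp [this]
  have hae : ∀ᵐ p : ℝ × ℝ, p.2 ≠ p.1 := by
    rw [ae_iff]
    simpa using hnull
  filter_upwards [hae] with p hp
  have : (p ∈ paramCone T') = (p ∈ paramCone T) := by
    refine propext ⟨fun h3 => ⟨h3.1, h3.2.1, ?_⟩, fun h3 => ⟨h3.1, h3.2.1, h h3.2.2⟩⟩
    rcases h' h3.2.2 with h4 | h4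
    · exfalso
      rcases Real.log_eq_zero.1 h4 with h5 | h5 | h5
      · exact (div_pos h3.2.1 h3.1).ne' h5
      · exact hp ((div_eq_one_iff_eq h3.1.ne').1 h5)
      · linarith [div_pos h3.2.1 h3.1]
    · exact h4
  exact this

/-- On the support, `t`, `x - μ y` and `y` are bounded, hence so is the slanted coordinate `x`; the
support is therefore bounded although the cone is not. -/
theorem integrable_onGraph {μ : ℝ} {q w : ℝ → ℝ} {K : ℝ} (hq : Continuous q) (hw : Measurable w)
    (hK : ∀ ξ, |w ξ| ≤ K) {φ : ℝ × ℝ × ℝ → ℝ} (hφ : Continuous φ) (hφc : HasCompactSupport φ) :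
    Integrable fun p : ℝ × ℝ => w (p.2 / p.1) * onGraph μ q φ p := by
  obtain ⟨R, hR0, hR⟩ := exists_support_bound hφc
  obtain ⟨M, hM⟩ := hφc.exists_bound_of_continuous hφ
  have hm : Measurable (onGraph μ q φ) := by
    have h1 : Measurable fun p : ℝ × ℝ => p.1 * q (p.2 / p.1) :=
      measurable_fst.mul (hq.measurable.comp (measurable_snd.div measurable_fst))
    exact hφ.measurable.comp
      (measurable_fst.prodMk ((measurable_snd.sub (h1.const_mul μ)).prodMk h1))
  have hint : Integrable (onGraph μ q φ) := by
    set s : Set (ℝ × ℝ) := Icc (-R) R ×ˢ Icc (-(R + |μ| * R)) (R + |μ| * R) with hs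
    have hsup : Function.support (onGraph μ q φ) ⊆ s := by
      rintro ⟨t, x⟩ h
      obtain ⟨h1, h2, h3⟩ := hR _ _ _ h
      refine ⟨abs_le.1 h1, abs_le.1 ?_⟩
      simp only at h2 h3 ⊢
      set y := t * q (x / t)
      have : x = (x - μ * y) + μ * y := by ring
      rw [this]
      refine (abs_add_le _ _).trans (add_le_add h2 ?_)
      rw [abs_mul]
      exact mul_le_mul_of_nonneg_left h3 (abs_nonneg _)
    rw [← integrableOn_iff_integrable_of_support_subset hsup]
    refine Measure.integrableOn_of_bounded (M := M) ?_ hm.aestronglyMeasurable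
      (ae_of_all _ fun p => hM _)
    exact ((isCompact_Icc.prod isCompact_Icc).measure_lt_top).ne
  exact hint.bdd_mul (hw.comp (measurable_snd.div measurable_fst)).aestronglyMeasurable
    (ae_of_all _ fun p => hK _)

/-- The amount of the `k`-th conserved quantity that is absorbed by a delta shock, per unit
parameter, tested against `φ`. -/
noncomputable def gain (S : Fin 3 → GasState) (δ : DeltaShock) (k : Fin 4) (φ : ℝ × ℝ × ℝ → ℝ)
    (p : ℝ × ℝ) : ℝ :=
  ((S δ.left).dens k * tri (S δ.left).vel (δ.U (Real.log (p.2 / p.1))) (δ.Ξ (Real.log (p.2 / p.1)))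
    - (S δ.right).dens k *
      tri (S δ.right).vel (δ.U (Real.log (p.2 / p.1))) (δ.Ξ (Real.log (p.2 / p.1)))) *
    Real.exp (-Real.log (p.2 / p.1)) * φ (p.1, p.1 • δ.Ξ (Real.log (p.2 / p.1)))

/-- The slanted coordinate of the self-similar plane. -/
def slant (μ : ℝ) (P : ℝ × ℝ) : ℝ := P.1 + μ * P.2

/-- The hypothesis `hq'` says that `Ξ - U` is tangent to the graph. The determinant `(U - L) × (Ξ -
U)` then sees the graph only through its slope and equals the flux times the slanted length of `Ξ -
U`, up to sign. This identity is what matches the Rankine–Hugoniot sources with the boundary fluxes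
of the regions. -/
theorem tri_eq_flux {μ : ℝ} {q : ℝ → ℝ} {Ξ U L : ℝ × ℝ} (hq : q (slant μ Ξ) = Ξ.2)
    (hq' : deriv q (slant μ Ξ) * slant μ (Ξ - U) = (Ξ - U).2) :
    tri L U Ξ = -(slant μ (Ξ - U) * flux μ q L (slant μ Ξ)) := by
  rw [tri_eq, flux, hq]
  have : slant μ (Ξ - U) * (Ξ.2 - L.2 - (slant μ Ξ - (L.1 + μ * L.2)) * deriv q (slant μ Ξ)) =
      slant μ (Ξ - U) * (Ξ.2 - L.2) -
        (slant μ Ξ - (L.1 + μ * L.2)) * (deriv q (slant μ Ξ) * slant μ (Ξ - U)) := by ring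
  rw [this, hq']
  simp only [slant, Prod.fst_sub, Prod.snd_sub]
  ring

theorem hasDerivAt_slant {μ : ℝ} {Ξ : ℝ → ℝ × ℝ} {V : ℝ × ℝ} {σ : ℝ} (h : HasDerivAt Ξ V σ) :
    HasDerivAt (fun σ => slant μ (Ξ σ)) (slant μ V) σ := by
  have h1 := (hasFDerivAt_fst (𝕜 := ℝ) (p := Ξ σ)).comp_hasDerivAt σ h
  have h2 := (hasFDerivAt_snd (𝕜 := ℝ) (p := Ξ σ)).comp_hasDerivAt σ h
  exact h1.add (h2.const_mul μ)

/-- The absorbed quantities as an integral over the cone over a graph carrying the delta shock. -/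
theorem integral_gain {S : Fin 3 → GasState} {δ : DeltaShock} {T : Set ℝ} {μ e : ℝ} {q : ℝ → ℝ}
    (he0 : e ≠ 0) (hT : IsOpen T) (hd : ∀ σ ∈ T, HasDerivAt δ.Ξ (δ.Ξ σ - δ.U σ) σ)
    (he : ∀ σ ∈ T, |slant μ (δ.Ξ σ - δ.U σ)| = e * slant μ (δ.Ξ σ - δ.U σ))
    (hinj : InjOn (fun σ => slant μ (δ.Ξ σ)) T)
    (hq : ∀ σ ∈ T, q (slant μ (δ.Ξ σ)) = (δ.Ξ σ).2)
    (hq' : ∀ σ ∈ T, deriv q (slant μ (δ.Ξ σ)) * slant μ (δ.Ξ σ - δ.U σ) = (δ.Ξ σ - δ.U σ).2)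
    (k : Fin 4) (φ : ℝ × ℝ × ℝ → ℝ)
    (hint : IntegrableOn (fun p : ℝ × ℝ => ((S δ.left).dens k * flux μ q (S δ.left).vel (p.2 / p.1)
      - (S δ.right).dens k * flux μ q (S δ.right).vel (p.2 / p.1)) * onGraph μ q φ p)
      {p | 0 < p.1 ∧ p.2 / p.1 ∈ (fun σ => slant μ (δ.Ξ σ)) '' T}) :
    IntegrableOn (gain S δ k φ) (paramCone T) ∧
    e * ∫ p in paramCone T, gain S δ k φ p =
      - ∫ p in {p : ℝ × ℝ | 0 < p.1 ∧ p.2 / p.1 ∈ (fun σ => slant μ (δ.Ξ σ)) '' T},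
        ((S δ.left).dens k * flux μ q (S δ.left).vel (p.2 / p.1)
        - (S δ.right).dens k * flux μ q (S δ.right).vel (p.2 / p.1)) * onGraph μ q φ p := by
  obtain ⟨h1, h2⟩ := selfSimilar_changeOfVariables hT
    (fun σ hσ => hasDerivAt_slant (μ := μ) (hd σ hσ)) hinj
    (fun p : ℝ × ℝ => ((S δ.left).dens k * flux μ q (S δ.left).vel (p.2 / p.1)
      - (S δ.right).dens k * flux μ q (S δ.right).vel (p.2 / p.1)) * onGraph μ q φ p)
  have hm := measurableSet_paramCone hT.measurableSet
  -- The factor `slant μ (Ξ - U)` that relates `tri` to `flux` is also the derivative of `σ ↦ slant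
  -- μ (Ξ σ)`, hence appears in the Jacobian. The two agree up to its sign `e`, which records the
  -- orientation of the curve.
  have key : EqOn (fun p : ℝ × ℝ =>
      |slant μ (δ.Ξ (Real.log (p.2 / p.1)) - δ.U (Real.log (p.2 / p.1))) * (p.1 / p.2)| *
      (((S δ.left).dens k * flux μ q (S δ.left).vel
          ((p.1 * slant μ (δ.Ξ (Real.log (p.2 / p.1)))) / p.1)
        - (S δ.right).dens k * flux μ q (S δ.right).vel
          ((p.1 * slant μ (δ.Ξ (Real.log (p.2 / p.1)))) / p.1)) *
        onGraph μ q φ (p.1, p.1 * slant μ (δ.Ξ (Real.log (p.2 / p.1))))))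
      (fun p => -e * gain S δ k φ p) (paramCone T) := by
    rintro ⟨t, s⟩ ⟨ht, hs, hσ⟩
    simp only at ht hs hσ
    have e1 : Real.exp (-Real.log (s / t)) = t / s := by
      rw [Real.exp_neg, Real.exp_log (div_pos hs ht), inv_div]
    simp only [gain, onGraph, e1]
    set σ := Real.log (s / t)
    rw [mul_div_cancel_left₀ _ ht.ne', hq σ hσ, tri_eq_flux (hq σ hσ) (hq' σ hσ),
      tri_eq_flux (hq σ hσ) (hq' σ hσ), abs_mul, he σ hσ, abs_of_pos (div_pos ht hs)]
    have e2 : ((t, t * slant μ (δ.Ξ σ) - μ * (t * (δ.Ξ σ).2), t * (δ.Ξ σ).2) : ℝ × ℝ × ℝ) =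
        (t, t • δ.Ξ σ) := by
      simp only [slant, Prod.mk.injEq, true_and]
      refine Prod.ext ?_ ?_
      · simp; ring
      · simp
    rw [e2]
    ring
  have hi := (integrableOn_congr_fun key hm).1 (h1.1 hint)
  refine ⟨?_, ?_⟩
  · have := hi.const_mul (-e)⁻¹
    refine this.congr (ae_of_all _ fun p => ?_)
    field_simp
  · rw [h2, setIntegral_congr_fun hm key, integral_const_mul]
    ring

theorem exists_fderiv_bound {φ : ℝ × ℝ × ℝ → ℝ} (hφ : ContDiff ℝ ∞ φ) (hφc : HasCompactSupport φ) :
    ∃ M R, 0 ≤ M ∧ 0 < R ∧ (∀ p w, |fderiv ℝ φ p w| ≤ M * ‖w‖) ∧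
      ∀ t x, R < t → fderiv ℝ φ (t, x) = 0 ∧ φ (t, x) = 0 := by
  have hφ' : Continuous (fderiv ℝ φ) := hφ.continuous_fderiv (by simp)
  obtain ⟨M, hM⟩ := (hφc.fderiv (𝕜 := ℝ)).exists_bound_of_continuous hφ'
  obtain ⟨R, hR⟩ := hφc.isCompact.isBounded.exists_norm_le
  have hout : ∀ t x, |R| + 1 < t → (t, x) ∉ tsupport φ := by
    intro t x ht h
    have h1 := hR _ h
    have h2 := (norm_fst_le (t, x)).trans h1
    have h3 := (le_abs_self t).trans h2
    have h4 := le_abs_self R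
    linarith
  refine ⟨M, |R| + 1, (norm_nonneg _).trans (hM 0), by positivity, fun p w => ?_, fun t x ht => ?_⟩
  · exact ((fderiv ℝ φ p).le_opNorm w).trans (mul_le_mul_of_nonneg_right (hM p) (norm_nonneg _))
  · exact ⟨image_eq_zero_of_notMem_tsupport
      (fun h => hout t x ht (tsupport_fderiv_subset ℝ h)),
      image_eq_zero_of_notMem_tsupport (hout t x ht)⟩

theorem exists_bound_of_tendsto_atBot {f : ℝ → ℝ × ℝ} {P : ℝ × ℝ} (hf : ContinuousOn f (Iic 0))
    (h : Tendsto f atBot (𝓝 P)) : ∃ B, ∀ σ ≤ 0, ‖f σ‖ ≤ B := by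
  have h1 : ∀ᶠ σ in atBot, ‖f σ‖ < ‖P‖ + 1 := h.norm.eventually_lt_const (by linarith)
  obtain ⟨a, ha⟩ := eventually_atBot.1 h1
  obtain ⟨C, hC⟩ := isCompact_Icc.exists_bound_of_continuousOn
    (hf.mono (fun x hx => hx.2 : Icc a 0 ⊆ Iic 0))
  refine ⟨max C (‖P‖ + 1), fun σ hσ => ?_⟩
  rcases le_total σ a with h2 | h2
  · exact (ha σ h2).le.trans (le_max_right _ _)
  · exact (hC σ ⟨h2, hσ⟩).trans (le_max_left _ _)

/-- Slow growth bounds the weights by a multiple of `exp (-σ/2) = √(t/s)`. On the support of `φ` one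
has `0 < s ≤ t ≤ R`, so the integrand is dominated by a constant times the integrable function
`s^(-1/2)`. -/
theorem DeltaShock.integrableOn_integrand {S : Fin 3 → GasState} {δ : DeltaShock} {P : ℝ × ℝ}
    (hδ : IsDeltaShock S δ) (hr : δ.range = Iic 0) (hP : δ.TerminatesAt P) (hg : δ.SlowGrowth)
    (k : Fin 4) {φ : ℝ × ℝ × ℝ → ℝ} (hφ : ContDiff ℝ ∞ φ) (hφc : HasCompactSupport φ) :
    IntegrableOn (δ.integrand k φ) (paramCone (Iic 0)) := by
  obtain ⟨C, hC⟩ := hg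
  obtain ⟨M, R, hM0, hR0, hM, hR⟩ := exists_fderiv_bound hφ hφc
  have hU : ContinuousOn δ.U (Iic 0) := hr ▸ hδ.smooth_U.continuousOn
  have hΞ : ContinuousOn δ.Ξ (Iic 0) := hr ▸ hδ.smooth_Ξ.continuousOn
  have hdens : ContinuousOn (δ.dens k) (Iic 0) := fun σ hσ =>
    hr ▸ (hδ.balance k σ (hr ▸ hσ)).continuousWithinAt
  obtain ⟨B, hB⟩ := exists_bound_of_tendsto_atBot hU hP.2
  have hB0 : 0 ≤ B := (norm_nonneg _).trans (hB 0 le_rfl)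
  have hC0 : 0 ≤ C := by
    have := (abs_nonneg _).trans (hC k 0 le_rfl)
    simpa using this
  have hφ' : Continuous (fderiv ℝ φ) := hφ.continuous_fderiv (by simp)
  have hlog := continuousOn_logRatio (Iic 0)
  have hmaps : MapsTo (fun p : ℝ × ℝ => Real.log (p.2 / p.1)) (paramCone (Iic 0)) (Iic 0) :=
    fun p hp => hp.2.2
  have hcont : ContinuousOn (δ.integrand k φ) (paramCone (Iic 0)) := by
    have c1 := hdens.comp hlog hmaps
    have c2 := hU.comp hlog hmaps
    have c3 := hΞ.comp hlog hmaps
    have c4 : ContinuousOn (fun p : ℝ × ℝ => fderiv ℝ φ (p.1, p.1 • δ.Ξ (Real.log (p.2 / p.1))))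
        (paramCone (Iic 0)) :=
      hφ'.comp_continuousOn (continuousOn_fst.prodMk (continuousOn_fst.smul c3))
    exact (continuousOn_fst.mul c1).mul (c4.clm_apply (continuousOn_const.prodMk c2))
  have hm : MeasurableSet (paramCone (Iic 0)) := measurableSet_paramCone measurableSet_Iic
  set g : ℝ × ℝ → ℝ := fun p => (Ioc 0 R).indicator (fun _ => R * √R * (C * (M * (1 + B)))) p.1 *
    (Ioc 0 R).indicator (fun s => s ^ (-(1 / 2) : ℝ)) p.2 with hgdef
  have hgi : Integrable g := by
    refine Integrable.mul_prod ?_ ?_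
    · exact (integrable_indicator_iff measurableSet_Ioc).2 (integrableOn_const (by simp))
    · rw [integrable_indicator_iff measurableSet_Ioc,
        ← intervalIntegrable_iff_integrableOn_Ioc_of_le hR0.le]
      exact intervalIntegral.intervalIntegrable_rpow' (by norm_num)
  refine Integrable.mono' hgi.integrableOn (hcont.aestronglyMeasurable hm) ?_
  rw [ae_restrict_iff' hm]
  refine ae_of_all _ ?_
  rintro ⟨t, s⟩ ⟨ht, hs, hσ⟩
  simp only at ht hs hσ
  have hst : s ≤ t := by
    have h1 : s / t ≤ 1 := by
      by_contra h
      have := Real.log_pos (not_le.1 h)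
      exact absurd hσ (not_le.2 this)
    rwa [div_le_one ht] at h1
  have hg0 : 0 ≤ g (t, s) := by
    refine mul_nonneg (indicator_nonneg (fun _ _ => by positivity) _)
      (indicator_nonneg (fun s hs => Real.rpow_nonneg hs.1.le _) _)
  rcases le_or_gt t R with htR | htR
  · have hgv : g (t, s) = R * √R * (C * (M * (1 + B))) * (√s)⁻¹ := by
      simp only [hgdef]
      rw [indicator_of_mem (show t ∈ Ioc 0 R from ⟨ht, htR⟩),
        indicator_of_mem (show s ∈ Ioc 0 R from ⟨hs, hst.trans htR⟩), Real.rpow_neg hs.le,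
        ← Real.sqrt_eq_rpow]
    rw [hgv, Real.norm_eq_abs, DeltaShock.integrand]
    simp only
    set σ := Real.log (s / t) with hσdef
    have e1 : Real.exp (-σ / 2) = √t * (√s)⁻¹ := by
      have : Real.exp (-σ) = t / s := by
        rw [Real.exp_neg, hσdef, Real.exp_log (div_pos hs ht), inv_div]
      rw [Real.exp_half, this, Real.sqrt_div ht.le, div_eq_mul_inv]
    have e2 : ‖((1, δ.U σ) : ℝ × ℝ × ℝ)‖ ≤ 1 + B := by
      rw [Prod.norm_def]
      refine max_le ?_ ?_
      · simp; exact hB0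
      · simp only
        linarith [hB σ hσ]
    rw [abs_mul, abs_mul, abs_of_pos ht]
    have e3 := hC k σ hσ
    rw [e1] at e3
    have e4 : |fderiv ℝ φ (t, t • δ.Ξ σ) (1, δ.U σ)| ≤ M * (1 + B) :=
      (hM _ _).trans (mul_le_mul_of_nonneg_left e2 hM0)
    have e5 : √t ≤ √R := Real.sqrt_le_sqrt htR
    calc t * |δ.dens k σ| * |fderiv ℝ φ (t, t • δ.Ξ σ) (1, δ.U σ)|
        ≤ R * (C * (√R * (√s)⁻¹)) * (M * (1 + B)) := by
          have e6 : |δ.dens k σ| ≤ C * (√R * (√s)⁻¹) := by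
            refine e3.trans ?_
            gcongr
          gcongr
      _ = _ := by ring
  · refine le_trans (le_of_eq ?_) hg0
    rw [DeltaShock.integrand]
    simp [(hR t _ htR).1]

/-- The contribution of a delta shock defined for `σ ≤ 0`: integration by parts along the paths of
its particles. -/
theorem integral_integrand_Iic {S : Fin 3 → GasState} {δ : DeltaShock} {P : ℝ × ℝ}
    (hδ : IsDeltaShock S δ) (hr : δ.range = Iic 0) (hP : δ.TerminatesAt P) (hg : δ.SlowGrowth)
    (k : Fin 4) {φ : ℝ × ℝ × ℝ → ℝ} (hφ : ContDiff ℝ ∞ φ) (hφc : HasCompactSupport φ)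
    (hgain : IntegrableOn (gain S δ k φ) (paramCone (Iio 0))) :
    IntegrableOn (δ.integrand k φ) δ.domain ∧
    ∫ p in δ.domain, δ.integrand k φ p =
      -(∫ s in Ioi (0 : ℝ), s * δ.dens k 0 * φ (s, s • δ.Ξ 0))
        - ∫ p in paramCone (Iio 0), gain S δ k φ p := by
  have hdom : δ.domain = paramCone (Iic 0) := by rw [DeltaShock.domain, hr]; rfl
  have hint := δ.integrableOn_integrand hδ hr hP hg k hφ hφc
  refine ⟨hdom ▸ hint, ?_⟩
  have hae : paramCone (Iic 0) =ᵐ[volume] paramCone (Iio 0) :=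
    paramCone_ae_eq Iio_subset_Iic_self fun x hx => by
      rcases (mem_Iic.1 hx).eq_or_lt with h | h
      · exact Or.inl h
      · exact Or.inr h
  have hgain' : IntegrableOn (gain S δ k φ) (paramCone (Iic 0)) := hgain.congr_set_ae hae
  rw [hdom, ← setIntegral_congr_set hae, eq_sub_iff_add_eq, ← integral_add hint hgain']
  have hm : MeasurableSet (paramCone (Iic 0)) := measurableSet_paramCone measurableSet_Iic
  set h : ℝ × ℝ → ℝ := fun p => δ.integrand k φ p + gain S δ k φ p with hh
  have hhi : IntegrableOn h (paramCone (Iic 0)) := hint.add hgain'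
  have hhi' : Integrable ((paramCone (Iic 0)).indicator h) := (integrable_indicator_iff hm).2 hhi
  rw [← integral_indicator hm, Measure.volume_eq_prod, integral_prod_symm _ hhi']
  have hmem : ∀ t s : ℝ, (t, s) ∈ paramCone (Iic 0) ↔ 0 < s ∧ s ≤ t := by
    intro t s
    constructor
    · rintro ⟨h1, h2, h3⟩
      simp only at h1 h2 h3
      refine ⟨h2, ?_⟩
      by_contra h4
      have := Real.log_pos ((one_lt_div h1).2 (not_le.1 h4))
      exact absurd h3 (not_le.2 this)
    · rintro ⟨h1, h2⟩
      have h3 : 0 < t := h1.trans_le h2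
      exact ⟨h3, h1, Real.log_nonpos (div_pos h1 h3).le ((div_le_one h3).2 h2)⟩
  have hsec : ∀ᵐ s : ℝ, Integrable (fun t => (paramCone (Iic 0)).indicator h (t, s)) :=
    hhi'.prod_left_ae
  rw [← integral_neg, ← integral_indicator measurableSet_Ioi]
  refine integral_congr_ae ?_
  filter_upwards [hsec] with s hs
  rcases le_or_gt s 0 with hs0 | hs0
  · rw [indicator_of_notMem (by simpa using hs0)]
    refine integral_eq_zero_of_ae (ae_of_all _ fun t => ?_)
    exact indicator_of_notMem (fun h => absurd ((hmem t s).1 h).1 (not_lt.2 hs0)) _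
  rw [indicator_of_mem (mem_Ioi.2 hs0)]
  have hind : (fun t => (paramCone (Iic 0)).indicator h (t, s)) =
      (Ici s).indicator (fun t => h (t, s)) := by
    ext t
    by_cases ht : s ≤ t
    · rw [indicator_of_mem ((hmem t s).2 ⟨hs0, ht⟩), indicator_of_mem (mem_Ici.2 ht)]
    · rw [indicator_of_notMem (fun h => ht ((hmem t s).1 h).2),
        indicator_of_notMem (fun h => ht (mem_Ici.1 h))]
  rw [hind, integrable_indicator_iff measurableSet_Ici] at hs
  rw [hind, integral_indicator measurableSet_Ici, integral_Ici_eq_integral_Ioi]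
  obtain ⟨M, R, hM0, hR0, hM, hR⟩ := exists_fderiv_bound hφ hφc
  -- For a fixed label `s`, the balance law and `Ξ - Ξ' = U` make the integrand plus the absorbed
  -- amount equal to the derivative of `H` along the particle path. `H` vanishes for large `t`, so
  -- only the value at `t = s`, the birth of the particle at `σ = 0`, remains.
  set H : ℝ → ℝ := fun t => t * δ.dens k (Real.log (s / t)) *
    φ (t, t • δ.Ξ (Real.log (s / t))) with hH
  have hlogc : ContinuousOn (fun t : ℝ => Real.log (s / t)) (Ici s) := by
    refine (continuousOn_const.div continuousOn_id fun t ht => ?_).log fun t ht => ?_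
    · exact (hs0.trans_le ht).ne'
    · exact (div_pos hs0 (hs0.trans_le ht)).ne'
  have hmaps : MapsTo (fun t : ℝ => Real.log (s / t)) (Ici s) (Iic 0) := fun t ht =>
    ((hmem t s).2 ⟨hs0, ht⟩).2.2
  have hΞ : ContinuousOn δ.Ξ (Iic 0) := hr ▸ hδ.smooth_Ξ.continuousOn
  have hdens : ContinuousOn (δ.dens k) (Iic 0) := fun σ hσ =>
    hr ▸ (hδ.balance k σ (hr ▸ hσ)).continuousWithinAt
  have hHc : ContinuousOn H (Ici s) :=
    (continuousOn_id.mul (hdens.comp hlogc hmaps)).mul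
      (hφ.continuous.comp_continuousOn
        (continuousOn_id.prodMk (continuousOn_id.smul (hΞ.comp hlogc hmaps))))
  have hHd : ∀ t ∈ Ioi s, HasDerivAt H (h (t, s)) t := by
    intro t ht
    have ht0 : 0 < t := hs0.trans ht
    have hσ : Real.log (s / t) < 0 :=
      Real.log_neg (div_pos hs0 ht0) ((div_lt_one ht0).2 ht)
    have hσn : Iic (0 : ℝ) ∈ 𝓝 (Real.log (s / t)) := Iic_mem_nhds hσ
    have hσm : Real.log (s / t) ∈ δ.range := hr ▸ hσ.le
    have e1 : HasDerivAt (fun t : ℝ => Real.log (s / t)) (-t⁻¹) t := by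
      have := ((hasDerivAt_const t s).div (hasDerivAt_id t) ht0.ne').log
        (div_pos hs0 ht0).ne'
      refine this.congr_deriv ?_
      have hs' := hs0.ne'
      simp only [id, Pi.div_apply]
      field_simp
      ring
    have e2 := ((hδ.balance k _ hσm).hasDerivAt (hr ▸ hσn)).comp t e1
    have e3 := ((hδ.curve _ hσm).hasDerivAt (hr ▸ hσn)).scomp t e1
    have e4 := (hasDerivAt_id t).prodMk ((hasDerivAt_id t).smul e3)
    have hφd : Differentiable ℝ φ := hφ.differentiable (by simp)
    have e5 := (hφd (t, t • δ.Ξ (Real.log (s / t)))).hasFDerivAt.comp_hasDerivAt t e4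
    have e6 := ((hasDerivAt_id t).mul e2).mul e5
    refine e6.congr_deriv ?_
    simp only [hh, DeltaShock.integrand, gain, id, Function.comp, Pi.mul_apply, Pi.smul_apply']
    set σ := Real.log (s / t)
    have hvec : ((1, t • (-t⁻¹) • (δ.Ξ σ - δ.U σ) + (1 : ℝ) • δ.Ξ σ) : ℝ × ℝ × ℝ)
        = (1, δ.U σ) := by
      rw [smul_smul, mul_neg, mul_inv_cancel₀ ht0.ne']
      simp
    simp only [hvec]
    field_simp
    ring
  rw [integral_Ioi_of_hasDerivAt_of_tendsto (hHc s (mem_Ici.2 le_rfl)) hHd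
    (hs.mono_set Ioi_subset_Ici_self) (m := 0)]
  · simp [hH, div_self hs0.ne']
  · refine tendsto_const_nhds.congr' ?_
    filter_upwards [eventually_gt_atTop R] with t ht
    simp [hH, (hR t _ ht).2]

/-! ### Straight delta shocks -/

section Straight

variable {S : Fin 3 → GasState} {l r : Fin 3} {C : ℝ × ℝ} {I : Set ℝ}

/-- The constant weights of a straight delta shock. -/
noncomputable def straightDens (S : Fin 3 → GasState) (l r : Fin 3) (C : ℝ × ℝ) (k : Fin 4) : ℝ :=
  cross ((S r).vel - (S l).vel) C * ((S l).dens k * √(S r).ρ + (S r).dens k * √(S l).ρ) /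
    (√(S l).ρ + √(S r).ρ)

/-- The kinetic loss included in `n` is exactly what makes the energy weight obey the same averaging
formula as mass and momentum. -/
theorem straightDelta_dens (hρ : ∀ i, 0 < (S i).ρ) (k : Fin 4) (σ : ℝ) :
    (straightDelta S l r C I).dens k σ = straightDens S l r C k := by
  have hl := Real.sqrt_pos.2 (hρ l)
  have hr := Real.sqrt_pos.2 (hρ r)
  have hl2 := Real.mul_self_sqrt (hρ l).le
  have hr2 := Real.mul_self_sqrt (hρ r).le
  have hs : √(S l).ρ + √(S r).ρ ≠ 0 := by positivity
  have hlr : √((S l).ρ * (S r).ρ) = √(S l).ρ * √(S r).ρ := Real.sqrt_mul (hρ l).le _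
  simp only [straightDens, DeltaShock.dens, straightDelta, GasState.dens, hlr]
  set X := cross ((S r).vel - (S l).vel) C
  set p := √(S l).ρ
  set q := √(S r).ρ
  rw [← hl2, ← hr2]
  fin_cases k
  · simp
    field_simp
  · simp only [avg_fst]
    simp
    change _ * (((p * (S l).u + q * (S r).u)) / (p + q)) = _
    field_simp
  · simp only [avg_snd]
    simp
    change _ * (((p * (S l).v + q * (S r).v)) / (p + q)) = _
    field_simp
  · simp only [nsq, avg_fst, avg_snd, GasState.vel]
    simp
    change _ + _ * ((((p * (S l).u + q * (S r).u)) / (p + q)) ^ 2 +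
      (((p * (S l).v + q * (S r).v)) / (p + q)) ^ 2) = _
    field_simp
    ring

theorem tri_left_straight (hρ : ∀ i, 0 < (S i).ρ) (a : ℝ) :
    tri (S l).vel (avg (S l) (S r)) (avg (S l) (S r) + a • C) =
      a * (√(S r).ρ / (√(S l).ρ + √(S r).ρ) * cross ((S r).vel - (S l).vel) C) := by
  have hl := Real.sqrt_pos.2 (hρ l)
  have hr := Real.sqrt_pos.2 (hρ r)
  have hs : √(S l).ρ + √(S r).ρ ≠ 0 := by positivity
  rw [tri_eq]
  simp only [Prod.fst_add, Prod.snd_add, avg_fst, avg_snd, cross, GasState.vel, Prod.fst_sub,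
    Prod.snd_sub, Prod.smul_fst, Prod.smul_snd, smul_eq_mul]
  field_simp
  ring

theorem tri_right_straight (hρ : ∀ i, 0 < (S i).ρ) (a : ℝ) :
    tri (S r).vel (avg (S l) (S r)) (avg (S l) (S r) + a • C) =
      -(a * (√(S l).ρ / (√(S l).ρ + √(S r).ρ) * cross ((S r).vel - (S l).vel) C)) := by
  have hl := Real.sqrt_pos.2 (hρ l)
  have hr := Real.sqrt_pos.2 (hρ r)
  have hs : √(S l).ρ + √(S r).ρ ≠ 0 := by positivity
  rw [tri_eq]
  simp only [Prod.fst_add, Prod.snd_add, avg_fst, avg_snd, cross, GasState.vel, Prod.fst_sub,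
    Prod.snd_sub, Prod.smul_fst, Prod.smul_snd, smul_eq_mul]
  field_simp
  ring

/-- The rate of absorption of a straight delta shock is constant. -/
theorem absorption_straight (hρ : ∀ i, 0 < (S i).ρ) (k : Fin 4) (σ : ℝ) :
    ((S l).dens k * tri (S l).vel (avg (S l) (S r)) (avg (S l) (S r) + Real.exp σ • C)
      - (S r).dens k * tri (S r).vel (avg (S l) (S r)) (avg (S l) (S r) + Real.exp σ • C)) *
      Real.exp (-σ) = straightDens S l r C k := by
  have hl := Real.sqrt_pos.2 (hρ l)
  have hr := Real.sqrt_pos.2 (hρ r)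
  have hs : √(S l).ρ + √(S r).ρ ≠ 0 := by positivity
  have he := (Real.exp_pos σ).ne'
  rw [tri_left_straight hρ, tri_right_straight hρ, straightDens, Real.exp_neg]
  field_simp
  ring

theorem entropy_straight (hρ : ∀ i, 0 < (S i).ρ)
    (hC : 0 < cross ((S r).vel - (S l).vel) C) (σ : ℝ) :
    0 < tri (S l).vel (avg (S l) (S r)) (avg (S l) (S r) + Real.exp σ • C) ∧
      tri (S r).vel (avg (S l) (S r)) (avg (S l) (S r) + Real.exp σ • C) < 0 := by
  have hl := Real.sqrt_pos.2 (hρ l)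
  have hr := Real.sqrt_pos.2 (hρ r)
  have he := Real.exp_pos σ
  rw [tri_left_straight hρ, tri_right_straight hρ]
  constructor
  · positivity
  · have : 0 < Real.exp σ * (√(S l).ρ / (√(S l).ρ + √(S r).ρ) *
      cross ((S r).vel - (S l).vel) C) := by positivity
    linarith

theorem hasDerivAt_straight (P C : ℝ × ℝ) (σ : ℝ) :
    HasDerivAt (fun σ => P + Real.exp σ • C) (P + Real.exp σ • C - P) σ := by
  have := ((Real.hasDerivAt_exp σ).smul_const C).const_add P
  rwa [add_sub_cancel_left]

theorem injective_straight (P : ℝ × ℝ) {C : ℝ × ℝ} (hC : C ≠ 0) :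
    Function.Injective fun σ => P + Real.exp σ • C := by
  intro σ σ' h
  have := add_left_cancel h
  exact Real.exp_injective (smul_left_injective ℝ hC this)

theorem ne_zero_of_cross_pos {P C : ℝ × ℝ} (hC : 0 < cross P C) : C ≠ 0 := by
  rintro rfl
  simp [cross] at hC

theorem straightDelta_m_pos (hρ : ∀ i, 0 < (S i).ρ)
    (hC : 0 < cross ((S r).vel - (S l).vel) C) (σ : ℝ) :
    0 < (straightDelta S l r C I).m σ :=
  mul_pos (Real.sqrt_pos.2 (mul_pos (hρ l) (hρ r))) hC

theorem straightDelta_n_pos (hρ : ∀ i, 0 < (S i).ρ) (hH : ∀ i, 0 ≤ (S i).H)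
    (hC : 0 < cross ((S r).vel - (S l).vel) C) (σ : ℝ) :
    0 < (straightDelta S l r C I).n σ := by
  have hl := Real.sqrt_pos.2 (hρ l)
  have hr := Real.sqrt_pos.2 (hρ r)
  have hn : 0 < nsq ((S l).vel - (S r).vel) := by
    simp only [cross, GasState.vel, nsq, Prod.fst_sub, Prod.snd_sub] at hC ⊢
    by_contra h
    have hu := sq_nonneg ((S l).u - (S r).u)
    have hv := sq_nonneg ((S l).v - (S r).v)
    have h1 : (S l).u - (S r).u = 0 := pow_eq_zero_iff (two_ne_zero) |>.1 (by linarith)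
    have h2 : (S l).v - (S r).v = 0 := pow_eq_zero_iff (two_ne_zero) |>.1 (by linarith)
    have h3 : (S r).u - (S l).u = 0 := by linarith
    have h4 : (S r).v - (S l).v = 0 := by linarith
    rw [h3, h4] at hC
    simp at hC
  have h1 := hρ l
  have h2 := hρ r
  have h3 := hH l
  have h4 := hH r
  simp only [straightDelta]
  refine mul_pos ?_ (by positivity)
  have : 0 < (S l).ρ * (S r).ρ * nsq ((S l).vel - (S r).vel) /
      (2 * (√(S l).ρ + √(S r).ρ)) := by positivity
  have : 0 ≤ √(S r).ρ * (S l).H := by positivity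
  have : 0 ≤ √(S l).ρ * (S r).H := by positivity
  linarith

/-- The weights are constant, so `g' = 0`, and the balance law only asks that they equal the
constant rate of absorption. -/
theorem isDeltaShock_straight (hρ : ∀ i, 0 < (S i).ρ) (hH : ∀ i, 0 ≤ (S i).H)
    (hC : 0 < cross ((S r).vel - (S l).vel) C) :
    IsDeltaShock S (straightDelta S l r C I) where
  smooth_Ξ := (contDiff_const.add (Real.contDiff_exp.smul contDiff_const)).contDiffOn
  smooth_U := contDiffOn_const
  smooth_m := contDiffOn_const
  smooth_n := contDiffOn_const
  simple := (injective_straight _ (ne_zero_of_cross_pos hC)).injOn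
  curve σ _ := (hasDerivAt_straight _ _ σ).hasDerivWithinAt
  balance k σ _ := by
    have h1 : (straightDelta S l r C I).dens k = fun _ => straightDens S l r C k :=
      funext fun σ => straightDelta_dens hρ k σ
    rw [h1]
    refine (hasDerivWithinAt_const σ I (straightDens S l r C k)).congr_deriv ?_
    exact (sub_eq_zero.2 (absorption_straight hρ k σ).symm).symm
  entropy σ _ := entropy_straight hρ hC σ
  pos σ _ := ⟨straightDelta_m_pos hρ hC σ, straightDelta_n_pos hρ hH hC σ⟩

theorem tendsto_straight (P C : ℝ × ℝ) :
    Tendsto (fun σ => P + Real.exp σ • C) atBot (𝓝 P) := by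
  simpa using (Real.tendsto_exp_atBot.smul_const C).const_add P

theorem terminatesAt_straight (S : Fin 3 → GasState) (l r : Fin 3) (C : ℝ × ℝ) (I : Set ℝ) :
    (straightDelta S l r C I).TerminatesAt (avg (S l) (S r)) :=
  ⟨tendsto_straight _ _, tendsto_const_nhds⟩

/-- The straight delta shock between two states that starts with zero weights at parameter `0`. -/
noncomputable def nascentDelta (S : Fin 3 → GasState) (l r : Fin 3) (C : ℝ × ℝ) : DeltaShock :=
  { straightDelta S l r C (Iic 0) with
    m := fun σ => (1 - Real.exp σ) * (straightDelta S l r C (Iic 0)).m σ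
    n := fun σ => (1 - Real.exp σ) * (straightDelta S l r C (Iic 0)).n σ }

theorem nascentDelta_dens (hρ : ∀ i, 0 < (S i).ρ) (k : Fin 4) (σ : ℝ) :
    (nascentDelta S l r C).dens k σ = (1 - Real.exp σ) * straightDens S l r C k := by
  rw [← straightDelta_dens (I := Iic 0) hρ k σ]
  simp only [nascentDelta, DeltaShock.dens]
  fin_cases k
  · simp
  · simp
    ring
  · simp
    ring
  · simp
    ring

/-- Multiples of `exp σ` solve `g - g' = 0`. They can therefore be subtracted from the constant
weights without disturbing the balance law, and the factor `1 - exp σ` makes the weights vanish at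
`σ = 0`. The ratio of momentum to mass stays `U*`, so the curve remains straight. -/
theorem isDeltaShock_nascent (hρ : ∀ i, 0 < (S i).ρ) (hH : ∀ i, 0 ≤ (S i).H)
    (hC : 0 < cross ((S r).vel - (S l).vel) C) : IsDeltaShock S (nascentDelta S l r C) where
  smooth_Ξ := (contDiff_const.add (Real.contDiff_exp.smul contDiff_const)).contDiffOn
  smooth_U := contDiffOn_const
  smooth_m := ((contDiff_const.sub Real.contDiff_exp).mul contDiff_const).contDiffOn
  smooth_n := ((contDiff_const.sub Real.contDiff_exp).mul contDiff_const).contDiffOn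
  simple := (injective_straight _ (ne_zero_of_cross_pos hC)).injOn
  curve σ _ := (hasDerivAt_straight _ _ σ).hasDerivWithinAt
  balance k σ _ := by
    have h1 : (nascentDelta S l r C).dens k =
        fun σ => (1 - Real.exp σ) * straightDens S l r C k :=
      funext fun σ => nascentDelta_dens hρ k σ
    rw [h1]
    have h2 := ((Real.hasDerivAt_exp σ).const_sub 1).mul_const (straightDens S l r C k)
    refine h2.hasDerivWithinAt.congr_deriv ?_
    have h3 := absorption_straight (C := C) (l := l) (r := r) hρ k σ
    change _ = _ - ((S l).dens k *
      tri (S l).vel (avg (S l) (S r)) (avg (S l) (S r) + Real.exp σ • C)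
      - (S r).dens k * tri (S r).vel (avg (S l) (S r)) (avg (S l) (S r) + Real.exp σ • C)) *
      Real.exp (-σ)
    rw [h3]
    ring
  entropy σ _ := entropy_straight hρ hC σ
  pos σ hσ := by
    have hσ' : σ < 0 := by
      have : σ ∈ interior (Iic (0 : ℝ)) := hσ
      simpa using this
    have : 0 < 1 - Real.exp σ := sub_pos.2 (by
      rw [← Real.exp_zero]
      exact Real.exp_lt_exp.2 hσ')
    exact ⟨mul_pos this (straightDelta_m_pos hρ hC σ),
      mul_pos this (straightDelta_n_pos hρ hH hC σ)⟩

theorem slowGrowth_nascent (hρ : ∀ i, 0 < (S i).ρ) : (nascentDelta S l r C).SlowGrowth := by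
  refine ⟨∑ k, |straightDens S l r C k|, fun k σ hσ => ?_⟩
  rw [nascentDelta_dens hρ, abs_mul]
  have h1 : |1 - Real.exp σ| ≤ Real.exp (-σ / 2) := by
    have h2 := Real.exp_le_one_iff.2 hσ
    have h3 := Real.exp_pos σ
    have h4 : 1 ≤ Real.exp (-σ / 2) := Real.one_le_exp (by linarith)
    rw [abs_le]
    constructor <;> linarith
  have h5 : |straightDens S l r C k| ≤ ∑ k, |straightDens S l r C k| :=
    Finset.single_le_sum (f := fun k => |straightDens S l r C k|) (fun i _ => abs_nonneg _)
      (Finset.mem_univ k)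
  calc |1 - Real.exp σ| * |straightDens S l r C k|
      ≤ Real.exp (-σ / 2) * ∑ k, |straightDens S l r C k| := by gcongr
    _ = _ := mul_comm _ _

/-- Paths of the particles of a straight delta shock. -/
noncomputable def straightPath (P C : ℝ × ℝ) : ℝ × ℝ →L[ℝ] ℝ × ℝ × ℝ :=
  (ContinuousLinearMap.fst ℝ ℝ ℝ).prod
    ((ContinuousLinearMap.fst ℝ ℝ ℝ).smulRight P + (ContinuousLinearMap.snd ℝ ℝ ℝ).smulRight C)

theorem straightPath_apply (P C : ℝ × ℝ) (t s : ℝ) :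
    straightPath P C (t, s) = (t, t • P + s • C) := by
  simp [straightPath]

theorem hasCompactSupport_comp_straightPath {β : Type*} [Zero β] {f : ℝ × ℝ × ℝ → β}
    (hf : HasCompactSupport f) (P : ℝ × ℝ) {C : ℝ × ℝ} (hC : C ≠ 0) :
    HasCompactSupport (f ∘ straightPath P C) := by
  refine hf.comp_isClosedEmbedding
    (LinearMap.isClosedEmbedding_of_injective (f := (straightPath P C).toLinearMap) ?_)
  rw [LinearMap.ker_eq_bot']
  rintro ⟨t, s⟩ h
  change straightPath P C (t, s) = 0 at h
  rw [straightPath_apply, Prod.mk_eq_zero] at h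
  obtain ⟨rfl, h⟩ := h
  simp only [zero_smul, zero_add, smul_eq_zero] at h
  rcases h with h | h
  · rw [h]; rfl
  · exact absurd h hC

/-- The paths `t ↦ (t, t U* + s C)` are straight and defined for all `t`, so compact support of `φ`
gives integrability directly. `J s` is the set of times at which the label `s` is on the shock, and
`b s` records its boundary term: `1` when the particle leaves at `t = s`, `0` when it stays forever.
The start `t = 0` contributes nothing because of the factor `t` in the weight. -/
theorem integral_integrand_straight (hρ : ∀ i, 0 < (S i).ρ)
    (hC : C ≠ 0) (k : Fin 4) {φ : ℝ × ℝ × ℝ → ℝ} (hφ : ContDiff ℝ ∞ φ)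
    (hφc : HasCompactSupport φ) {T : Set ℝ} (hT : MeasurableSet T) {J : ℝ → Set ℝ} {b : ℝ → ℝ}
    (hJ : ∀ s, 0 < s → ∀ t, (t, s) ∈ paramCone T ↔ t ∈ J s)
    (hb : ∀ s, 0 < s → ∀ H H' : ℝ → ℝ, (∀ t, HasDerivAt H (H' t) t) → Integrable H' →
      H 0 = 0 → Tendsto H atTop (𝓝 0) → ∫ t in J s, H' t = b s * H s) :
    IntegrableOn ((straightDelta S l r C I).integrand k φ) (paramCone T) ∧
    ∫ p in paramCone T, (straightDelta S l r C I).integrand k φ p =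
      (∫ s in Ioi (0 : ℝ), b s * (s * straightDens S l r C k *
        φ (s, s • (avg (S l) (S r) + C))))
        - ∫ p in paramCone T, gain S (straightDelta S l r C I) k φ p := by
  set V := avg (S l) (S r) with hV
  set d := straightDens S l r C k with hd
  have hm : MeasurableSet (paramCone T) := measurableSet_paramCone hT
  have hφ' : Continuous (fderiv ℝ φ) := hφ.continuous_fderiv (by simp)
  have hφd : Differentiable ℝ φ := hφ.differentiable (by simp)
  have hpc : Continuous (straightPath V C) := (straightPath V C).continuous
  set f₁ : ℝ × ℝ → ℝ := fun p => p.1 * d * fderiv ℝ φ (straightPath V C p) (1, V) with hf₁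
  set f₂ : ℝ × ℝ → ℝ := fun p => d * φ (straightPath V C p) with hf₂
  have hf₁i : Integrable f₁ := by
    refine Continuous.integrable_of_hasCompactSupport ?_ ?_
    · exact (continuous_fst.mul continuous_const).mul
        ((hφ'.comp hpc).clm_apply continuous_const)
    · have h1 := hasCompactSupport_comp_straightPath (hφc.fderiv (𝕜 := ℝ)) V hC
      have h2 := h1.comp_left (g := fun L : ℝ × ℝ × ℝ →L[ℝ] ℝ => L (1, V)) (by simp)
      exact h2.mul_left
  have hf₂i : Integrable f₂ := by
    refine Continuous.integrable_of_hasCompactSupport ?_ ?_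
    · exact continuous_const.mul (hφ.continuous.comp hpc)
    · exact (hasCompactSupport_comp_straightPath hφc V hC).mul_left
  have hpos : ∀ p ∈ paramCone T, p.1 • (V + Real.exp (Real.log (p.2 / p.1)) • C) =
      p.1 • V + p.2 • C := by
    rintro ⟨t, s⟩ ⟨h1, h2, -⟩
    simp only at h1 h2 ⊢
    rw [Real.exp_log (div_pos h2 h1), smul_add, smul_smul, mul_div_cancel₀ _ h1.ne']
  have e₁ : EqOn ((straightDelta S l r C I).integrand k φ) f₁ (paramCone T) := by
    rintro ⟨t, s⟩ hp
    simp only [DeltaShock.integrand, straightDelta_dens hρ, ← hd, hf₁, straightPath_apply]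
    have := hpos _ hp
    simp only at this
    change _ * fderiv ℝ φ (t, t • (V + Real.exp (Real.log (s / t)) • C)) (1, V) = _
    rw [this]
  have e₂ : EqOn (gain S (straightDelta S l r C I) k φ) f₂ (paramCone T) := by
    rintro ⟨t, s⟩ hp
    have := hpos _ hp
    simp only at this
    have h3 := absorption_straight (C := C) (l := l) (r := r) hρ k (Real.log (s / t))
    simp only [hf₂, straightPath_apply, ← this]
    change _ * _ * φ (t, t • (V + Real.exp (Real.log (s / t)) • C)) = _
    rw [hd, ← h3]
    rfl
  refine ⟨(integrableOn_congr_fun e₁ hm).2 hf₁i.integrableOn, ?_⟩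
  rw [setIntegral_congr_fun hm e₁, setIntegral_congr_fun hm e₂, eq_sub_iff_add_eq,
    ← integral_add hf₁i.integrableOn hf₂i.integrableOn, ← integral_indicator hm]
  set h : ℝ × ℝ → ℝ := fun p => f₁ p + f₂ p with hh
  have hhi : Integrable h := hf₁i.add hf₂i
  have hhi' : Integrable ((paramCone T).indicator h) := hhi.indicator hm
  rw [Measure.volume_eq_prod, integral_prod_symm _ hhi', ← integral_indicator measurableSet_Ioi]
  have hsec : ∀ᵐ s : ℝ, Integrable (fun t => h (t, s)) := hhi.prod_left_ae
  refine integral_congr_ae ?_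
  filter_upwards [hsec] with s hs
  rcases le_or_gt s 0 with hs0 | hs0
  · rw [indicator_of_notMem (by simpa using hs0)]
    refine integral_eq_zero_of_ae (ae_of_all _ fun t => ?_)
    exact indicator_of_notMem (fun h => absurd h.2.1 (not_lt.2 hs0)) _
  rw [indicator_of_mem (mem_Ioi.2 hs0)]
  have hJm : MeasurableSet (J s) := by
    have : J s = (fun t => (t, s)) ⁻¹' paramCone T := by
      ext t
      exact (hJ s hs0 t).symm
    rw [this]
    exact measurable_prodMk_right hm
  have hind : (fun t => (paramCone T).indicator h (t, s)) =
      (J s).indicator (fun t => h (t, s)) := by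
    ext t
    by_cases ht : t ∈ J s
    · rw [indicator_of_mem ((hJ s hs0 t).2 ht), indicator_of_mem ht]
    · rw [indicator_of_notMem (fun h => ht ((hJ s hs0 t).1 h)), indicator_of_notMem ht]
  rw [hind, integral_indicator hJm]
  obtain ⟨M, R, -, -, -, hR⟩ := exists_fderiv_bound hφ hφc
  rw [hb s hs0 (fun t => t * d * φ (t, t • V + s • C)) (fun t => h (t, s)) ?_ hs (by simp) ?_]
  · rw [smul_add]
  · intro t
    have e4 : HasDerivAt (fun t : ℝ => ((t, t • V + s • C) : ℝ × ℝ × ℝ)) (1, V) t := by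
      have := (hasDerivAt_id t).prodMk (((hasDerivAt_id t).smul_const V).add_const (s • C))
      simpa using this
    have e5 := (hφd (t, t • V + s • C)).hasFDerivAt.comp_hasDerivAt t e4
    refine (((hasDerivAt_id t).mul_const d).mul e5).congr_deriv ?_
    simp only [hh, hf₁, hf₂, straightPath_apply, id, Function.comp]
    ring
  · refine tendsto_const_nhds.congr' ?_
    filter_upwards [eventually_gt_atTop R] with t ht
    simp [(hR t _ ht).2]

theorem integral_integrand_straight_Ici (hρ : ∀ i, 0 < (S i).ρ)
    (hC : C ≠ 0) (k : Fin 4) {φ : ℝ × ℝ × ℝ → ℝ} (hφ : ContDiff ℝ ∞ φ)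
    (hφc : HasCompactSupport φ) :
    IntegrableOn ((straightDelta S l r C (Ici 0)).integrand k φ)
      (straightDelta S l r C (Ici 0)).domain ∧
    ∫ p in (straightDelta S l r C (Ici 0)).domain, (straightDelta S l r C (Ici 0)).integrand k φ p =
      (∫ s in Ioi (0 : ℝ), s * (straightDelta S l r C (Ici 0)).dens k 0 *
        φ (s, s • (straightDelta S l r C (Ici 0)).Ξ 0))
        - ∫ p in paramCone (Ioi 0), gain S (straightDelta S l r C (Ici 0)) k φ p := by
  have hae : paramCone (Ici 0) =ᵐ[volume] paramCone (Ioi 0) :=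
    paramCone_ae_eq Ioi_subset_Ici_self fun x hx => by
      rcases (mem_Ici.1 hx).eq_or_lt with h | h
      · exact Or.inl h.symm
      · exact Or.inr h
  have hJ : ∀ s : ℝ, 0 < s → ∀ t, (t, s) ∈ paramCone (Ici 0) ↔ t ∈ Ioc 0 s := by
    intro s hs t
    constructor
    · rintro ⟨h1, h2, h3⟩
      simp only at h1 h2 h3
      refine ⟨h1, ?_⟩
      by_contra h4
      have := Real.log_neg (div_pos h2 h1) ((div_lt_one h1).2 (not_le.1 h4))
      exact absurd h3 (not_le.2 this)
    · rintro ⟨h1, h2⟩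
      exact ⟨h1, hs, Real.log_nonneg ((one_le_div h1).2 h2)⟩
  obtain ⟨h1, h2⟩ := integral_integrand_straight (S := S) (l := l) (r := r) (I := Ici 0) hρ hC k hφ
    hφc measurableSet_Ici (b := fun _ => 1) hJ fun s hs H H' hH hi h0 _ => by
      rw [← intervalIntegral.integral_of_le hs.le,
        intervalIntegral.integral_eq_sub_of_hasDerivAt (fun t _ => hH t) hi.intervalIntegrable, h0]
      simp
  refine ⟨h1, ?_⟩
  change ∫ p in paramCone (Ici 0), _ = _
  rw [h2, setIntegral_congr_set hae, straightDelta_dens hρ]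
  simp [straightDelta]

theorem integral_integrand_straight_univ (hρ : ∀ i, 0 < (S i).ρ)
    (hC : C ≠ 0) (k : Fin 4) {φ : ℝ × ℝ × ℝ → ℝ} (hφ : ContDiff ℝ ∞ φ)
    (hφc : HasCompactSupport φ) :
    IntegrableOn ((straightDelta S l r C univ).integrand k φ)
      (straightDelta S l r C univ).domain ∧
    ∫ p in (straightDelta S l r C univ).domain, (straightDelta S l r C univ).integrand k φ p =
      - ∫ p in paramCone univ, gain S (straightDelta S l r C univ) k φ p := by
  obtain ⟨h1, h2⟩ := integral_integrand_straight (S := S) (l := l) (r := r) (I := univ) hρ hC k hφ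
    hφc MeasurableSet.univ (J := fun _ => Ioi 0) (b := fun _ => 0)
    (fun s hs t => ⟨fun h => h.1, fun h => ⟨h, hs, mem_univ _⟩⟩) fun s hs H H' hH hi h0 hlim => by
      rw [integral_Ioi_of_hasDerivAt_of_tendsto (hH 0).continuousAt.continuousWithinAt
        (fun t _ => hH t) hi.integrableOn hlim, h0]
      simp
  refine ⟨h1, ?_⟩
  change ∫ p in paramCone univ, _ = _
  rw [h2]
  simp

end Straight

/-! ### Regions bounded by graphs over the slanted coordinate -/

theorem continuous_slant (μ : ℝ) : Continuous (slant μ) :=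
  continuous_fst.add (continuous_const.mul continuous_snd)

/-- The data of a partition of the self-similar plane into three regions: in the coordinates
`(ξ + μη, η)`, the lower region lies below the graph of `lo`, and beyond the interaction point `A`,
where `lo` is constant, a vertical ray from `A` separates the other two. -/
structure Profile where
  μ : ℝ
  A : ℝ × ℝ
  lo : ℝ → ℝ
  μ_pos : 0 < μ
  continuous_lo : Continuous lo
  bounded_lo : ∃ B, ∀ ξ, |lo ξ| ≤ B
  lo_of_ge : ∀ ξ, slant μ A ≤ ξ → lo ξ = A.2

/-- The existence of a graph over the slanted coordinate containing a delta shock with states `3`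
and `2` on its sides. -/
theorem exists_profile {S : Fin 3 → GasState} {δ : DeltaShock} (hδ : IsDeltaShock S δ)
    (hl : δ.left = i₃) (hr : δ.right = i₂) (hI : δ.range = Iic 0)
    (hu : (S i₃).u < (S i₂).u) (hv : (S i₂).v < (S i₃).v) {P : ℝ × ℝ} (hP : δ.TerminatesAt P)
    {μ : ℝ} (hμ : μ = ((S i₂).u - (S i₃).u) / ((S i₃).v - (S i₂).v)) :
    ∃ p : Profile, p.μ = μ ∧ p.A = δ.Ξ 0 ∧ slant μ P < slant μ (δ.Ξ 0) ∧
      (∀ ξ ≤ slant μ P, p.lo ξ = P.2) ∧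
      (∀ σ ≤ 0, p.lo (slant μ (δ.Ξ σ)) = (δ.Ξ σ).2) ∧
      (∀ σ < 0, HasDerivAt p.lo ((δ.Ξ σ - δ.U σ).2 / slant μ (δ.Ξ σ - δ.U σ))
        (slant μ (δ.Ξ σ))) ∧
      (∀ σ ≤ 0, 0 < slant μ (δ.Ξ σ - δ.U σ)) ∧
      (fun σ => slant μ (δ.Ξ σ)) '' Iic 0 = Ioc (slant μ P) (slant μ (δ.Ξ 0)) ∧
      InjOn (fun σ => slant μ (δ.Ξ σ)) (Iic 0) := by
  have hdv : 0 < (S i₃).v - (S i₂).v := sub_pos.2 hv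
  have hμ0 : 0 < μ := hμ ▸ div_pos (sub_pos.2 hu) hdv
  set x := slant μ P with hx
  set χ : ℝ → ℝ := fun σ => slant μ (δ.Ξ σ) with hχ
  -- The difference of the entropy determinants is `(U₂ - U₃) × (Ξ - U)`, and for this `μ` it equals
  -- `v₃ - v₂` times the slanted coordinate of `Ξ - U`.
  have hχpos : ∀ σ ≤ 0, 0 < slant μ (δ.Ξ σ - δ.U σ) := by
    intro σ hσ
    have h := hδ.entropy σ (hI ▸ hσ)
    rw [hl, hr, tri_eq, tri_eq] at h
    have : 0 < ((S i₃).v - (S i₂).v) * slant μ (δ.Ξ σ - δ.U σ) := by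
      rw [slant, hμ, mul_add, ← mul_assoc, mul_div_cancel₀ _ hdv.ne']
      simp only [GasState.vel, Prod.fst_sub, Prod.snd_sub] at h ⊢
      linarith [h.1, h.2]
    exact pos_of_mul_pos_right this hdv.le
  have hΞd : ∀ σ ≤ 0, HasDerivWithinAt δ.Ξ (δ.Ξ σ - δ.U σ) (Iic 0) σ := by
    intro σ hσ
    have := hδ.curve σ (hI ▸ hσ)
    rwa [hI] at this
  have hΞc : ContinuousOn δ.Ξ (Iic 0) := fun σ hσ => (hΞd σ hσ).continuousWithinAt
  have hχd : ∀ σ ≤ 0, HasDerivWithinAt χ (slant μ (δ.Ξ σ - δ.U σ)) (Iic 0) σ := by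
    intro σ hσ
    have h1 := (hasFDerivAt_fst (𝕜 := ℝ) (p := δ.Ξ σ)).comp_hasDerivWithinAt σ (hΞd σ hσ)
    have h2 := (hasFDerivAt_snd (𝕜 := ℝ) (p := δ.Ξ σ)).comp_hasDerivWithinAt σ (hΞd σ hσ)
    exact h1.add (h2.const_mul μ)
  have hmono : StrictMonoOn χ (Iic 0) := by
    refine strictMonoOn_of_deriv_pos (convex_Iic 0)
      (fun σ hσ => (hχd σ hσ).continuousWithinAt) fun σ hσ => ?_
    rw [interior_Iic] at hσ
    rw [((hχd σ hσ.le).hasDerivAt (Iic_mem_nhds hσ)).deriv]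
    exact hχpos σ hσ.le
  have hlim : Tendsto χ atBot (𝓝 x) := ((continuous_slant μ).tendsto P).comp hP.1
  have hgt : ∀ σ ≤ 0, x < χ σ := by
    intro σ hσ
    have h1 : χ (σ - 1) < χ σ := hmono (mem_Iic.2 (by linarith)) hσ (by linarith)
    refine lt_of_le_of_lt (le_of_tendsto hlim ?_) h1
    filter_upwards [eventually_le_atBot (σ - 1)] with s hs
    exact hmono.monotoneOn (mem_Iic.2 (by linarith)) (mem_Iic.2 (by linarith)) hs
  set y := χ 0 with hy
  have hxy : x < y := hgt 0 le_rfl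
  -- The map `τ ↦ 1/(χ (-τ) - x)` turns the approach to the limit `x` as `σ → -∞` into growth to
  -- infinity, so the inverse on a half-line applies, up to and including the end `σ = 0`.
  obtain ⟨g, hgc, hgtop, hgf, hfg, hgd⟩ := exists_inverse (f := fun τ => (χ (-τ) - x)⁻¹)
    (f' := fun τ => slant μ (δ.Ξ (-τ) - δ.U (-τ)) / (χ (-τ) - x) ^ 2) (a := 0) (by
      intro τ hτ
      have h1 := (hχd (-τ) (by linarith)).scomp τ ((hasDerivAt_neg τ).hasDerivWithinAt (s := Ici 0))
        (fun t ht => mem_Iic.2 (neg_nonpos.2 (mem_Ici.1 ht)))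
      refine ((h1.sub_const x).fun_inv (sub_pos.2 (hgt (-τ) (by linarith))).ne').congr_deriv ?_
      simp) (by
      intro τ hτ
      exact div_pos (hχpos _ (by linarith)) (pow_pos (sub_pos.2 (hgt (-τ) (by linarith))) 2)) (by
      refine tendsto_inv_nhdsGT_zero.comp (tendsto_nhdsWithin_iff.2 ⟨?_, ?_⟩)
      · have := (hlim.comp tendsto_neg_atTop_atBot).sub_const x
        simpa using this
      · filter_upwards [eventually_ge_atTop 0] with τ hτ
        exact sub_pos.2 (hgt (-τ) (by linarith)))
  simp only [neg_zero] at hfg hgd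
  set s : ℝ → ℝ := fun ξ => -g (ξ - x)⁻¹ with hs
  have hinv : ∀ ξ, x < ξ → ξ ≤ y → (y - x)⁻¹ ≤ (ξ - x)⁻¹ := fun ξ h1 h2 =>
    inv_anti₀ (sub_pos.2 h1) (by linarith)
  have hs0 : ∀ ξ, x < ξ → ξ ≤ y → s ξ ≤ 0 := fun ξ h1 h2 =>
    neg_nonpos.2 (hfg _ (hinv ξ h1 h2)).1
  have hχs : ∀ ξ, x < ξ → ξ ≤ y → χ (s ξ) = ξ := fun ξ h1 h2 => by
    have := inv_injective (hfg _ (hinv ξ h1 h2)).2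
    change χ (-g (ξ - x)⁻¹) = ξ
    linarith
  have hsχ : ∀ σ ≤ 0, s (χ σ) = σ := fun σ hσ => by
    have := hgf (-σ) (by linarith)
    rw [neg_neg] at this
    simp only [hs, this, neg_neg]
  have hχle : ∀ σ ≤ 0, χ σ ≤ y := fun σ hσ => hmono.monotoneOn hσ (mem_Iic.2 le_rfl) hσ
  -- Taking `min ξ y` freezes the height at that of the interaction point, which gives the
  -- horizontal ray beyond it.
  set k : ℝ → ℝ := fun ξ => (δ.Ξ (s (min ξ y))).2 with hk
  set lo : ℝ → ℝ := fun ξ => if ξ ≤ x then P.2 else k ξ with hlo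
  have hmin : ∀ ξ, x < ξ → x < min ξ y := fun ξ h => lt_min h hxy
  have hkc : ContinuousOn (fun ξ => δ.Ξ (s (min ξ y))) (Ioi x) := by
    refine hΞc.comp (hgc.comp_continuousOn ?_).neg fun ξ hξ =>
      hs0 _ (hmin ξ hξ) (min_le_right _ _)
    exact ContinuousOn.inv₀ (by fun_prop) fun ξ hξ => (sub_pos.2 (hmin ξ hξ)).ne'
  have hlo_le : ∀ ξ ≤ x, lo ξ = P.2 := fun ξ h => if_pos h
  have hlo_gt : ∀ ξ, x < ξ → lo ξ = k ξ := fun ξ h => if_neg (not_le.2 h)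
  have hlo_ge : ∀ ξ, y ≤ ξ → lo ξ = (δ.Ξ 0).2 := fun ξ h => by
    rw [hlo_gt ξ (hxy.trans_le h), hk]
    simp only [min_eq_right h]
    rw [hsχ 0 le_rfl]
  have hlo_χ : ∀ σ ≤ 0, lo (χ σ) = (δ.Ξ σ).2 := fun σ hσ => by
    rw [hlo_gt _ (hgt σ hσ), hk]
    simp only [min_eq_left (hχle σ hσ)]
    rw [hsχ σ hσ]
  have hcont : Continuous lo := by
    rw [continuous_iff_continuousAt]
    intro ξ
    rcases lt_trichotomy ξ x with h | h | h
    · refine (continuousAt_const (y := P.2)).congr ?_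
      filter_upwards [Iio_mem_nhds h] with z hz
      exact (hlo_le z (le_of_lt hz)).symm
    · rw [h]
      rw [continuousAt_iff_continuous_left'_right']
      constructor
      · exact ContinuousWithinAt.congr (f := fun _ => P.2) continuousWithinAt_const
          (fun z hz => hlo_le z (le_of_lt hz)) (hlo_le _ le_rfl)
      -- As `ξ` decreases to `x`, the parameter `s ξ` tends to `-∞`, so the curve tends to `P` and
      -- joins the horizontal ray.
      · change Tendsto lo (𝓝[>] x) (𝓝 (lo x))
        rw [hlo_le x le_rfl]
        have h1 : Tendsto s (𝓝[>] x) atBot := by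
          refine tendsto_neg_atTop_atBot.comp (hgtop.comp (tendsto_inv_nhdsGT_zero.comp
            (tendsto_nhdsWithin_iff.2 ⟨?_, ?_⟩)))
          · have : Tendsto (fun z => z - x) (𝓝 x) (𝓝 (x - x)) := by
              exact (continuous_id.sub continuous_const).tendsto x
            rw [sub_self] at this
            exact this.mono_left nhdsWithin_le_nhds
          · filter_upwards [self_mem_nhdsWithin] with z hz
            exact mem_Ioi.2 (sub_pos.2 (mem_Ioi.1 hz))
        have h2 := (continuous_snd.tendsto P).comp (hP.1.comp h1)
        refine h2.congr' ?_
        filter_upwards [Ioo_mem_nhdsGT hxy] with z hz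
        simp only [hlo_gt z hz.1, hk, min_eq_left hz.2.le, Function.comp]
    · have h1 : ContinuousAt k ξ := continuous_snd.continuousAt.comp
        (hkc.continuousAt (Ioi_mem_nhds h))
      refine h1.congr ?_
      filter_upwards [Ioi_mem_nhds h] with z hz
      exact (hlo_gt z hz).symm
  have himg : χ '' Iic 0 = Ioc x y := by
    ext ξ
    constructor
    · rintro ⟨σ, hσ, rfl⟩
      exact ⟨hgt σ hσ, hχle σ hσ⟩
    · rintro ⟨h1, h2⟩
      exact ⟨s ξ, hs0 ξ h1 h2, hχs ξ h1 h2⟩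
  have hder : ∀ σ < 0, HasDerivAt lo ((δ.Ξ σ - δ.U σ).2 / slant μ (δ.Ξ σ - δ.U σ)) (χ σ) := by
    intro σ hσ
    have h1 := hgt σ hσ.le
    have h2 : χ σ < y := hmono (mem_Iic.2 hσ.le) (mem_Iic.2 le_rfl) hσ
    have h3 := hsχ σ hσ.le
    have h4 : g (χ σ - x)⁻¹ = -σ := by simp only [hs] at h3; linarith
    have hne := (sub_pos.2 h1).ne'
    have hsd : HasDerivAt s (slant μ (δ.Ξ σ - δ.U σ))⁻¹ (χ σ) := by
      have h5 := hgd (χ σ - x)⁻¹ (hinv _ h1 h2.le)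
      have h6 := ((hasDerivAt_id (χ σ)).sub_const x).fun_inv hne
      refine ((h5.comp (χ σ) h6).neg).congr_deriv ?_
      rw [h4, neg_neg]
      have := (hχpos σ hσ.le).ne'
      simp only [id]
      field_simp
    have h7 : HasDerivAt δ.Ξ (δ.Ξ σ - δ.U σ) (s (χ σ)) := by
      rw [h3]
      exact (hΞd σ hσ.le).hasDerivAt (Iic_mem_nhds hσ)
    have h8 := h7.scomp (χ σ) hsd
    have h9 := (hasFDerivAt_snd (𝕜 := ℝ) (p := δ.Ξ (s (χ σ)))).comp_hasDerivAt (χ σ) h8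
    refine (h9.congr_deriv ?_).congr_of_eventuallyEq ?_
    · simp [div_eq_inv_mul]
    · filter_upwards [Ioo_mem_nhds h1 h2] with z hz
      simp only [hlo_gt z hz.1, hk, min_eq_left hz.2.le, Function.comp]
  refine ⟨⟨μ, δ.Ξ 0, lo, hμ0, hcont, ?_, hlo_ge⟩, rfl, rfl, hxy, hlo_le, hlo_χ, hder, hχpos, himg,
    hmono.injOn⟩
  obtain ⟨B, hB⟩ := isCompact_Icc.exists_bound_of_continuousOn (s := Icc x y) hcont.continuousOn
  refine ⟨B, fun ξ => ?_⟩
  have : lo ξ = lo (max x (min ξ y)) := by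
    rcases le_or_gt ξ x with h | h
    · rw [hlo_le ξ h, max_eq_left ((min_le_left _ _).trans h), hlo_le x le_rfl]
    · rw [max_eq_right (hmin ξ h).le]
      rcases le_total ξ y with h' | h'
      · rw [min_eq_left h']
      · rw [min_eq_right h', hlo_ge ξ h', hlo_ge y le_rfl]
  rw [this]
  exact hB _ ⟨le_max_left _ _, max_le hxy.le (min_le_right _ _)⟩

namespace Profile

variable (p : Profile)

/-- The slanted coordinate of the interaction point. -/
noncomputable def a : ℝ := slant p.μ p.A

/-- The upper boundary of the right region. -/
noncomputable def hi (ξ : ℝ) : ℝ := p.lo ξ + max (ξ - p.a) 0 / p.μ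

/-- The three regions. -/
def region : Fin 3 → Set (ℝ × ℝ) :=
  ![{P | p.lo (slant p.μ P) < P.2 ∧ P.2 < p.hi (slant p.μ P)},
    {P | p.hi (slant p.μ P) < P.2}, {P | P.2 < p.lo (slant p.μ P)}]

theorem mem_region_one {P : ℝ × ℝ} :
    P ∈ p.region i₁ ↔ p.lo (slant p.μ P) < P.2 ∧ P.2 < p.hi (slant p.μ P) := Iff.rfl

theorem mem_region_two {P : ℝ × ℝ} : P ∈ p.region i₂ ↔ p.hi (slant p.μ P) < P.2 := Iff.rfl

theorem mem_region_three {P : ℝ × ℝ} : P ∈ p.region i₃ ↔ P.2 < p.lo (slant p.μ P) := Iff.rfl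

theorem continuous_hi : Continuous p.hi :=
  p.continuous_lo.add (((continuous_id.sub continuous_const).max continuous_const).div_const _)

theorem hi_of_le {ξ : ℝ} (h : ξ ≤ p.a) : p.hi ξ = p.lo ξ := by
  simp [hi, max_eq_right (sub_nonpos.2 h)]

/-- Over the slanted coordinate a vertical line is a graph of slope `1/μ`. Beyond `a` the graph of
`hi` is thus the vertical ray upwards from `A`; before `a` the two graphs coincide and the right
region is empty. -/
theorem hi_of_ge {ξ : ℝ} (h : p.a ≤ ξ) : p.hi ξ = p.A.2 + (ξ - p.a) / p.μ := by
  rw [hi, max_eq_left (sub_nonneg.2 h), p.lo_of_ge ξ h]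

theorem lo_le_hi (ξ : ℝ) : p.lo ξ ≤ p.hi ξ :=
  le_add_of_nonneg_right (div_nonneg (le_max_right _ _) p.μ_pos.le)

theorem lo_lt_hi {ξ : ℝ} (h : p.a < ξ) : p.lo ξ < p.hi ξ :=
  lt_add_of_pos_right _ (div_pos (lt_max_of_lt_left (sub_pos.2 h)) p.μ_pos)

theorem isOpen_region (i : Fin 3) : IsOpen (p.region i) := by
  have h1 := p.continuous_lo.comp (continuous_slant p.μ)
  have h2 := p.continuous_hi.comp (continuous_slant p.μ)
  fin_cases i
  · exact (isOpen_lt h1 continuous_snd).inter (isOpen_lt continuous_snd h2)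
  · exact isOpen_lt h2 continuous_snd
  · exact isOpen_lt continuous_snd h1

theorem pairwise_disjoint_region : Pairwise fun i j => Disjoint (p.region i) (p.region j) := by
  have h01 : Disjoint (p.region i₁) (p.region i₂) :=
    disjoint_left.2 fun P h h' => lt_asymm h.2 h'
  have h02 : Disjoint (p.region i₁) (p.region i₃) :=
    disjoint_left.2 fun P h h' => lt_asymm h.1 h'
  have h12 : Disjoint (p.region i₂) (p.region i₃) :=
    disjoint_left.2 fun P h h' => by
      have := p.lo_le_hi (slant p.μ P)
      exact absurd (lt_trans h h') (not_lt.2 this)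
  intro i j hij
  fin_cases i <;> fin_cases j
  · exact absurd rfl hij
  · exact h01
  · exact h02
  · exact h01.symm
  · exact absurd rfl hij
  · exact h12
  · exact h02.symm
  · exact h12.symm
  · exact absurd rfl hij

/-- The arc of the graph of a function of the slanted coordinate over a given set. -/
def arc (q : ℝ → ℝ) (T : Set ℝ) : Set (ℝ × ℝ) := {P | slant p.μ P ∈ T ∧ P.2 = q (slant p.μ P)}

theorem compl_iUnion_region :
    (⋃ i, p.region i)ᶜ = p.arc p.lo univ ∪ p.arc p.hi (Ici p.a) := by
  ext P
  simp only [mem_compl_iff, mem_iUnion, not_exists]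
  constructor
  · intro h
    have h1 := h i₁
    have h2 := h i₂
    have h3 := h i₃
    rw [mem_region_one] at h1
    rw [mem_region_two, not_lt] at h2
    rw [mem_region_three, not_lt] at h3
    rcases h3.eq_or_lt with h4 | h4
    · exact Or.inl ⟨mem_univ _, h4.symm⟩
    · have h5 : p.hi (slant p.μ P) ≤ P.2 := not_lt.1 fun h6 => h1 ⟨h4, h6⟩
      refine Or.inr ⟨?_, le_antisymm h2 h5⟩
      by_contra h6
      rw [p.hi_of_le (not_le.1 h6).le] at h2
      exact absurd h4 (not_lt.2 h2)
  · have hle := p.lo_le_hi (slant p.μ P)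
    have key : P.2 = p.lo (slant p.μ P) ∨ P.2 = p.hi (slant p.μ P) → ∀ i, P ∉ p.region i := by
      intro h i
      fin_cases i
      · rintro ⟨h1, h2⟩
        rcases h with h | h
        · exact absurd h1 (not_lt.2 h.le)
        · exact absurd h2 (not_lt.2 h.ge)
      · intro h1
        have h2 : p.hi (slant p.μ P) < P.2 := h1
        rcases h with h | h <;> linarith
      · intro h1
        have h2 : P.2 < p.lo (slant p.μ P) := h1
        rcases h with h | h <;> linarith
    rintro (⟨-, h⟩ | ⟨-, h⟩)
    · exact key (Or.inl h)
    · exact key (Or.inr h)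

theorem arc_union (q : ℝ → ℝ) (T T' : Set ℝ) : p.arc q (T ∪ T') = p.arc q T ∪ p.arc q T' := by
  ext P
  simp only [arc, mem_union, mem_ofPred_eq]
  tauto

theorem arc_inter (q : ℝ → ℝ) (T T' : Set ℝ) : p.arc q T ∩ p.arc q T' = p.arc q (T ∩ T') := by
  ext P
  simp only [arc, mem_inter_iff, mem_ofPred_eq]
  tauto

theorem arc_mono (q : ℝ → ℝ) {T T' : Set ℝ} (h : T ⊆ T') : p.arc q T ⊆ p.arc q T' :=
  fun _ hP => ⟨h hP.1, hP.2⟩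

theorem slant_injective {μ : ℝ} {P Q : ℝ × ℝ} (h : slant μ P = slant μ Q) (h' : P.2 = Q.2) :
    P = Q := by
  refine Prod.ext ?_ h'
  simp only [slant, h'] at h
  linarith

theorem arc_singleton {q : ℝ → ℝ} {P : ℝ × ℝ} (h : q (slant p.μ P) = P.2) :
    p.arc q {slant p.μ P} = {P} := by
  ext Q
  constructor
  · rintro ⟨h1, h2⟩
    rw [mem_singleton_iff] at h1
    exact slant_injective h1 (by rw [h2, h1, h])
  · rintro rfl
    exact ⟨rfl, h.symm⟩

theorem arc_lo_inter_arc_hi {T T' : Set ℝ} (h : T' ⊆ Ici p.a) :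
    p.arc p.lo T ∩ p.arc p.hi T' ⊆ {p.A} := by
  rintro P ⟨⟨-, h1⟩, h2, h3⟩
  have h4 : slant p.μ P = p.a := by
    refine le_antisymm (not_lt.1 fun h5 => ?_) (h h2)
    exact (p.lo_lt_hi h5).ne (h1.symm.trans h3)
  exact slant_injective h4 (by rw [h1, h4]; exact p.lo_of_ge _ le_rfl)

theorem image_eq_arc {ι : Type*} {f : ι → ℝ × ℝ} {I : Set ι} {q : ℝ → ℝ}
    (h : ∀ i ∈ I, q (slant p.μ (f i)) = (f i).2) :
    f '' I = p.arc q ((fun i => slant p.μ (f i)) '' I) := by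
  ext P
  constructor
  · rintro ⟨i, hi, rfl⟩
    exact ⟨⟨i, hi, rfl⟩, (h i hi).symm⟩
  · rintro ⟨⟨i, hi, h1⟩, h2⟩
    exact ⟨i, hi, slant_injective h1 (by rw [h2, ← h i hi, ← h1])⟩

/-- Far out the bounded function `lo` is negligible. The inequality `η < lo + (ξ + μ η - a)/μ` then
reduces to the sign of `ξ`, and the comparison of `η` with `lo` to the sign of `η`. -/
theorem eventually_mem_region (i : Fin 3) {d : ℝ × ℝ} (hd : d ∈ sector i) :
    ∀ᶠ r : ℝ in atTop, r • d ∈ p.region i := by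
  obtain ⟨B, hB⟩ := p.bounded_lo
  have hμ := p.μ_pos
  have hlin : ∀ {c : ℝ}, 0 < c → ∀ K : ℝ, ∀ᶠ r : ℝ in atTop, K < r * c := fun hc K =>
    (tendsto_id.atTop_mul_const hc).eventually_gt_atTop K
  have hs : ∀ r : ℝ, slant p.μ (r • d) = r * d.1 + p.μ * (r * d.2) := fun r => by
    simp [slant]
  fin_cases i
  · obtain ⟨h1, h2⟩ : 0 < d.1 ∧ 0 < d.2 := hd
    filter_upwards [hlin h1 (p.a + p.μ * B), hlin h2 B] with r hr1 hr2
    change p.lo (slant p.μ (r • d)) < r * d.2 ∧ r * d.2 < p.hi (slant p.μ (r • d))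
    have h3 := abs_le.1 (hB (slant p.μ (r • d)))
    refine ⟨by linarith, ?_⟩
    have h4 : (slant p.μ (r • d) - p.a) / p.μ ≤ max (slant p.μ (r • d) - p.a) 0 / p.μ :=
      div_le_div_of_nonneg_right (le_max_left _ _) hμ.le
    have h5 : (slant p.μ (r • d) - p.a) / p.μ = r * d.2 + (r * d.1 - p.a) / p.μ := by
      rw [hs]
      field_simp
      ring
    have h6 : B < (r * d.1 - p.a) / p.μ := by
      rw [lt_div_iff₀ hμ]
      linarith
    rw [hi]
    linarith
  · obtain ⟨h1, h2⟩ : d.1 < 0 ∧ 0 < d.2 := hd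
    filter_upwards [hlin (neg_pos.2 h1) (p.μ * B - p.a), hlin h2 B] with r hr1 hr2
    change p.hi (slant p.μ (r • d)) < r * d.2
    have h3 := abs_le.1 (hB (slant p.μ (r • d)))
    have h5 : (slant p.μ (r • d) - p.a) / p.μ = r * d.2 + (r * d.1 - p.a) / p.μ := by
      rw [hs]
      field_simp
      ring
    have h6 : (r * d.1 - p.a) / p.μ < -B := by
      rw [div_lt_iff₀ hμ]
      linarith
    rw [hi]
    rcases le_total (slant p.μ (r • d) - p.a) 0 with h | h
    · rw [max_eq_right h]
      simp only [zero_div, add_zero]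
      linarith
    · rw [max_eq_left h]
      linarith
  · have h2 : d.2 < 0 := hd
    filter_upwards [hlin (neg_pos.2 h2) B] with r hr
    change r * d.2 < p.lo (slant p.μ (r • d))
    have h3 := abs_le.1 (hB (slant p.μ (r • d)))
    linarith

/-- A vector at a point of a graph points below the graph if its slope is smaller, and its
opposite points above the graph. -/
theorem eventually_sides_graph {μ q' : ℝ} {q : ℝ → ℝ} {P W : ℝ × ℝ}
    (hq : HasDerivAt q q' (slant μ P)) (hP : P.2 = q (slant μ P)) (hW : W.2 < q' * slant μ W) :
    ∀ᶠ ε : ℝ in 𝓝[>] 0, (P + ε • W).2 < q (slant μ (P + ε • W)) ∧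
      q (slant μ (P - ε • W)) < (P - ε • W).2 := by
  have h1 : HasDerivAt (fun ε : ℝ => slant μ (P + ε • W)) (slant μ W) 0 := by
    have := ((hasDerivAt_id (0 : ℝ)).smul_const W).const_add P
    rw [one_smul] at this
    exact hasDerivAt_slant this
  have h2 : HasDerivAt (fun ε : ℝ => q (slant μ (P + ε • W)) - (P.2 + ε * W.2))
      (q' * slant μ W - W.2) 0 := by
    have h3 := ((hasDerivAt_id (0 : ℝ)).mul_const W.2).const_add P.2
    rw [one_mul] at h3
    refine HasDerivAt.sub (HasDerivAt.comp (0 : ℝ) (h₂ := q) ?_ h1) h3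
    simpa using hq
  have h4 := (hasDerivAt_iff_tendsto_slope_zero.1 h2).eventually_const_lt (sub_pos.2 hW)
  have h5 : Tendsto (fun ε : ℝ => ε) (𝓝[>] 0) (𝓝[≠] 0) :=
    nhdsWithin_mono 0 fun x (hx : x ∈ Ioi (0 : ℝ)) => ne_of_gt hx
  have h6 : Tendsto (fun ε : ℝ => -ε) (𝓝[>] 0) (𝓝[≠] 0) := by
    refine tendsto_nhdsWithin_iff.2 ⟨?_, ?_⟩
    · have := (continuous_neg (G := ℝ)).tendsto 0
      rw [neg_zero] at this
      exact this.mono_left nhdsWithin_le_nhds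
    · filter_upwards [self_mem_nhdsWithin] with ε hε
      exact neg_ne_zero.2 (ne_of_gt hε)
  filter_upwards [h5.eventually h4, h6.eventually h4, self_mem_nhdsWithin] with ε h7 h8 h9
  have h9' : 0 < ε := h9
  simp only [zero_add, zero_smul, add_zero, zero_mul, ← hP, sub_self, sub_zero, smul_eq_mul]
    at h7 h8
  constructor
  · have := pos_of_mul_pos_right h7 (inv_nonneg.2 h9'.le)
    simpa using sub_pos.1 this
  · have h10 : q (slant μ (P + -ε • W)) - (P.2 + -ε * W.2) < 0 := by
      refine neg_of_mul_pos_right h8 ?_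
      exact (inv_lt_zero.2 (neg_neg_of_pos h9')).le
    rw [sub_eq_add_neg, ← neg_smul]
    simpa using sub_neg.1 h10

theorem tendsto_slant_line (μ : ℝ) (P W : ℝ × ℝ) :
    Tendsto (fun ε : ℝ => slant μ (P + ε • W)) (𝓝[>] 0) (𝓝 (slant μ P)) := by
  have h : Continuous fun ε : ℝ => slant μ (P + ε • W) :=
    (continuous_slant μ).comp (continuous_const.add (continuous_id.smul continuous_const))
  have := h.tendsto 0
  simp only [zero_smul, add_zero] at this
  exact this.mono_left nhdsWithin_le_nhds

theorem sides_lo_left {l : ℝ} {P W : ℝ × ℝ} (hP : P ∈ p.arc p.lo (Iio p.a))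
    (hl : HasDerivAt p.lo l (slant p.μ P)) (hW : W.2 < l * slant p.μ W) :
    ∀ᶠ ε : ℝ in 𝓝[>] 0, P + ε • W ∈ p.region i₃ ∧ P - ε • W ∈ p.region i₂ := by
  have h1 := (tendsto_slant_line p.μ P (-W)).eventually_lt_const (mem_Iio.1 hP.1)
  filter_upwards [eventually_sides_graph hl hP.2 hW, h1] with ε h2 h3
  rw [smul_neg, ← sub_eq_add_neg] at h3
  exact ⟨h2.1, by rw [mem_region_two, p.hi_of_le h3.le]; exact h2.2⟩

theorem hasDerivAt_lo_right {ξ : ℝ} (h : p.a < ξ) : HasDerivAt p.lo 0 ξ := by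
  refine (hasDerivAt_const ξ p.A.2).congr_of_eventuallyEq ?_
  filter_upwards [Ioi_mem_nhds h] with z hz
  exact p.lo_of_ge z (le_of_lt hz)

theorem hasDerivAt_hi_right {ξ : ℝ} (h : p.a < ξ) : HasDerivAt p.hi p.μ⁻¹ ξ := by
  have h1 := (((hasDerivAt_id ξ).sub_const p.a).div_const p.μ).const_add p.A.2
  rw [one_div] at h1
  refine h1.congr_of_eventuallyEq ?_
  filter_upwards [Ioi_mem_nhds h] with z hz
  exact p.hi_of_ge (le_of_lt hz)

theorem sides_lo_right {P W : ℝ × ℝ} (hP : P ∈ p.arc p.lo (Ioi p.a)) (hW : W.2 < 0) :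
    ∀ᶠ ε : ℝ in 𝓝[>] 0, P + ε • W ∈ p.region i₃ ∧ P - ε • W ∈ p.region i₁ := by
  have h1 : Tendsto (fun ε : ℝ => (P + ε • -W).2 - p.hi (slant p.μ (P + ε • -W))) (𝓝[>] 0)
      (𝓝 (P.2 - p.hi (slant p.μ P))) := by
    refine Tendsto.sub ?_ ((p.continuous_hi.tendsto _).comp (tendsto_slant_line p.μ P (-W)))
    have h : Continuous fun ε : ℝ => (P + ε • -W).2 := by fun_prop
    have := h.tendsto 0
    simp only [zero_smul, add_zero] at this
    exact this.mono_left nhdsWithin_le_nhds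
  have h2 : P.2 - p.hi (slant p.μ P) < 0 := by
    rw [hP.2]
    exact sub_neg.2 (p.lo_lt_hi hP.1)
  filter_upwards [eventually_sides_graph (p.hasDerivAt_lo_right hP.1) hP.2 (by rwa [zero_mul]),
    h1.eventually_lt_const h2] with ε h3 h4
  rw [smul_neg, ← sub_eq_add_neg] at h4
  exact ⟨h3.1, h3.2, sub_neg.1 h4⟩

theorem sides_hi {P W : ℝ × ℝ} (hP : P ∈ p.arc p.hi (Ioi p.a)) (hW : 0 < W.1) :
    ∀ᶠ ε : ℝ in 𝓝[>] 0, P + ε • W ∈ p.region i₁ ∧ P - ε • W ∈ p.region i₂ := by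
  have h1 : Tendsto (fun ε : ℝ => (P + ε • W).2 - p.lo (slant p.μ (P + ε • W))) (𝓝[>] 0)
      (𝓝 (P.2 - p.lo (slant p.μ P))) := by
    refine Tendsto.sub ?_ ((p.continuous_lo.tendsto _).comp (tendsto_slant_line p.μ P W))
    have h : Continuous fun ε : ℝ => (P + ε • W).2 := by fun_prop
    have := h.tendsto 0
    simp only [zero_smul, add_zero] at this
    exact this.mono_left nhdsWithin_le_nhds
  have h2 : 0 < P.2 - p.lo (slant p.μ P) := by
    rw [hP.2]
    exact sub_pos.2 (p.lo_lt_hi hP.1)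
  have h5 : W.2 < p.μ⁻¹ * slant p.μ W := by
    have := mul_pos (inv_pos.2 p.μ_pos) hW
    rw [slant, mul_add, inv_mul_cancel_left₀ p.μ_pos.ne']
    linarith
  filter_upwards [eventually_sides_graph (p.hasDerivAt_hi_right hP.1) hP.2 h5,
    h1.eventually_const_lt h2] with ε h3 h4
  exact ⟨⟨sub_pos.1 h4, h3.1⟩, h3.2⟩

/-- The normal to a curve that carries a graph. -/
theorem rot_below {μ l : ℝ} {V : ℝ × ℝ} (hV : 0 < slant μ V) (hl : l = V.2 / slant μ V) :
    (rot (-V)).2 < l * slant μ (rot (-V)) := by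
  have h1 : V.1 ^ 2 + V.2 ^ 2 > 0 := by
    by_contra h
    have h2 := sq_nonneg V.1
    have h3 := sq_nonneg V.2
    have h4 : V.1 = 0 := pow_eq_zero_iff two_ne_zero |>.1 (by linarith)
    have h5 : V.2 = 0 := pow_eq_zero_iff two_ne_zero |>.1 (by linarith)
    simp [slant, h4, h5] at hV
  rw [hl, div_mul_eq_mul_div, lt_div_iff₀ hV]
  simp only [slant, rot, Prod.fst_neg, Prod.snd_neg] at hV ⊢
  nlinarith

theorem volume_arc {q : ℝ → ℝ} (hq : Continuous q) (T : Set ℝ) : volume (p.arc q T) = 0 := by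
  refine measure_mono_null (p.arc_mono q (subset_univ T)) ?_
  have h1 := measurePreserving_shear p.μ hq.measurable
  have hm : MeasurableSet (p.arc q univ) := by
    have : p.arc q univ = {P : ℝ × ℝ | P.2 = q (slant p.μ P)} := by
      ext P
      exact ⟨fun h => h.2, fun h => ⟨mem_univ _, h⟩⟩
    rw [this]
    exact measurableSet_eq_fun measurable_snd (hq.comp (continuous_slant p.μ)).measurable
  rw [← h1.measure_preimage hm.nullMeasurableSet]
  refine measure_mono_null (t := univ ×ˢ {0}) ?_ (by simp [Measure.volume_eq_prod])
  rintro ⟨x, c⟩ ⟨-, h⟩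
  simp only [slant, sub_add_cancel] at h
  exact ⟨mem_univ _, by simpa using h⟩

theorem ae_mem_region : ∀ᵐ P : ℝ × ℝ, ∃ i, P ∈ p.region i := by
  have h : volume (⋃ i, p.region i)ᶜ = 0 := by
    rw [p.compl_iUnion_region]
    exact measure_union_null (p.volume_arc p.continuous_lo _) (p.volume_arc p.continuous_hi _)
  filter_upwards [compl_mem_ae_iff.2 h] with P hP
  rw [compl_compl] at hP
  exact mem_iUnion.1 hP

end Profile

/-! ### Boundary integrals over graphs and the weak form over the three regions. -/

/-- The integral over the cone over a part of a graph of a self-similar function times the test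
function. -/
noncomputable def graphIntegral (μ : ℝ) (q : ℝ → ℝ) (T : Set ℝ) (w : ℝ → ℝ)
    (φ : ℝ × ℝ × ℝ → ℝ) : ℝ :=
  ∫ p in {p : ℝ × ℝ | 0 < p.1 ∧ p.2 / p.1 ∈ T}, w (p.2 / p.1) * onGraph μ q φ p

theorem measurableSet_ratio {T : Set ℝ} (hT : MeasurableSet T) :
    MeasurableSet {p : ℝ × ℝ | 0 < p.1 ∧ p.2 / p.1 ∈ T} :=
  (measurableSet_lt measurable_const measurable_fst).inter
    ((measurable_snd.div measurable_fst) hT)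

theorem graphIntegral_congr {μ : ℝ} {q q' w w' : ℝ → ℝ} {T : Set ℝ} (hT : MeasurableSet T)
    (hq : EqOn q q' T) (hw : EqOn w w' T) (φ : ℝ × ℝ × ℝ → ℝ) :
    graphIntegral μ q T w φ = graphIntegral μ q' T w' φ := by
  refine setIntegral_congr_fun (measurableSet_ratio hT) fun p hp => ?_
  simp only [onGraph, hq hp.2, hw hp.2]

theorem graphIntegral_eq_zero {μ : ℝ} {q w : ℝ → ℝ} {T : Set ℝ}
    (hw : ∀ ξ ∈ T, w ξ = 0) (φ : ℝ × ℝ × ℝ → ℝ) : graphIntegral μ q T w φ = 0 := by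
  refine setIntegral_eq_zero_of_forall_eq_zero fun p hp => ?_
  rw [hw _ hp.2, zero_mul]

/-- A ray is a null set. -/
theorem graphIntegral_union_singleton (μ : ℝ) (q : ℝ → ℝ) (T : Set ℝ) (x : ℝ) (w : ℝ → ℝ)
    (φ : ℝ × ℝ × ℝ → ℝ) : graphIntegral μ q (insert x T) w φ = graphIntegral μ q T w φ := by
  refine setIntegral_congr_set ?_
  have hnull : volume {p : ℝ × ℝ | p.2 = x * p.1} = 0 := by
    rw [Measure.volume_eq_prod, Measure.measure_prod_null
      (measurableSet_eq_fun measurable_snd (measurable_fst.const_mul x))]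
    refine ae_of_all _ fun t => ?_
    have : Prod.mk t ⁻¹' {p : ℝ × ℝ | p.2 = x * p.1} = {x * t} := by
      ext y
      simp
    simp [this]
  have hae : ∀ᵐ p : ℝ × ℝ, p.2 ≠ x * p.1 := by
    rw [ae_iff]
    simpa using hnull
  filter_upwards [hae] with p hp
  refine propext ⟨fun h => ⟨h.1, h.2.resolve_left fun h1 => hp ?_⟩, fun h => ⟨h.1, Or.inr h.2⟩⟩
  rw [← h1, div_mul_cancel₀ _ h.1.ne']

theorem graphIntegral_union {μ : ℝ} {q w : ℝ → ℝ} {K : ℝ} (hq : Continuous q) (hw : Measurable w)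
    (hK : ∀ ξ, |w ξ| ≤ K) {φ : ℝ × ℝ × ℝ → ℝ} (hφ : Continuous φ) (hφc : HasCompactSupport φ)
    {T T' : Set ℝ} (hT' : MeasurableSet T') (h : Disjoint T T') :
    graphIntegral μ q (T ∪ T') w φ = graphIntegral μ q T w φ + graphIntegral μ q T' w φ := by
  have hi := integrable_onGraph (μ := μ) hq hw hK hφ hφc
  rw [graphIntegral, graphIntegral, graphIntegral,
    ← setIntegral_union ?_ (measurableSet_ratio hT') hi.integrableOn hi.integrableOn]
  · congr 2
    ext p
    simp only [mem_ofPred_eq, mem_union]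
    tauto
  · exact disjoint_left.2 fun p h1 h2 => disjoint_left.1 h h1.2 h2.2

theorem graphIntegral_univ {μ : ℝ} {q w : ℝ → ℝ} {K : ℝ} (hq : Continuous q) (hw : Measurable w)
    (hK : ∀ ξ, |w ξ| ≤ K) {φ : ℝ × ℝ × ℝ → ℝ} (hφ : Continuous φ) (hφc : HasCompactSupport φ)
    (x : ℝ) :
    graphIntegral μ q univ w φ = graphIntegral μ q (Iio x) w φ + graphIntegral μ q (Ioi x) w φ := by
  rw [← graphIntegral_union hq hw hK hφ hφc measurableSet_Ioi
    (disjoint_left.2 fun y h1 h2 => lt_asymm (mem_Iio.1 h1) h2),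
    ← graphIntegral_union_singleton μ q (_ ∪ _) x]
  rw [Iio_union_Ioi, insert_eq, union_compl_self]

theorem graphIntegral_sub {μ : ℝ} {q w w' : ℝ → ℝ} {K K' : ℝ} (hq : Continuous q)
    (hw : Measurable w)
    (hK : ∀ ξ, |w ξ| ≤ K) (hw' : Measurable w') (hK' : ∀ ξ, |w' ξ| ≤ K') {φ : ℝ × ℝ × ℝ → ℝ}
    (hφ : Continuous φ) (hφc : HasCompactSupport φ) (T : Set ℝ) (c c' : ℝ) :
    graphIntegral μ q T (fun ξ => c * w ξ - c' * w' ξ) φ =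
      c * graphIntegral μ q T w φ - c' * graphIntegral μ q T w' φ := by
  have hi := (integrable_onGraph (μ := μ) hq hw hK hφ hφc).integrableOn
    (s := {p : ℝ × ℝ | 0 < p.1 ∧ p.2 / p.1 ∈ T})
  have hi' := (integrable_onGraph (μ := μ) hq hw' hK' hφ hφc).integrableOn
    (s := {p : ℝ × ℝ | 0 < p.1 ∧ p.2 / p.1 ∈ T})
  simp only [graphIntegral]
  rw [← integral_const_mul, ← integral_const_mul, ← integral_sub (hi.const_mul c)
    (hi'.const_mul c')]
  congr 1 with p
  ring

theorem integral_Iio_deriv {ψ : ℝ → ℝ} (hψ : ContDiff ℝ 1 ψ) (hψc : HasCompactSupport ψ) :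
    ∫ c in Iio 0, deriv ψ c = 1 * ψ 0 := by
  have hd := hψ.differentiable (by simp)
  have hi : Integrable (deriv ψ) :=
    (hψ.continuous_deriv (by simp)).integrable_of_hasCompactSupport hψc.deriv
  have hlim : Tendsto ψ atBot (𝓝 0) := hψc.is_zero_at_infty.mono_left atBot_le_cocompact
  rw [← integral_Iic_eq_integral_Iio, integral_Iic_of_hasDerivAt_of_tendsto
    hd.continuous.continuousWithinAt (fun x _ => (hd x).hasDerivAt) hi.integrableOn hlim]
  ring

theorem integral_Ioi_deriv {ψ : ℝ → ℝ} (hψ : ContDiff ℝ 1 ψ) (hψc : HasCompactSupport ψ) :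
    ∫ c in Ioi 0, deriv ψ c = -1 * ψ 0 := by
  have hd := hψ.differentiable (by simp)
  have hi : Integrable (deriv ψ) :=
    (hψ.continuous_deriv (by simp)).integrable_of_hasCompactSupport hψc.deriv
  have hlim : Tendsto ψ atTop (𝓝 0) := hψc.is_zero_at_infty.mono_left atTop_le_cocompact
  rw [integral_Ioi_of_hasDerivAt_of_tendsto
    hd.continuous.continuousWithinAt (fun x _ => (hd x).hasDerivAt) hi.integrableOn hlim]
  ring

theorem setIntegral_ratio_univ {μ : ℝ} {q w : ℝ → ℝ} {φ : ℝ × ℝ × ℝ → ℝ} :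
    ∫ p in Ioi (0 : ℝ) ×ˢ univ, w (p.2 / p.1) * onGraph μ q φ p = graphIntegral μ q univ w φ := by
  have : (Ioi (0 : ℝ) ×ˢ (univ : Set ℝ)) = {p : ℝ × ℝ | 0 < p.1 ∧ p.2 / p.1 ∈ univ} := by
    ext p
    simp
  rw [this, graphIntegral]

/-- The cone over a graph is a null set. -/
theorem ae_ne_cone_graph (μ : ℝ) {q : ℝ → ℝ} (hq : Continuous q) :
    ∀ᵐ p : ℝ × ℝ × ℝ, p.2.2 ≠ p.1 * q ((p.2.1 + μ * p.2.2) / p.1) := by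
  rw [ae_iff]
  simp only [not_not]
  have hm : MeasurableSet {p : ℝ × ℝ × ℝ | p.2.2 = p.1 * q ((p.2.1 + μ * p.2.2) / p.1)} := by
    have := hq.measurable
    refine measurableSet_eq_fun (by fun_prop) (by fun_prop)
  rw [← (measurePreserving_graphMap μ hq.measurable).measure_preimage hm.nullMeasurableSet]
  refine measure_mono_null (t := univ ×ˢ {0}) ?_ (by simp [Measure.volume_eq_prod])
  rintro ⟨⟨t, x⟩, c⟩ h
  simp only [graphMap, mem_preimage, mem_ofPred_eq, sub_add_cancel] at h
  exact ⟨mem_univ _, by simpa using h⟩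

namespace Profile

variable (p : Profile)

theorem flux_lo_right {U : ℝ × ℝ} {ξ : ℝ} (h : p.a < ξ) : flux p.μ p.lo U ξ = p.A.2 - U.2 := by
  rw [flux, (p.hasDerivAt_lo_right h).deriv, p.lo_of_ge ξ h.le]
  ring

/-- Through the vertical ray the flux depends only on the horizontal velocity relative to the ray.
It vanishes for both states next to a vertical contact discontinuity. -/
theorem flux_hi_right {U : ℝ × ℝ} {ξ : ℝ} (h : p.a < ξ) :
    flux p.μ p.hi U ξ = (U.1 - p.A.1) / p.μ := by
  have := p.μ_pos.ne'
  rw [flux, (p.hasDerivAt_hi_right h).deriv, p.hi_of_ge h.le, a, slant]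
  field_simp
  ring

theorem flux_hi_left {U : ℝ × ℝ} {ξ : ℝ} (h : ξ < p.a) :
    flux p.μ p.hi U ξ = flux p.μ p.lo U ξ := by
  have h1 : p.hi =ᶠ[𝓝 ξ] p.lo := by
    filter_upwards [Iio_mem_nhds h] with z hz
    exact p.hi_of_le (le_of_lt hz)
  rw [flux, flux, h1.deriv_eq, h1.eq_of_nhds]

theorem exists_flux_hi_bound {U : ℝ × ℝ} (h : ∃ K, ∀ ξ, |flux p.μ p.lo U ξ| ≤ K) :
    ∃ K, ∀ ξ, |flux p.μ p.hi U ξ| ≤ K := by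
  obtain ⟨K, hK⟩ := h
  have hK0 : 0 ≤ K := (abs_nonneg _).trans (hK 0)
  have h1 := abs_nonneg ((U.1 - p.A.1) / p.μ)
  have h2 := abs_nonneg (flux p.μ p.hi U p.a)
  refine ⟨K + |(U.1 - p.A.1) / p.μ| + |flux p.μ p.hi U p.a|, fun ξ => ?_⟩
  rcases lt_trichotomy ξ p.a with h | h | h
  · rw [p.flux_hi_left h]
    linarith [hK ξ]
  · rw [h]
    linarith
  · rw [p.flux_hi_right h]
    linarith

theorem countable_insert_differentiableAt_hi {E : Set ℝ} (hE : E.Countable)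
    (hd : ∀ ξ ∉ E, DifferentiableAt ℝ p.lo ξ) :
    (insert p.a E).Countable ∧ ∀ ξ ∉ insert p.a E, DifferentiableAt ℝ p.hi ξ := by
  refine ⟨hE.insert _, fun ξ hξ => ?_⟩
  rw [mem_insert_iff, not_or] at hξ
  rcases lt_or_gt_of_ne hξ.1 with h | h
  · refine (hd ξ hξ.2).congr_of_eventuallyEq ?_
    filter_upwards [Iio_mem_nhds h] with z hz
    exact p.hi_of_le (le_of_lt hz)
  · exact (p.hasDerivAt_hi_right h).differentiableAt

theorem tendsto_lo_scaled (x f : ℝ) :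
    Tendsto (fun t => t * p.lo (x / t + f)) (𝓝[>] 0) (𝓝 0) := by
  obtain ⟨B, hB⟩ := p.bounded_lo
  have h : Tendsto (fun t : ℝ => t) (𝓝[>] 0) (𝓝 0) :=
    tendsto_id.mono_left nhdsWithin_le_nhds
  exact h.zero_mul_isBoundedUnder_le (isBoundedUnder_of ⟨B, fun t => hB _⟩)

/-- As `t → 0` the bounded part `lo` disappears, and the homogeneous part of `hi` gives the boundary
between the first two initial sectors. -/
theorem tendsto_hi_scaled (x f : ℝ) :
    Tendsto (fun t => t * p.hi (x / t + f)) (𝓝[>] 0) (𝓝 (max x 0 / p.μ)) := by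
  have h1 : Tendsto (fun t : ℝ => max (x + t * (f - p.a)) 0 / p.μ) (𝓝[>] 0)
      (𝓝 (max x 0 / p.μ)) := by
    have h : Continuous fun t : ℝ => max (x + t * (f - p.a)) 0 / p.μ :=
      ((continuous_const.add (continuous_id.mul continuous_const)).max
        continuous_const).div_const _
    have := h.tendsto 0
    rw [zero_mul, add_zero] at this
    exact this.mono_left nhdsWithin_le_nhds
  have h2 := (p.tendsto_lo_scaled x f).add h1
  rw [zero_add] at h2
  refine h2.congr' ?_
  filter_upwards [self_mem_nhdsWithin] with t ht
  have ht : 0 < t := ht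
  have h3 : t * max (x / t + f - p.a) 0 = max (x + t * (f - p.a)) 0 := by
    rw [mul_max_of_nonneg _ _ ht.le, mul_zero]
    congr 1
    field_simp
    ring
  rw [hi, mul_add, ← mul_div_assoc, h3]

theorem slant_div (q : ℝ × ℝ × ℝ) :
    slant p.μ (q.2.1 / q.1, q.2.2 / q.1) = (q.2.1 + p.μ * q.2.2) / q.1 := by
  rw [slant]
  ring

theorem cone_region_two : cone (p.region i₂) = {q : ℝ × ℝ × ℝ | 0 < q.1 ∧
    q.2.2 - q.1 * p.hi ((q.2.1 + p.μ * q.2.2) / q.1) ∈ Ioi 0} := by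
  ext q
  refine and_congr_right fun ht => ?_
  rw [mem_region_two, slant_div, lt_div_iff₀ ht, mem_Ioi, sub_pos, mul_comm]

theorem cone_region_three : cone (p.region i₃) = {q : ℝ × ℝ × ℝ | 0 < q.1 ∧
    q.2.2 - q.1 * p.lo ((q.2.1 + p.μ * q.2.2) / q.1) ∈ Iio 0} := by
  ext q
  refine and_congr_right fun ht => ?_
  rw [mem_region_three, slant_div, div_lt_iff₀ ht, mem_Iio, sub_neg, mul_comm]

theorem sector_two : {X : ℝ × ℝ | X.2 - max (X.1 + p.μ * X.2) 0 / p.μ ∈ Ioi 0} = sector i₂ := by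
  ext X
  have hμ := p.μ_pos
  change 0 < X.2 - max (X.1 + p.μ * X.2) 0 / p.μ ↔ X.1 < 0 ∧ 0 < X.2
  rw [sub_pos, div_lt_iff₀ hμ, max_lt_iff]
  constructor
  · rintro ⟨h1, h2⟩
    exact ⟨by linarith, pos_of_mul_pos_left h2 hμ.le⟩
  · rintro ⟨h1, h2⟩
    exact ⟨by linarith, mul_pos h2 hμ⟩

variable {p} {U : ℝ × ℝ} {E : Set ℝ} {φ : ℝ × ℝ × ℝ → ℝ}

theorem integral_region_three (hE : E.Countable) (hd : ∀ ξ ∉ E, DifferentiableAt ℝ p.lo ξ)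
    (hK : ∃ K, ∀ ξ, |flux p.μ p.lo U ξ| ≤ K) (hφ : ContDiff ℝ ∞ φ) (hφc : HasCompactSupport φ) :
    ∫ q in cone (p.region i₃), fderiv ℝ φ q (1, U) =
      -(∫ X in sector i₃, φ (0, X)) - graphIntegral p.μ p.lo univ (flux p.μ p.lo U) φ := by
  obtain ⟨K, hK⟩ := hK
  rw [cone_region_three, integral_cone_graph (q₀ := fun _ => 0) (ε := 1) p.continuous_lo hE hd hK
    measurable_const (fun x _ => p.tendsto_lo_scaled x _) measurableSet_Iio
    (fun ψ h1 h2 => integral_Iio_deriv h1 h2) hφ hφc, setIntegral_ratio_univ, one_mul]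
  simp only [sub_zero]
  rfl

theorem integral_region_two (hE : E.Countable) (hd : ∀ ξ ∉ E, DifferentiableAt ℝ p.lo ξ)
    (hK : ∃ K, ∀ ξ, |flux p.μ p.lo U ξ| ≤ K) (hφ : ContDiff ℝ ∞ φ) (hφc : HasCompactSupport φ) :
    ∫ q in cone (p.region i₂), fderiv ℝ φ q (1, U) =
      -(∫ X in sector i₂, φ (0, X)) + graphIntegral p.μ p.hi univ (flux p.μ p.hi U) φ := by
  obtain ⟨K, hK⟩ := p.exists_flux_hi_bound hK
  obtain ⟨hE', hd'⟩ := p.countable_insert_differentiableAt_hi hE hd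
  rw [cone_region_two, integral_cone_graph (q₀ := fun x => max x 0 / p.μ) (ε := -1)
    p.continuous_hi hE' hd' hK ((measurable_id.max measurable_const).div_const _)
    (fun x _ => p.tendsto_hi_scaled x _) measurableSet_Ioi
    (fun ψ h1 h2 => integral_Ioi_deriv h1 h2) hφ hφc, setIntegral_ratio_univ, sector_two]
  ring

/-- The profile with the same interaction point and a constant lower boundary. -/
def flat (p : Profile) : Profile where
  μ := p.μ
  A := p.A
  lo := fun _ => p.A.2
  μ_pos := p.μ_pos
  continuous_lo := continuous_const
  bounded_lo := ⟨|p.A.2|, fun _ => le_rfl⟩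
  lo_of_ge := fun _ _ => rfl

/-- The first region is empty before `a`, where alone the two profiles may differ. Replacing the
profile by a flat one avoids a bound for the flux of state 1 along the curved part of `lo`; such
bounds are available only for states 2 and 3. -/
theorem region_one_flat : p.region i₁ = p.flat.region i₁ := by
  ext P
  rw [mem_region_one, mem_region_one]
  change _ ↔ p.A.2 < P.2 ∧ P.2 < p.flat.hi (slant p.μ P)
  rcases le_or_gt (slant p.μ P) p.a with h | h
  · have h1 := p.hi_of_le h
    have h2 := p.flat.hi_of_le h
    rw [h1, h2]
    exact ⟨fun h => absurd h.1 (lt_asymm h.2), fun h => absurd h.1 (lt_asymm h.2)⟩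
  · rw [p.hi_of_ge h.le, p.flat.hi_of_ge h.le, p.lo_of_ge _ h.le]
    rfl

theorem eqOn_flat_lo : EqOn p.flat.lo p.lo (Ioi p.a) := fun _ h => (p.lo_of_ge _ (le_of_lt h)).symm

theorem eqOn_flat_hi : EqOn p.flat.hi p.hi (Ioi p.a) := fun _ h => by
  rw [p.hi_of_ge (le_of_lt h), p.flat.hi_of_ge (le_of_lt h)]
  rfl

theorem ae_snd_ne_zero : ∀ᵐ X : ℝ × ℝ, X.2 ≠ 0 := by
  rw [ae_iff]
  refine measure_mono_null (t := univ ×ˢ {0}) ?_ (by simp [Measure.volume_eq_prod])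
  intro X hX
  exact ⟨mem_univ _, by simpa using hX⟩

/-- Up to null sets the cone over the region is the difference of the cones below the flat `hi` and
the flat `lo`. The boundary integrals of the two cancel before `a`, where these graphs coincide. -/
theorem integral_region_one (hφ : ContDiff ℝ ∞ φ) (hφc : HasCompactSupport φ) :
    ∫ q in cone (p.region i₁), fderiv ℝ φ q (1, U) =
      -(∫ X in sector i₁, φ (0, X)) - graphIntegral p.μ p.hi (Ioi p.a) (flux p.μ p.hi U) φ
        + graphIntegral p.μ p.lo (Ioi p.a) (flux p.μ p.lo U) φ := by
  have hflux : ∀ ξ, flux p.μ p.flat.lo U ξ = p.A.2 - U.2 := fun ξ => by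
    have : deriv p.flat.lo ξ = 0 := deriv_const ξ _
    rw [flux, this]
    change p.A.2 - _ - _ = _
    ring
  have hK : ∃ K, ∀ ξ, |flux p.μ p.flat.lo U ξ| ≤ K :=
    ⟨|p.A.2 - U.2|, fun ξ => by rw [hflux ξ]⟩
  obtain ⟨K', hK'⟩ := p.flat.exists_flux_hi_bound hK
  have hμ : p.flat.μ = p.μ := rfl
  have ha : p.flat.a = p.a := rfl
  rw [hμ] at hK'
  have hd : ∀ ξ ∉ (∅ : Set ℝ), DifferentiableAt ℝ p.flat.lo ξ :=
    fun ξ _ => differentiableAt_const _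
  obtain ⟨hE', hd'⟩ := p.flat.countable_insert_differentiableAt_hi countable_empty hd
  obtain ⟨K, hK⟩ := hK
  have hlo := integral_cone_graph (μ := p.μ) (q₀ := fun _ => 0) (ε := 1) p.flat.continuous_lo
    countable_empty hd hK measurable_const (fun x _ => p.flat.tendsto_lo_scaled x _)
    measurableSet_Iio (fun ψ h1 h2 => integral_Iio_deriv h1 h2) hφ hφc
  have hhi := integral_cone_graph (μ := p.μ) (q₀ := fun x => max x 0 / p.μ) (ε := 1)
    p.flat.continuous_hi hE' hd' hK' ((measurable_id.max measurable_const).div_const _)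
    (fun x _ => p.flat.tendsto_hi_scaled x _) measurableSet_Iio
    (fun ψ h1 h2 => integral_Iio_deriv h1 h2) hφ hφc
  rw [setIntegral_ratio_univ, one_mul] at hlo hhi
  set L : Set (ℝ × ℝ × ℝ) := {q | 0 < q.1 ∧
    q.2.2 - q.1 * p.flat.lo ((q.2.1 + p.μ * q.2.2) / q.1) ∈ Iio 0} with hL
  set M : Set (ℝ × ℝ × ℝ) := {q | 0 < q.1 ∧
    q.2.2 - q.1 * p.flat.hi ((q.2.1 + p.μ * q.2.2) / q.1) ∈ Iio 0} with hM
  have hLM : L ⊆ M := by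
    rintro q ⟨ht, h⟩
    refine ⟨ht, mem_Iio.2 ?_⟩
    have := mul_le_mul_of_nonneg_left (p.flat.lo_le_hi ((q.2.1 + p.μ * q.2.2) / q.1)) ht.le
    linarith [mem_Iio.1 h]
  have hLm : MeasurableSet L := by
    have := p.flat.continuous_lo.measurable
    exact (measurableSet_lt measurable_const measurable_fst).inter
      (measurableSet_lt (by fun_prop) measurable_const)
  have hφ' : Continuous (fderiv ℝ φ) := hφ.continuous_fderiv (by simp)
  have hint : Integrable fun q => fderiv ℝ φ q (1, U) :=
    (hφ'.clm_apply continuous_const).integrable_of_hasCompactSupport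
      ((hφc.fderiv (𝕜 := ℝ)).comp_left (g := fun L : ℝ × ℝ × ℝ →L[ℝ] ℝ => L (1, U)) (by simp))
  have hcone : cone (p.region i₁) =ᵐ[volume] (M \ L : Set (ℝ × ℝ × ℝ)) := by
    filter_upwards [ae_ne_cone_graph p.μ p.flat.continuous_lo] with q hq
    refine propext ?_
    rw [region_one_flat]
    change (0 < q.1 ∧ _) ↔ q ∈ M \ L
    rw [mem_region_one, hμ, slant_div]
    constructor
    · rintro ⟨ht, h1, h2⟩
      rw [lt_div_iff₀ ht, mul_comm] at h1
      rw [div_lt_iff₀ ht, mul_comm] at h2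
      exact ⟨⟨ht, mem_Iio.2 (sub_neg.2 h2)⟩, fun h3 => lt_asymm h1 (sub_neg.1 h3.2)⟩
    · rintro ⟨⟨ht, h1⟩, h2⟩
      refine ⟨ht, ?_, ?_⟩
      · rw [lt_div_iff₀ ht, mul_comm]
        refine lt_of_le_of_ne (not_lt.1 fun h3 => h2 ⟨ht, mem_Iio.2 (sub_neg.2 h3)⟩) (Ne.symm hq)
      · rw [div_lt_iff₀ ht, mul_comm]
        exact sub_neg.1 h1
  have hφ0 : Integrable fun X : ℝ × ℝ => φ (0, X) := by
    refine (hφ.continuous.comp (by fun_prop : Continuous fun X : ℝ × ℝ =>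
      ((0, X) : ℝ × ℝ × ℝ))).integrable_of_hasCompactSupport ?_
    refine hφc.comp_isClosedEmbedding ?_
    exact Topology.IsClosedEmbedding.of_continuous_injective_isClosedMap (by fun_prop)
      (fun X Y h => (Prod.mk.inj h).2) (isClosedMap_prodMk_left 0)
  have hsec : (sector i₁ : Set (ℝ × ℝ)) =ᵐ[volume]
      ({X : ℝ × ℝ | X.2 - max (X.1 + p.μ * X.2) 0 / p.μ ∈ Iio 0} \
        {X : ℝ × ℝ | X.2 - 0 ∈ Iio 0} : Set (ℝ × ℝ)) := by
    filter_upwards [ae_snd_ne_zero] with X hX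
    have hμ0 := p.μ_pos
    refine propext ?_
    change (0 < X.1 ∧ 0 < X.2) ↔
      (X.2 - max (X.1 + p.μ * X.2) 0 / p.μ < 0 ∧ ¬ (X.2 - 0 < 0))
    rw [sub_zero, sub_neg, lt_div_iff₀ hμ0, lt_max_iff, not_lt]
    constructor
    · rintro ⟨h1, h2⟩
      exact ⟨Or.inl (by linarith), h2.le⟩
    · rintro ⟨h1, h2⟩
      refine ⟨?_, lt_of_le_of_ne h2 (Ne.symm hX)⟩
      rcases h1 with h1 | h1
      · linarith
      · exact absurd h1 (not_lt.2 (by positivity))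
  have hsm : MeasurableSet {X : ℝ × ℝ | X.2 - 0 ∈ Iio 0} :=
    (measurable_snd.sub_const 0) measurableSet_Iio
  have e1 : graphIntegral p.μ p.flat.hi (Iio p.a) (flux p.μ p.flat.hi U) φ =
      graphIntegral p.μ p.flat.lo (Iio p.a) (flux p.μ p.flat.lo U) φ :=
    graphIntegral_congr measurableSet_Iio (fun ξ h => p.flat.hi_of_le (le_of_lt h))
      (fun ξ h => p.flat.flux_hi_left h) φ
  have e2 : graphIntegral p.μ p.flat.hi (Ioi p.a) (flux p.μ p.flat.hi U) φ =
      graphIntegral p.μ p.hi (Ioi p.a) (flux p.μ p.hi U) φ :=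
    graphIntegral_congr measurableSet_Ioi eqOn_flat_hi (fun ξ h => by
      rw [p.flux_hi_right h]
      exact p.flat.flux_hi_right h) φ
  have e3 : graphIntegral p.μ p.flat.lo (Ioi p.a) (flux p.μ p.flat.lo U) φ =
      graphIntegral p.μ p.lo (Ioi p.a) (flux p.μ p.lo U) φ :=
    graphIntegral_congr measurableSet_Ioi eqOn_flat_lo (fun ξ h => by
      rw [p.flux_lo_right h]
      exact p.flat.flux_lo_right h) φ
  rw [setIntegral_congr_set hcone, setIntegral_sdiff hLm hint.integrableOn hLM, hhi, hlo,
    setIntegral_congr_set hsec, setIntegral_sdiff hsm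
    hφ0.integrableOn ?_, graphIntegral_univ p.flat.continuous_hi
      (measurable_flux _ p.flat.continuous_hi.measurable _) hK' hφ.continuous hφc p.a,
    graphIntegral_univ p.flat.continuous_lo
      (measurable_flux _ p.flat.continuous_lo.measurable _) hK hφ.continuous hφc p.a,
    e1, e2, e3]
  · ring
  · intro X hX
    have h1 : X.2 - 0 < 0 := hX
    change X.2 - max (X.1 + p.μ * X.2) 0 / p.μ < 0
    have h2 : 0 ≤ max (X.1 + p.μ * X.2) 0 / p.μ := div_nonneg (le_max_right _ _) p.μ_pos.le
    linarith

/-- The weak form of a conservation law over the three regions. -/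
theorem sum_integral_region (S : Fin 3 → GasState) (hE : E.Countable)
    (hd : ∀ ξ ∉ E, DifferentiableAt ℝ p.lo ξ)
    (hK₂ : ∃ K, ∀ ξ, |flux p.μ p.lo (S i₂).vel ξ| ≤ K)
    (hK₃ : ∃ K, ∀ ξ, |flux p.μ p.lo (S i₃).vel ξ| ≤ K)
    (hφ : ContDiff ℝ ∞ φ) (hφc : HasCompactSupport φ) (k : Fin 4) :
    (∑ i, ∫ q in cone (p.region i), (S i).dens k * fderiv ℝ φ q (1, (S i).vel))
      + (∑ i, ∫ X in sector i, (S i).dens k * φ (0, X)) =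
    (S i₂).dens k * graphIntegral p.μ p.lo (Iio p.a) (flux p.μ p.lo (S i₂).vel) φ
      - (S i₃).dens k * graphIntegral p.μ p.lo (Iio p.a) (flux p.μ p.lo (S i₃).vel) φ
      + (S i₁).dens k * graphIntegral p.μ p.lo (Ioi p.a) (flux p.μ p.lo (S i₁).vel) φ
      - (S i₃).dens k * graphIntegral p.μ p.lo (Ioi p.a) (flux p.μ p.lo (S i₃).vel) φ
      + (S i₂).dens k * graphIntegral p.μ p.hi (Ioi p.a) (flux p.μ p.hi (S i₂).vel) φ
      - (S i₁).dens k * graphIntegral p.μ p.hi (Ioi p.a) (flux p.μ p.hi (S i₁).vel) φ := by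
  obtain ⟨K₂, hK₂'⟩ := p.exists_flux_hi_bound hK₂
  obtain ⟨K₃, hK₃'⟩ := id hK₃
  have e1 : graphIntegral p.μ p.hi (Iio p.a) (flux p.μ p.hi (S i₂).vel) φ =
      graphIntegral p.μ p.lo (Iio p.a) (flux p.μ p.lo (S i₂).vel) φ :=
    graphIntegral_congr measurableSet_Iio (fun ξ h => p.hi_of_le (le_of_lt h))
      (fun ξ h => p.flux_hi_left h) φ
  simp only [integral_const_mul, Fin.sum_univ_three]
  rw [integral_region_one hφ hφc, integral_region_two hE hd hK₂ hφ hφc,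
    integral_region_three hE hd hK₃ hφ hφc, graphIntegral_univ p.continuous_lo
      (measurable_flux _ p.continuous_lo.measurable _) hK₃' hφ.continuous hφc p.a,
    graphIntegral_univ p.continuous_hi
      (measurable_flux _ p.continuous_hi.measurable _) hK₂' hφ.continuous hφc p.a,
    e1]
  ring

end Profile

/-! ### Delta shocks as pieces of the graphs. -/

theorem slant_add_smul (μ : ℝ) (V C : ℝ × ℝ) (a : ℝ) :
    slant μ (V + a • C) = slant μ V + a * slant μ C := by
  simp [slant]
  ring

theorem image_slant_straight_Ioi {μ : ℝ} (V : ℝ × ℝ) {C : ℝ × ℝ} (hC : 0 < slant μ C) :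
    (fun σ => slant μ (V + Real.exp σ • C)) '' Ioi 0 = Ioi (slant μ (V + C)) := by
  have h1 : slant μ (V + C) = slant μ V + slant μ C := by
    simpa using slant_add_smul μ V C 1
  ext x
  simp only [slant_add_smul, h1, mem_image, mem_Ioi]
  constructor
  · rintro ⟨σ, hσ, rfl⟩
    have := mul_lt_mul_of_pos_right (Real.one_lt_exp_iff.2 hσ) hC
    linarith
  · intro hx
    have h2 : 1 < (x - slant μ V) / slant μ C := by
      rw [one_lt_div hC]
      linarith
    refine ⟨Real.log ((x - slant μ V) / slant μ C), Real.log_pos h2, ?_⟩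
    rw [Real.exp_log (by linarith), div_mul_cancel₀ _ hC.ne']
    ring

theorem image_slant_straight_univ {μ : ℝ} (V : ℝ × ℝ) {C : ℝ × ℝ} (hC : 0 < slant μ C) :
    (fun σ => slant μ (V + Real.exp σ • C)) '' univ = Ioi (slant μ V) := by
  ext x
  simp only [slant_add_smul, mem_image, mem_univ, true_and, mem_Ioi]
  constructor
  · rintro ⟨σ, rfl⟩
    have := mul_pos (Real.exp_pos σ) hC
    linarith
  · intro hx
    refine ⟨Real.log ((x - slant μ V) / slant μ C), ?_⟩
    rw [Real.exp_log (div_pos (sub_pos.2 hx) hC), div_mul_cancel₀ _ hC.ne']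
    ring

theorem image_slant_straight_univ_of_neg {μ : ℝ} (V : ℝ × ℝ) {C : ℝ × ℝ} (hC : slant μ C < 0) :
    (fun σ => slant μ (V + Real.exp σ • C)) '' univ = Iio (slant μ V) := by
  ext x
  simp only [slant_add_smul, mem_image, mem_univ, true_and, mem_Iio]
  constructor
  · rintro ⟨σ, rfl⟩
    have := mul_neg_of_pos_of_neg (Real.exp_pos σ) hC
    linarith
  · intro hx
    refine ⟨Real.log ((x - slant μ V) / slant μ C), ?_⟩
    rw [Real.exp_log (div_pos_of_neg_of_neg (sub_neg.2 hx) hC), div_mul_cancel₀ _ hC.ne]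
    ring

theorem flux_congr {μ : ℝ} {q q' : ℝ → ℝ} {R : Set ℝ} (hR : IsOpen R) (h : EqOn q q' R)
    (U : ℝ × ℝ) : EqOn (flux μ q U) (flux μ q' U) R := by
  intro ξ hξ
  rw [flux, flux, (h.eventuallyEq_of_mem (hR.mem_nhds hξ)).deriv_eq, h hξ]

/-- The quantities absorbed by a straight delta shock as integrals over a graph. -/
theorem integral_gain_straight {S : Fin 3 → GasState} {l r : Fin 3} {C : ℝ × ℝ} {I T R : Set ℝ}
    {μ e β : ℝ} {q : ℝ → ℝ} (hT : IsOpen T) (hR : IsOpen R)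
    (he : |slant μ C| = e * slant μ C) (hC : slant μ C ≠ 0)
    (himg : (fun σ => slant μ (avg (S l) (S r) + Real.exp σ • C)) '' T = R)
    (hq : ∀ ξ ∈ R, q ξ = (avg (S l) (S r)).2 + β * (ξ - slant μ (avg (S l) (S r))))
    (hβ : β * slant μ C = C.2) (k : Fin 4) {φ : ℝ × ℝ × ℝ → ℝ} (hφ : Continuous φ)
    (hφc : HasCompactSupport φ) :
    e * ∫ p in paramCone T, gain S (straightDelta S l r C I) k φ p =
      -((S l).dens k * graphIntegral μ q R (flux μ q (S l).vel) φ -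
        (S r).dens k * graphIntegral μ q R (flux μ q (S r).vel) φ) := by
  set V := avg (S l) (S r) with hV
  -- Away from `R` the graph of `q` is arbitrary. The affine function agrees with it on the open set
  -- `R` and has constant flux, so integrability is immediate.
  set q' : ℝ → ℝ := fun ξ => V.2 + β * (ξ - slant μ V) with hq'
  have hqd : ∀ ξ, HasDerivAt q' β ξ := fun ξ => by
    have := (((hasDerivAt_id ξ).sub_const (slant μ V)).const_mul β).const_add V.2
    rwa [mul_one] at this
  have hqc : Continuous q' := by fun_prop
  have hflux : ∀ U ξ, flux μ q' U ξ = V.2 - U.2 + β * (slant μ U - slant μ V) := fun U ξ => by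
    rw [flux, (hqd ξ).deriv, hq', slant, slant]
    ring
  have hK : ∀ U ξ, |flux μ q' U ξ| ≤ |V.2 - U.2 + β * (slant μ U - slant μ V)| := fun U ξ => by
    rw [hflux]
  have hm : ∀ U, Measurable (flux μ q' U) := fun U => measurable_flux _ hqc.measurable _
  have he0 : e ≠ 0 := by
    rintro rfl
    rw [zero_mul, abs_eq_zero] at he
    exact hC he
  have hsub : ∀ σ, (straightDelta S l r C I).Ξ σ - (straightDelta S l r C I).U σ =
      Real.exp σ • C := fun σ => add_sub_cancel_left _ _
  have hs : ∀ σ, slant μ (Real.exp σ • C) = Real.exp σ * slant μ C := fun σ => by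
    have := slant_add_smul μ 0 C (Real.exp σ)
    rwa [zero_add, show slant μ 0 = 0 by simp [slant], zero_add] at this
  have hi := (((integrable_onGraph (μ := μ) hqc (hm (S l).vel) (hK _) hφ hφc).const_mul
    ((S l).dens k)).sub ((integrable_onGraph (μ := μ) hqc (hm (S r).vel) (hK _) hφ hφc).const_mul
    ((S r).dens k))).integrableOn (s := {p : ℝ × ℝ | 0 < p.1 ∧ p.2 / p.1 ∈ R})
  have key := (integral_gain (S := S) (δ := straightDelta S l r C I) (T := T) (μ := μ) (e := e)
    (q := q') he0 hT (fun σ _ => hasDerivAt_straight V C σ) (fun σ _ => by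
      rw [hsub, hs, abs_mul, he, abs_of_pos (Real.exp_pos σ)]
      ring) (fun σ _ σ' _ h => by
      have h' : slant μ (V + Real.exp σ • C) = slant μ (V + Real.exp σ' • C) := h
      rw [slant_add_smul, slant_add_smul] at h'
      exact Real.exp_injective (mul_right_cancel₀ hC (add_left_cancel h'))) (fun σ _ => by
      change q' (slant μ (V + Real.exp σ • C)) = (V + Real.exp σ • C).2
      simp only [hq', slant_add_smul, add_sub_cancel_left, Prod.snd_add, Prod.smul_snd,
        smul_eq_mul, ← hβ]
      ring) (fun σ _ => by
      rw [hsub, hs, (hqd _).deriv, Prod.smul_snd, smul_eq_mul, ← hβ]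
      ring) k φ (by
      change IntegrableOn _ {p : ℝ × ℝ | 0 < p.1 ∧ p.2 / p.1 ∈
        (fun σ => slant μ (V + Real.exp σ • C)) '' T}
      rw [himg]
      refine hi.congr (ae_of_all _ fun p => ?_)
      simp only [Pi.sub_apply]
      change _ = ((S l).dens k * flux μ q' (S l).vel (p.2 / p.1) -
        (S r).dens k * flux μ q' (S r).vel (p.2 / p.1)) * onGraph μ q' φ p
      ring)).2
  rw [key]
  have h2 := graphIntegral_sub (μ := μ) hqc (hm (S l).vel) (hK _) (hm (S r).vel) (hK _) hφ hφc R
    ((S l).dens k) ((S r).dens k)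
  have h3 : EqOn q' q R := fun ξ hξ => (hq ξ hξ).symm
  rw [graphIntegral_congr hR.measurableSet h3 (flux_congr hR h3 (S l).vel),
    graphIntegral_congr hR.measurableSet h3 (flux_congr hR h3 (S r).vel)] at h2
  rw [← h2]
  change -(∫ p in {p : ℝ × ℝ | 0 < p.1 ∧ p.2 / p.1 ∈
        (fun σ => slant μ (V + Real.exp σ • C)) '' T}, _) = _
  rw [himg]
  rfl

namespace Profile

variable {p : Profile} {S : Fin 3 → GasState} {φ : ℝ × ℝ × ℝ → ℝ}

/-- The amount of a conserved quantity on a delta shock at the end with parameter `0`, tested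
against `φ`. -/
noncomputable def source (δ : DeltaShock) (k : Fin 4) (φ : ℝ × ℝ × ℝ → ℝ) : ℝ :=
  ∫ s in Ioi (0 : ℝ), s * δ.dens k 0 * φ (s, s • δ.Ξ 0)

theorem integral_horizontal_Ici (hρ : ∀ i, 0 < (S i).ρ) (hφ : ContDiff ℝ ∞ φ)
    (hφc : HasCompactSupport φ) (k : Fin 4) {l r : Fin 3} {C : ℝ × ℝ}
    (hA : p.A = avg (S l) (S r) + C) (h1 : 0 < C.1) (h2 : C.2 = 0) :
    IntegrableOn ((straightDelta S l r C (Ici 0)).integrand k φ)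
      (straightDelta S l r C (Ici 0)).domain ∧
    ∫ q in (straightDelta S l r C (Ici 0)).domain, (straightDelta S l r C (Ici 0)).integrand k φ q =
      source (straightDelta S l r C (Ici 0)) k φ +
        ((S l).dens k * graphIntegral p.μ p.lo (Ioi p.a) (flux p.μ p.lo (S l).vel) φ -
          (S r).dens k * graphIntegral p.μ p.lo (Ioi p.a) (flux p.μ p.lo (S r).vel) φ) := by
  have hs : 0 < slant p.μ C := by simpa [slant, h2] using h1
  have hC : C ≠ 0 := by
    rintro rfl
    exact lt_irrefl _ h1
  have h := integral_gain_straight (S := S) (l := l) (r := r) (I := Ici 0) (e := 1) (β := 0)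
    (q := p.lo) isOpen_Ioi isOpen_Ioi (by rw [abs_of_pos hs, one_mul]) hs.ne'
    (image_slant_straight_Ioi _ hs) (fun ξ hξ => by
      rw [p.lo_of_ge ξ (by rw [hA]; exact le_of_lt hξ), hA, Prod.snd_add, h2]
      ring) (by rw [h2, zero_mul]) k hφ.continuous hφc
  obtain ⟨h3, h4⟩ := integral_integrand_straight_Ici (l := l) (r := r) hρ hC k hφ hφc
  refine ⟨h3, h4.trans ?_⟩
  rw [one_mul, ← hA] at h
  rw [h, source, a]
  ring

theorem integral_vertical_Ici (hρ : ∀ i, 0 < (S i).ρ) (hφ : ContDiff ℝ ∞ φ)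
    (hφc : HasCompactSupport φ) (k : Fin 4) {l r : Fin 3} {C : ℝ × ℝ}
    (hA : p.A = avg (S l) (S r) + C) (h1 : C.1 = 0) (h2 : 0 < C.2) :
    IntegrableOn ((straightDelta S l r C (Ici 0)).integrand k φ)
      (straightDelta S l r C (Ici 0)).domain ∧
    ∫ q in (straightDelta S l r C (Ici 0)).domain, (straightDelta S l r C (Ici 0)).integrand k φ q =
      source (straightDelta S l r C (Ici 0)) k φ +
        ((S l).dens k * graphIntegral p.μ p.hi (Ioi p.a) (flux p.μ p.hi (S l).vel) φ -
          (S r).dens k * graphIntegral p.μ p.hi (Ioi p.a) (flux p.μ p.hi (S r).vel) φ) := by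
  have hμ := p.μ_pos
  have hs' : slant p.μ C = p.μ * C.2 := by simp [slant, h1]
  have hs : 0 < slant p.μ C := by rw [hs']; exact mul_pos hμ h2
  have hC : C ≠ 0 := by
    rintro rfl
    exact lt_irrefl _ h2
  have h := integral_gain_straight (S := S) (l := l) (r := r) (I := Ici 0) (e := 1) (β := p.μ⁻¹)
    (q := p.hi) isOpen_Ioi isOpen_Ioi (by rw [abs_of_pos hs, one_mul]) hs.ne'
    (image_slant_straight_Ioi _ hs) (fun ξ hξ => by
      rw [← hA] at hξ
      rw [p.hi_of_ge (le_of_lt hξ), a, hA]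
      have := slant_add_smul p.μ (avg (S l) (S r)) C 1
      rw [one_smul, one_mul] at this
      rw [this, hs', Prod.snd_add]
      field_simp
      ring) (by rw [hs', inv_mul_cancel_left₀ hμ.ne']) k hφ.continuous hφc
  obtain ⟨h3, h4⟩ := integral_integrand_straight_Ici (l := l) (r := r) hρ hC k hφ hφc
  refine ⟨h3, h4.trans ?_⟩
  rw [one_mul, ← hA] at h
  rw [h, source, a]
  ring

theorem integral_vertical_univ (hρ : ∀ i, 0 < (S i).ρ) (hφ : ContDiff ℝ ∞ φ)
    (hφc : HasCompactSupport φ) (k : Fin 4) {l r : Fin 3} (hA : p.A = avg (S l) (S r)) :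
    IntegrableOn ((straightDelta S l r (0, 1) univ).integrand k φ)
      (straightDelta S l r (0, 1) univ).domain ∧
    ∫ q in (straightDelta S l r (0, 1) univ).domain,
        (straightDelta S l r (0, 1) univ).integrand k φ q =
      (S l).dens k * graphIntegral p.μ p.hi (Ioi p.a) (flux p.μ p.hi (S l).vel) φ -
        (S r).dens k * graphIntegral p.μ p.hi (Ioi p.a) (flux p.μ p.hi (S r).vel) φ := by
  have hμ := p.μ_pos
  have hs' : slant p.μ ((0, 1) : ℝ × ℝ) = p.μ := by simp [slant]
  have hs : 0 < slant p.μ ((0, 1) : ℝ × ℝ) := by rw [hs']; exact hμ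
  have hC : ((0, 1) : ℝ × ℝ) ≠ 0 := by simp
  have h := integral_gain_straight (S := S) (l := l) (r := r) (I := univ) (e := 1) (β := p.μ⁻¹)
    (q := p.hi) isOpen_univ isOpen_Ioi (by rw [abs_of_pos hs, one_mul]) hs.ne'
    (image_slant_straight_univ _ hs) (fun ξ hξ => by
      rw [← hA] at hξ
      rw [p.hi_of_ge (le_of_lt hξ), a, hA]
      ring) (by rw [hs', inv_mul_cancel₀ hμ.ne']) k hφ.continuous hφc
  obtain ⟨h3, h4⟩ := integral_integrand_straight_univ (l := l) (r := r) hρ hC k hφ hφc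
  refine ⟨h3, h4.trans ?_⟩
  rw [one_mul, ← hA] at h
  rw [h, a]
  ring

theorem integral_horizontal_univ (hρ : ∀ i, 0 < (S i).ρ) (hφ : ContDiff ℝ ∞ φ)
    (hφc : HasCompactSupport φ) (k : Fin 4) {l r : Fin 3}
    (hlo : ∀ ξ ≤ slant p.μ (avg (S l) (S r)), p.lo ξ = (avg (S l) (S r)).2) :
    IntegrableOn ((straightDelta S l r (-1, 0) univ).integrand k φ)
      (straightDelta S l r (-1, 0) univ).domain ∧
    ∫ q in (straightDelta S l r (-1, 0) univ).domain,
        (straightDelta S l r (-1, 0) univ).integrand k φ q =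
      (S r).dens k * graphIntegral p.μ p.lo (Iio (slant p.μ (avg (S l) (S r))))
          (flux p.μ p.lo (S r).vel) φ -
        (S l).dens k * graphIntegral p.μ p.lo (Iio (slant p.μ (avg (S l) (S r))))
          (flux p.μ p.lo (S l).vel) φ := by
  have hs' : slant p.μ ((-1, 0) : ℝ × ℝ) = -1 := by simp [slant]
  have hs : slant p.μ ((-1, 0) : ℝ × ℝ) < 0 := by rw [hs']; norm_num
  have hC : ((-1, 0) : ℝ × ℝ) ≠ 0 := by simp
  have h := integral_gain_straight (S := S) (l := l) (r := r) (I := univ) (e := -1) (β := 0)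
    (q := p.lo) isOpen_univ isOpen_Iio (by rw [abs_of_neg hs, neg_one_mul]) hs.ne
    (image_slant_straight_univ_of_neg _ hs) (fun ξ hξ => by
      rw [hlo ξ (le_of_lt hξ)]
      ring) (by simp) k hφ.continuous hφc
  obtain ⟨h3, h4⟩ := integral_integrand_straight_univ (l := l) (r := r) hρ hC k hφ hφc
  refine ⟨h3, h4.trans ?_⟩
  rw [neg_one_mul] at h
  rw [h]
  ring

/-- Integration by parts along the particle paths followed by the change of variables to the slanted
coordinate. The source has a minus sign because particles enter this shock at `A`, while they leave
the arriving shocks there. -/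
theorem integral_curved {δ : DeltaShock} (hδ : IsDeltaShock S δ) (hI : δ.range = Iic 0)
    {P : ℝ × ℝ} (hP : δ.TerminatesAt P) (hg : δ.SlowGrowth) {x : ℝ}
    (hlo : ∀ σ ≤ 0, p.lo (slant p.μ (δ.Ξ σ)) = (δ.Ξ σ).2)
    (hder : ∀ σ < 0, HasDerivAt p.lo ((δ.Ξ σ - δ.U σ).2 / slant p.μ (δ.Ξ σ - δ.U σ))
        (slant p.μ (δ.Ξ σ)))
    (hpos : ∀ σ ≤ 0, 0 < slant p.μ (δ.Ξ σ - δ.U σ))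
    (himg : (fun σ => slant p.μ (δ.Ξ σ)) '' Iio 0 = Ioo x p.a)
    (hinj : InjOn (fun σ => slant p.μ (δ.Ξ σ)) (Iic 0))
    (hKl : ∃ K, ∀ ξ, |flux p.μ p.lo (S δ.left).vel ξ| ≤ K)
    (hKr : ∃ K, ∀ ξ, |flux p.μ p.lo (S δ.right).vel ξ| ≤ K)
    (hφ : ContDiff ℝ ∞ φ) (hφc : HasCompactSupport φ) (k : Fin 4) :
    IntegrableOn (δ.integrand k φ) δ.domain ∧ ∫ q in δ.domain, δ.integrand k φ q =
      -source δ k φ +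
        ((S δ.left).dens k * graphIntegral p.μ p.lo (Ioo x p.a) (flux p.μ p.lo (S δ.left).vel) φ -
          (S δ.right).dens k *
            graphIntegral p.μ p.lo (Ioo x p.a) (flux p.μ p.lo (S δ.right).vel) φ) := by
  obtain ⟨Kl, hKl⟩ := hKl
  obtain ⟨Kr, hKr⟩ := hKr
  have hm : ∀ U, Measurable (flux p.μ p.lo U) :=
    fun U => measurable_flux _ p.continuous_lo.measurable _
  have hi := (((integrable_onGraph (μ := p.μ) p.continuous_lo (hm _) hKl hφ.continuous
    hφc).const_mul ((S δ.left).dens k)).sub ((integrable_onGraph (μ := p.μ) p.continuous_lo (hm _)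
    hKr hφ.continuous hφc).const_mul ((S δ.right).dens k))).integrableOn
    (s := {q : ℝ × ℝ | 0 < q.1 ∧ q.2 / q.1 ∈ Ioo x p.a})
  obtain ⟨h1, h2⟩ := integral_gain (S := S) (δ := δ) (T := Iio 0) (μ := p.μ) (e := 1)
    (q := p.lo) one_ne_zero isOpen_Iio (fun σ hσ => by
      have := hδ.curve σ (by rw [hI]; exact le_of_lt (mem_Iio.1 hσ))
      rw [hI] at this
      exact this.hasDerivAt (Iic_mem_nhds (mem_Iio.1 hσ)))
    (fun σ hσ => by rw [abs_of_pos (hpos σ (le_of_lt hσ)), one_mul])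
    (hinj.mono Iio_subset_Iic_self) (fun σ hσ => hlo σ (le_of_lt hσ))
    (fun σ hσ => by
      rw [(hder σ hσ).deriv, div_mul_cancel₀ _ (hpos σ (le_of_lt hσ)).ne']) k φ (by
      rw [himg]
      refine hi.congr (ae_of_all _ fun q => ?_)
      simp only [Pi.sub_apply]
      ring)
  obtain ⟨h3, h4⟩ := integral_integrand_Iic hδ hI hP hg k hφ hφc h1
  refine ⟨h3, h4.trans ?_⟩
  rw [one_mul, himg] at h2
  rw [h2, source, ← graphIntegral_sub p.continuous_lo (hm _) hKl (hm _) hKr hφ.continuous hφc,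
    graphIntegral]
  ring

end Profile

/-! ### Profiles that carry the new delta shock. -/

/-- A profile whose lower boundary consists of a horizontal ray ending at `P`, of a delta shock
between the states `3` and `2` that leads from the interaction point to `P`, and of the horizontal
ray beyond the interaction point. -/
structure Profile.Carries (p : Profile) (S : Fin 3 → GasState) (δ : DeltaShock) (P : ℝ × ℝ) :
    Prop where
  isDelta : IsDeltaShock S δ
  left : δ.left = i₃
  right : δ.right = i₂
  range : δ.range = Iic 0
  start : δ.Ξ 0 = p.A
  terminates : δ.TerminatesAt P
  slow : δ.SlowGrowth
  lt : slant p.μ P < p.a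
  vel_two : slant p.μ (S i₂).vel = slant p.μ P
  vel_three : slant p.μ (S i₃).vel = slant p.μ P
  vel_lt : (S i₂).v < (S i₃).v
  lo_left : ∀ ξ ≤ slant p.μ P, p.lo ξ = P.2
  lo_curve : ∀ σ ≤ 0, p.lo (slant p.μ (δ.Ξ σ)) = (δ.Ξ σ).2
  deriv_curve : ∀ σ < 0, HasDerivAt p.lo ((δ.Ξ σ - δ.U σ).2 / slant p.μ (δ.Ξ σ - δ.U σ))
    (slant p.μ (δ.Ξ σ))
  slant_pos : ∀ σ ≤ 0, 0 < slant p.μ (δ.Ξ σ - δ.U σ)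
  image : (fun σ => slant p.μ (δ.Ξ σ)) '' Iic 0 = Ioc (slant p.μ P) p.a
  injOn : InjOn (fun σ => slant p.μ (δ.Ξ σ)) (Iic 0)

theorem slant_avg {μ : ℝ} {L R : GasState} (hL : 0 < L.ρ) (hR : 0 < R.ρ)
    (h : slant μ L.vel = slant μ R.vel) : slant μ (avg L R) = slant μ R.vel := by
  have h1 := Real.sqrt_pos.2 hL
  have h2 := Real.sqrt_pos.2 hR
  have h3 : √L.ρ + √R.ρ ≠ 0 := by positivity
  simp only [slant, GasState.vel] at h
  rw [slant, avg_fst, avg_snd]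
  simp only [slant, GasState.vel]
  field_simp
  linear_combination √L.ρ * h

/-- The slant is chosen so that `U₂` and `U₃` have the same slanted coordinate; their average `U*₂₃`
then shares it. -/
theorem exists_carries {S : Fin 3 → GasState} {δ : DeltaShock} (hρ : ∀ i, 0 < (S i).ρ)
    (hδ : IsDeltaShock S δ)
    (hl : δ.left = i₃) (hr : δ.right = i₂) (hI : δ.range = Iic 0)
    (hu : (S i₃).u < (S i₂).u) (hv : (S i₂).v < (S i₃).v)
    (hP : δ.TerminatesAt (avg (S i₂) (S i₃))) (hs : δ.SlowGrowth) :
    ∃ p : Profile, p.A = δ.Ξ 0 ∧ p.Carries S δ (avg (S i₂) (S i₃)) := by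
  have hdv : 0 < (S i₃).v - (S i₂).v := sub_pos.2 hv
  obtain ⟨p, hμ, hA, h1, h2, h3, h4, h5, h6, h7⟩ := exists_profile hδ hl hr hI hu hv hP rfl
  have h8 : slant p.μ (S i₂).vel = slant p.μ (S i₃).vel := by
    rw [hμ]
    simp only [slant, GasState.vel]
    field_simp
    ring
  have h9 := slant_avg (hρ i₂) (hρ i₃) h8
  rw [← hμ] at h1 h2 h3 h4 h5 h6 h7
  have ha : slant p.μ (δ.Ξ 0) = p.a := by rw [Profile.a, hA]
  rw [ha] at h1 h6
  exact ⟨p, hA, hδ, hl, hr, hI, hA.symm, hP, hs, h1, h8.trans h9.symm, h9.symm, hv, h2, h3, h4, h5,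
    h6, h7⟩

namespace Profile.Carries

variable {p : Profile} {S : Fin 3 → GasState} {δ : DeltaShock} {P : ℝ × ℝ}
  {φ : ℝ × ℝ × ℝ → ℝ}

theorem image_Iio (h : p.Carries S δ P) :
    (fun σ => slant p.μ (δ.Ξ σ)) '' Iio 0 = Ioo (slant p.μ P) p.a := by
  have h0 : slant p.μ (δ.Ξ 0) = p.a := by rw [h.start]; rfl
  rw [show Iio (0 : ℝ) = Iic 0 \ {0} by ext; simp [lt_iff_le_and_ne],
    h.injOn.image_sdiff_subset (by simp), h.image, image_singleton, h0]
  ext ξ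
  simp [lt_iff_le_and_ne]

theorem hasDerivAt_lo_left (h : p.Carries S δ P) {ξ : ℝ} (hξ : ξ < slant p.μ P) :
    HasDerivAt p.lo 0 ξ := by
  refine (hasDerivAt_const ξ P.2).congr_of_eventuallyEq ?_
  filter_upwards [Iio_mem_nhds hξ] with z hz
  exact h.lo_left z (le_of_lt hz)

theorem differentiableAt (h : p.Carries S δ P) {ξ : ℝ}
    (hξ : ξ ∉ ({slant p.μ P, p.a} : Set ℝ)) : DifferentiableAt ℝ p.lo ξ := by
  simp only [mem_insert_iff, mem_singleton_iff, not_or] at hξ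
  rcases lt_or_gt_of_ne hξ.1 with h1 | h1
  · exact (h.hasDerivAt_lo_left h1).differentiableAt
  · rcases lt_or_gt_of_ne hξ.2 with h2 | h2
    · have h3 : ξ ∈ (fun σ => slant p.μ (δ.Ξ σ)) '' Iio 0 := by
        rw [h.image_Iio]
        exact ⟨h1, h2⟩
      obtain ⟨σ, hσ, rfl⟩ := h3
      exact (h.deriv_curve σ hσ).differentiableAt
    · exact (p.hasDerivAt_lo_right h2).differentiableAt

/-- No bound on the slope of `lo` is needed. On the curve the entropy condition says that the flux
is positive for state 2 and negative for state 3. Their difference is the constant `v₃ - v₂`,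
because both velocities have the same slanted coordinate. -/
theorem flux_bound (h : p.Carries S δ P) :
    (∃ K, ∀ ξ, |flux p.μ p.lo (S i₂).vel ξ| ≤ K) ∧
      ∃ K, ∀ ξ, |flux p.μ p.lo (S i₃).vel ξ| ≤ K := by
  have key : ∀ ξ, slant p.μ P < ξ → ξ < p.a → |flux p.μ p.lo (S i₂).vel ξ| ≤
      (S i₃).v - (S i₂).v ∧ |flux p.μ p.lo (S i₃).vel ξ| ≤ (S i₃).v - (S i₂).v := by
    intro ξ h1 h2
    have h3 : ξ ∈ (fun σ => slant p.μ (δ.Ξ σ)) '' Iio 0 := by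
      rw [h.image_Iio]
      exact ⟨h1, h2⟩
    obtain ⟨σ, hσ, rfl⟩ := h3
    have hσ' : σ ≤ 0 := le_of_lt hσ
    have hp := h.slant_pos σ hσ'
    have hent := h.isDelta.entropy σ (by rw [h.range]; exact hσ')
    have hd : deriv p.lo (slant p.μ (δ.Ξ σ)) * slant p.μ (δ.Ξ σ - δ.U σ) = (δ.Ξ σ - δ.U σ).2 := by
      rw [(h.deriv_curve σ hσ).deriv, div_mul_cancel₀ _ hp.ne']
    rw [h.left, h.right, tri_eq_flux (h.lo_curve σ hσ') hd, tri_eq_flux (h.lo_curve σ hσ') hd,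
      neg_pos, neg_neg_iff_pos] at hent
    have e3 : flux p.μ p.lo (S i₃).vel (slant p.μ (δ.Ξ σ)) < 0 := neg_of_mul_neg_right hent.1 hp.le
    have e2 : 0 < flux p.μ p.lo (S i₂).vel (slant p.μ (δ.Ξ σ)) := pos_of_mul_pos_right hent.2 hp.le
    have hsum : flux p.μ p.lo (S i₂).vel (slant p.μ (δ.Ξ σ)) -
        flux p.μ p.lo (S i₃).vel (slant p.μ (δ.Ξ σ)) = (S i₃).v - (S i₂).v := by
      have e1 := h.vel_two.trans h.vel_three.symm
      simp only [slant] at e1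
      simp only [flux, e1]
      simp only [GasState.vel]
      ring
    constructor <;> rw [abs_le] <;> constructor <;> linarith
  have hb : ∀ U : ℝ × ℝ, slant p.μ U = slant p.μ P → (∀ ξ, slant p.μ P < ξ → ξ < p.a →
      |flux p.μ p.lo U ξ| ≤ (S i₃).v - (S i₂).v) → ∃ K, ∀ ξ, |flux p.μ p.lo U ξ| ≤ K := by
    intro U hU hk
    have hdv : 0 < (S i₃).v - (S i₂).v := sub_pos.2 h.vel_lt
    have a1 := abs_nonneg (P.2 - U.2)
    have a2 := abs_nonneg (p.A.2 - U.2)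
    have a3 := abs_nonneg (flux p.μ p.lo U (slant p.μ P))
    have a4 := abs_nonneg (flux p.μ p.lo U p.a)
    refine ⟨|P.2 - U.2| + |p.A.2 - U.2| + |flux p.μ p.lo U (slant p.μ P)| +
      |flux p.μ p.lo U p.a| + ((S i₃).v - (S i₂).v), fun ξ => ?_⟩
    rcases lt_trichotomy ξ (slant p.μ P) with h1 | h1 | h1
    · have : flux p.μ p.lo U ξ = P.2 - U.2 := by
        rw [flux, (h.hasDerivAt_lo_left h1).deriv, h.lo_left ξ h1.le]
        ring
      rw [this]
      linarith
    · rw [h1]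
      linarith
    · rcases lt_trichotomy ξ p.a with h2 | h2 | h2
      · linarith [hk ξ h1 h2]
      · rw [h2]
        linarith
      · rw [p.flux_lo_right h2]
        linarith
  exact ⟨hb _ h.vel_two fun ξ h1 h2 => (key ξ h1 h2).1,
    hb _ h.vel_three fun ξ h1 h2 => (key ξ h1 h2).2⟩

end Profile.Carries

theorem image_slant_straight_Ici {μ : ℝ} (V : ℝ × ℝ) {C : ℝ × ℝ} (hC : 0 < slant μ C) :
    (fun σ => slant μ (V + Real.exp σ • C)) '' Ici 0 = Ici (slant μ (V + C)) := by
  rw [← Ioi_insert, image_insert_eq, image_slant_straight_Ioi V hC, Real.exp_zero, one_smul,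
    Ioi_insert]

theorem rot_straight (V C : ℝ × ℝ) (a : ℝ) : rot (V - (V + a • C)) = (a * C.2, -(a * C.1)) := by
  simp [rot]

namespace Profile

variable {p : Profile} {S : Fin 3 → GasState} {δ : DeltaShock} {P : ℝ × ℝ} {l r : Fin 3}
  {C : ℝ × ℝ}

theorem slant_of_fst_pos (h1 : 0 < C.1) (h2 : C.2 = 0) : 0 < slant p.μ C := by
  simpa [slant, h2] using h1

theorem slant_of_snd_pos (h1 : C.1 = 0) (h2 : 0 < C.2) : 0 < slant p.μ C := by
  simpa [slant, h1] using mul_pos p.μ_pos h2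

/-! #### Horizontal and vertical rays from the interaction point -/

theorem mem_arc_horizontal {V : ℝ × ℝ} (hA : p.A = V + C) (h1 : 0 < C.1) (h2 : C.2 = 0) {σ : ℝ}
    (hσ : 0 ≤ σ) : p.lo (slant p.μ (V + Real.exp σ • C)) = (V + Real.exp σ • C).2 := by
  have hs := slant_of_fst_pos (p := p) h1 h2
  have h3 : slant p.μ (V + Real.exp σ • C) ∈ Ici (slant p.μ (V + C)) := by
    rw [← image_slant_straight_Ici V hs]
    exact ⟨σ, hσ, rfl⟩
  rw [p.lo_of_ge _ (by rw [hA]; exact h3), hA]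
  simp [h2]

theorem mem_arc_vertical {V : ℝ × ℝ} {σ c : ℝ} (hA : p.A = V + c • C) (h1 : C.1 = 0)
    (h : p.a ≤ slant p.μ (V + Real.exp σ • C)) :
    p.hi (slant p.μ (V + Real.exp σ • C)) = (V + Real.exp σ • C).2 := by
  have hμ := p.μ_pos
  rw [p.hi_of_ge h, a, hA, slant_add_smul, slant_add_smul]
  simp only [slant, h1, Prod.snd_add, Prod.smul_snd, smul_eq_mul]
  field_simp
  ring

theorem support_horizontal_Ici (hA : p.A = avg (S l) (S r) + C) (h1 : 0 < C.1) (h2 : C.2 = 0) :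
    (straightDelta S l r C (Ici 0)).support = p.arc p.lo (Ici p.a) := by
  have h3 := p.image_eq_arc (f := fun σ => avg (S l) (S r) + Real.exp σ • C) (I := Ici 0)
    (q := p.lo) fun σ hσ => mem_arc_horizontal hA h1 h2 hσ
  rw [image_slant_straight_Ici _ (slant_of_fst_pos h1 h2), ← hA] at h3
  exact h3

theorem support_vertical_Ici (hA : p.A = avg (S l) (S r) + C) (h1 : C.1 = 0) (h2 : 0 < C.2) :
    (straightDelta S l r C (Ici 0)).support = p.arc p.hi (Ici p.a) := by
  have h4 := image_slant_straight_Ici (avg (S l) (S r)) (slant_of_snd_pos (p := p) h1 h2)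
  rw [← hA] at h4
  have h3 := p.image_eq_arc (f := fun σ => avg (S l) (S r) + Real.exp σ • C) (I := Ici 0)
    (q := p.hi) fun σ hσ => mem_arc_vertical (c := 1) (by rw [one_smul, hA]) h1 (by
      have : slant p.μ (avg (S l) (S r) + Real.exp σ • C) ∈ Ici (slant p.μ p.A) := by
        rw [← h4]
        exact ⟨σ, hσ, rfl⟩
      exact this)
  rw [h4] at h3
  exact h3

theorem support_vertical_univ (hA : p.A = avg (S l) (S r)) :
    (straightDelta S l r (0, 1) univ).support = p.arc p.hi (Ioi p.a) := by
  have h4 := image_slant_straight_univ (avg (S l) (S r))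
    (slant_of_snd_pos (p := p) (C := (0, 1)) rfl one_pos)
  rw [← hA, ← a, hA] at h4
  have h3 := p.image_eq_arc (f := fun σ => avg (S l) (S r) + Real.exp σ • ((0, 1) : ℝ × ℝ))
    (I := univ) (q := p.hi) fun σ _ => mem_arc_vertical (c := 0) (by simp [hA]) rfl (by
      have : slant p.μ (avg (S l) (S r) + Real.exp σ • ((0, 1) : ℝ × ℝ)) ∈ Ioi p.a := by
        rw [← h4]
        exact ⟨σ, mem_univ _, rfl⟩
      exact le_of_lt this)
  rw [h4] at h3
  exact h3

theorem support_horizontal_univ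
    (hlo : ∀ ξ ≤ slant p.μ (avg (S l) (S r)), p.lo ξ = (avg (S l) (S r)).2) :
    (straightDelta S l r (-1, 0) univ).support =
      p.arc p.lo (Iio (slant p.μ (avg (S l) (S r)))) := by
  have h4 := image_slant_straight_univ_of_neg (μ := p.μ) (avg (S l) (S r)) (C := (-1, 0))
    (by simp [slant])
  have h3 := p.image_eq_arc (f := fun σ => avg (S l) (S r) + Real.exp σ • ((-1, 0) : ℝ × ℝ))
    (I := univ) (q := p.lo) fun σ _ => by
      have : slant p.μ (avg (S l) (S r) + Real.exp σ • ((-1, 0) : ℝ × ℝ)) ∈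
          Iio (slant p.μ (avg (S l) (S r))) := by
        rw [← h4]
        exact ⟨σ, mem_univ _, rfl⟩
      rw [hlo _ (le_of_lt this)]
      simp
  rw [h4] at h3
  exact h3

theorem sides_horizontal_Ici (hA : p.A = avg (S i₃) (S i₁) + C) (h1 : 0 < C.1) (h2 : C.2 = 0) :
    let d := straightDelta S i₃ i₁ C (Ici 0)
    ∀ σ ∈ interior d.range, ∀ᶠ ε : ℝ in 𝓝[>] 0,
      d.Ξ σ + ε • rot (d.U σ - d.Ξ σ) ∈ p.region d.left ∧
      d.Ξ σ - ε • rot (d.U σ - d.Ξ σ) ∈ p.region d.right := by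
  intro d σ hσ
  have hσ' : σ ∈ Ioi (0 : ℝ) := by
    have : σ ∈ interior (Ici (0 : ℝ)) := hσ
    rwa [interior_Ici] at this
  refine p.sides_lo_right ⟨?_, (mem_arc_horizontal hA h1 h2 (le_of_lt hσ')).symm⟩ ?_
  · rw [a, hA, ← image_slant_straight_Ioi _ (slant_of_fst_pos h1 h2)]
    exact ⟨σ, hσ', rfl⟩
  · change (rot (avg (S i₃) (S i₁) - (avg (S i₃) (S i₁) + Real.exp σ • C))).2 < 0
    rw [rot_straight]
    exact neg_neg_of_pos (mul_pos (Real.exp_pos σ) h1)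

theorem sides_vertical (I : Set ℝ) (h2 : 0 < C.2)
    (hI : ∀ σ ∈ interior I, avg (S i₁) (S i₂) + Real.exp σ • C ∈ p.arc p.hi (Ioi p.a)) :
    let d := straightDelta S i₁ i₂ C I
    ∀ σ ∈ interior d.range, ∀ᶠ ε : ℝ in 𝓝[>] 0,
      d.Ξ σ + ε • rot (d.U σ - d.Ξ σ) ∈ p.region d.left ∧
      d.Ξ σ - ε • rot (d.U σ - d.Ξ σ) ∈ p.region d.right := by
  intro d σ hσ
  refine p.sides_hi (hI σ hσ) ?_
  change 0 < (rot (avg (S i₁) (S i₂) - (avg (S i₁) (S i₂) + Real.exp σ • C))).1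
  rw [rot_straight]
  exact mul_pos (Real.exp_pos σ) h2

theorem sides_vertical_Ici (hA : p.A = avg (S i₁) (S i₂) + C) (h1 : C.1 = 0) (h2 : 0 < C.2) :
    let d := straightDelta S i₁ i₂ C (Ici 0)
    ∀ σ ∈ interior d.range, ∀ᶠ ε : ℝ in 𝓝[>] 0,
      d.Ξ σ + ε • rot (d.U σ - d.Ξ σ) ∈ p.region d.left ∧
      d.Ξ σ - ε • rot (d.U σ - d.Ξ σ) ∈ p.region d.right := by
  refine sides_vertical _ h2 fun σ hσ => ?_
  rw [interior_Ici] at hσ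
  have h3 : slant p.μ (avg (S i₁) (S i₂) + Real.exp σ • C) ∈ Ioi p.a := by
    rw [a, hA, ← image_slant_straight_Ioi _ (slant_of_snd_pos h1 h2)]
    exact ⟨σ, hσ, rfl⟩
  exact ⟨h3, (mem_arc_vertical (c := 1) (by rw [one_smul, hA]) h1 (le_of_lt h3)).symm⟩

theorem sides_vertical_univ (hA : p.A = avg (S i₁) (S i₂)) :
    let d := straightDelta S i₁ i₂ (0, 1) univ
    ∀ σ ∈ interior d.range, ∀ᶠ ε : ℝ in 𝓝[>] 0,
      d.Ξ σ + ε • rot (d.U σ - d.Ξ σ) ∈ p.region d.left ∧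
      d.Ξ σ - ε • rot (d.U σ - d.Ξ σ) ∈ p.region d.right := by
  refine sides_vertical _ one_pos fun σ _ => ?_
  have h := support_vertical_univ (S := S) (l := i₁) (r := i₂) hA
  rw [← h]
  exact ⟨σ, mem_univ _, rfl⟩

/-! #### Contact discontinuities -/

theorem image_affine_Iio_of_pos (b : ℝ) {s : ℝ} (hs : 0 < s) :
    (fun τ : ℝ => b + τ * s) '' Iio 0 = Iio b := by
  ext x
  simp only [mem_image, mem_Iio]
  constructor
  · rintro ⟨τ, hτ, rfl⟩
    linarith [mul_neg_of_neg_of_pos hτ hs]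
  · intro hx
    refine ⟨(x - b) / s, div_neg_of_neg_of_pos (sub_neg.2 hx) hs, ?_⟩
    rw [div_mul_cancel₀ _ hs.ne']
    ring

theorem image_affine_Iio_of_neg (b : ℝ) {s : ℝ} (hs : s < 0) :
    (fun τ : ℝ => b + τ * s) '' Iio 0 = Ioi b := by
  ext x
  simp only [mem_image, mem_Iio, mem_Ioi]
  constructor
  · rintro ⟨τ, hτ, rfl⟩
    linarith [mul_pos_of_neg_of_neg hτ hs]
  · intro hx
    refine ⟨(x - b) / s, div_neg_of_pos_of_neg (sub_pos.2 hx) hs, ?_⟩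
    rw [div_mul_cancel₀ _ hs.ne]
    ring

theorem support_contact {J : Contact} {q : ℝ → ℝ} {T : Set ℝ}
    (himg : (fun τ : ℝ => slant p.μ J.base + τ * slant p.μ J.dir) '' J.range = T)
    (hq : ∀ τ ∈ J.range, q (slant p.μ J.base + τ * slant p.μ J.dir) = J.base.2 + τ * J.dir.2) :
    J.support = p.arc q T := by
  have h := p.image_eq_arc (f := fun τ : ℝ => J.base + τ • J.dir) (I := J.range) (q := q)
    fun τ hτ => by
      rw [slant_add_smul, hq τ hτ]
      rfl
  simp only [slant_add_smul] at h
  rw [himg] at h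
  exact h

theorem support_contact_vertical (i j : Fin 3) :
    (⟨i, j, p.A, (0, -1), Iio 0⟩ : Contact).support = p.arc p.hi (Ioi p.a) := by
  have hμ := p.μ_pos
  have hs : slant p.μ ((0, -1) : ℝ × ℝ) < 0 := by simpa [slant] using hμ
  have himg := image_affine_Iio_of_neg p.a hs
  refine support_contact himg fun τ hτ => ?_
  have h1 : p.a + τ * slant p.μ ((0, -1) : ℝ × ℝ) ∈ Ioi p.a := himg ▸ ⟨τ, hτ, rfl⟩
  change p.hi (p.a + τ * slant p.μ ((0, -1) : ℝ × ℝ)) = p.A.2 + τ * (-1)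
  rw [p.hi_of_ge (le_of_lt h1)]
  simp only [slant]
  field_simp
  ring

theorem support_contact_right (i j : Fin 3) {B : ℝ × ℝ} (hB : p.a ≤ slant p.μ B)
    (hB' : B.2 = p.A.2) :
    (⟨i, j, B, (-1, 0), Iio 0⟩ : Contact).support = p.arc p.lo (Ioi (slant p.μ B)) := by
  have hs : slant p.μ ((-1, 0) : ℝ × ℝ) < 0 := by simp [slant]
  have himg := image_affine_Iio_of_neg (slant p.μ B) hs
  refine support_contact himg fun τ hτ => ?_
  have h1 : slant p.μ B + τ * slant p.μ ((-1, 0) : ℝ × ℝ) ∈ Ioi (slant p.μ B) :=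
    himg ▸ ⟨τ, hτ, rfl⟩
  rw [p.lo_of_ge _ (hB.trans (le_of_lt h1)), ← hB']
  simp

theorem isContact_vertical {i j : Fin 3} {A : ℝ × ℝ} {I : Set ℝ} (hi : (S i).u = A.1)
    (hj : (S j).u = A.1) : IsContact S ⟨i, j, A, (0, -1), I⟩ := by
  refine ⟨by simp, ?_⟩
  rintro Q ⟨τ, -, rfl⟩
  simp [cross, GasState.vel, hi, hj]

theorem isContact_horizontal {i j : Fin 3} {A : ℝ × ℝ} {I : Set ℝ} {c : ℝ} (hc : c ≠ 0)
    (hi : (S i).v = A.2) (hj : (S j).v = A.2) : IsContact S ⟨i, j, A, (c, 0), I⟩ := by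
  refine ⟨by simp [hc], ?_⟩
  rintro Q ⟨τ, -, rfl⟩
  simp [cross, GasState.vel, hi, hj]

theorem contactSides_vertical :
    let J : Contact := ⟨i₁, i₂, p.A, (0, -1), Iio 0⟩
    ∀ Q ∈ J.support, ∀ᶠ ε : ℝ in 𝓝[>] 0,
      Q + ε • rot J.dir ∈ p.region J.left ∧ Q - ε • rot J.dir ∈ p.region J.right := by
  intro J Q hQ
  rw [support_contact_vertical] at hQ
  exact p.sides_hi hQ (by simp [J, rot])

theorem contactSides_right {B : ℝ × ℝ} (hB : p.a ≤ slant p.μ B) (hB' : B.2 = p.A.2) :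
    let J : Contact := ⟨i₃, i₁, B, (-1, 0), Iio 0⟩
    ∀ Q ∈ J.support, ∀ᶠ ε : ℝ in 𝓝[>] 0,
      Q + ε • rot J.dir ∈ p.region J.left ∧ Q - ε • rot J.dir ∈ p.region J.right := by
  intro J Q hQ
  rw [support_contact_right i₃ i₁ hB hB'] at hQ
  exact p.sides_lo_right (p.arc_mono _ (Ioi_subset_Ioi hB) hQ) (by simp [J, rot])

/-! #### The curved delta shock -/

theorem arc_lo_inter_subset {T T' : Set ℝ} (h : T ∩ T' ⊆ {p.a}) :
    p.arc p.lo T ∩ p.arc p.lo T' ⊆ {p.A} := by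
  rw [arc_inter]
  refine (p.arc_mono _ h).trans ?_
  rw [a, p.arc_singleton (p.lo_of_ge _ le_rfl)]

theorem sides_of_opposite {B W : ℝ × ℝ} {Ω Ω' : Set (ℝ × ℝ)}
    (h : ∀ᶠ ε : ℝ in 𝓝[>] 0, B + ε • (-W) ∈ Ω' ∧ B - ε • (-W) ∈ Ω) :
    ∀ᶠ ε : ℝ in 𝓝[>] 0, B + ε • W ∈ Ω ∧ B - ε • W ∈ Ω' := by
  filter_upwards [h] with ε hε
  rw [smul_neg, sub_neg_eq_add, ← sub_eq_add_neg] at hε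
  exact hε.symm

namespace Carries

theorem support_curve (h : p.Carries S δ P) :
    δ.support = p.arc p.lo (Ioc (slant p.μ P) p.a) := by
  rw [DeltaShock.support, h.range, p.image_eq_arc (I := Iic 0) h.lo_curve, h.image]

theorem sides_curve (h : p.Carries S δ P) : ∀ σ ∈ interior δ.range, ∀ᶠ ε : ℝ in 𝓝[>] 0,
    δ.Ξ σ + ε • rot (δ.U σ - δ.Ξ σ) ∈ p.region δ.left ∧
      δ.Ξ σ - ε • rot (δ.U σ - δ.Ξ σ) ∈ p.region δ.right := by
  intro σ hσ
  rw [h.range, interior_Iic] at hσ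
  have h1 : slant p.μ (δ.Ξ σ) ∈ Ioo (slant p.μ P) p.a := by
    rw [← h.image_Iio]
    exact ⟨σ, hσ, rfl⟩
  rw [h.left, h.right, ← neg_sub (δ.Ξ σ)]
  exact p.sides_lo_left ⟨h1.2, (h.lo_curve σ (le_of_lt hσ)).symm⟩ (h.deriv_curve σ hσ)
    (rot_below (h.slant_pos σ (le_of_lt hσ)) rfl)

theorem sides_exterior (h : p.Carries S δ (avg (S i₂) (S i₃))) :
    let d := straightDelta S i₂ i₃ (-1, 0) univ
    ∀ σ ∈ interior d.range, ∀ᶠ ε : ℝ in 𝓝[>] 0,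
      d.Ξ σ + ε • rot (d.U σ - d.Ξ σ) ∈ p.region d.left ∧
      d.Ξ σ - ε • rot (d.U σ - d.Ξ σ) ∈ p.region d.right := by
  intro d σ _
  have h1 := support_horizontal_univ h.lo_left
  have h2 : d.Ξ σ ∈ p.arc p.lo (Iio (slant p.μ (avg (S i₂) (S i₃)))) := by
    rw [← h1]
    exact ⟨σ, mem_univ _, rfl⟩
  refine sides_of_opposite (p.sides_lo_left (p.arc_mono _ (Iio_subset_Iio h.lt.le) h2)
    (h.hasDerivAt_lo_left h2.1) ?_)
  change (-rot (avg (S i₂) (S i₃) - (avg (S i₂) (S i₃) + Real.exp σ • (-1, 0)))).2 < _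
  rw [rot_straight]
  simp [Real.exp_pos]

theorem compl_iUnion_region (h : p.Carries S δ P) : (⋃ i, p.region i)ᶜ =
    p.arc p.lo (Iio (slant p.μ P)) ∪ p.arc p.lo (Ioc (slant p.μ P) p.a) ∪ p.arc p.lo (Ioi p.a) ∪
      p.arc p.hi (Ioi p.a) ∪ {p.A, P} := by
  have h2 : p.arc p.hi {p.a} = {p.A} := p.arc_singleton (by
    change p.hi p.a = _
    rw [p.hi_of_le le_rfl]
    exact p.lo_of_ge _ le_rfl)
  have h3 : p.arc p.lo {slant p.μ P} = {P} := p.arc_singleton (h.lo_left _ le_rfl)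
  have h4 : (univ : Set ℝ) = Iio (slant p.μ P) ∪ {slant p.μ P} ∪ Ioc (slant p.μ P) p.a ∪
      Ioi p.a := by
    rw [union_assoc, Ioc_union_Ioi_eq_Ioi h.lt.le, Iio_union_right, Iic_union_Ioi]
  have h5 : Ici p.a = {p.a} ∪ Ioi p.a := by rw [← Ioi_insert]; rfl
  rw [p.compl_iUnion_region, h4, h5]
  simp only [arc_union, h2, h3]
  have h6 : p.A ∈ p.arc p.lo (Ioc (slant p.μ P) p.a) :=
    ⟨⟨h.lt, le_rfl⟩, (p.lo_of_ge _ le_rfl).symm⟩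
  ext Q
  simp only [mem_union, mem_singleton_iff, mem_insert_iff]
  tauto

end Carries

end Profile

/-! ### Balance at the interaction point and the global solutions. -/

namespace Profile

variable {p : Profile} {S : Fin 3 → GasState} {δ : DeltaShock} {φ : ℝ × ℝ × ℝ → ℝ}

theorem source_eq (δ : DeltaShock) (k : Fin 4) (φ : ℝ × ℝ × ℝ → ℝ) :
    source δ k φ = δ.dens k 0 * ∫ s in Ioi (0 : ℝ), s * φ (s, s • δ.Ξ 0) := by
  rw [source, ← integral_const_mul]
  congr 1 with s
  ring

theorem arc_insert_right (p : Profile) {q : ℝ → ℝ} (hq : q p.a = p.A.2) :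
    p.arc q (Ici p.a) = insert p.A (p.arc q (Ioi p.a)) := by
  rw [← Ioi_insert, insert_eq, arc_union, show p.arc q {p.a} = {p.A} from p.arc_singleton hq]
  rfl

theorem lo_a (p : Profile) : p.lo p.a = p.A.2 := p.lo_of_ge _ le_rfl

theorem hi_a (p : Profile) : p.hi p.a = p.A.2 := by rw [p.hi_of_le le_rfl, lo_a]

namespace Carries

/-- The exterior shock between states 2 and 3 and the new shock together absorb all fluxes through
the boundary before `a`. What remains is the initial amount of the new shock at `A` and the fluxes
beyond `a`, which the waves arriving at `A` have to balance. -/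
theorem weak_aux (h : p.Carries S δ (avg (S i₂) (S i₃))) (hρ : ∀ i, 0 < (S i).ρ)
    (hφ : ContDiff ℝ ∞ φ) (hφc : HasCompactSupport φ) (k : Fin 4) :
    let d := straightDelta S i₂ i₃ (-1, 0) univ
    IntegrableOn (d.integrand k φ) d.domain ∧ IntegrableOn (δ.integrand k φ) δ.domain ∧
    (∑ i, ∫ q in cone (p.region i), (S i).dens k * fderiv ℝ φ q (1, (S i).vel))
      + (∑ i, ∫ X in sector i, (S i).dens k * φ (0, X))
      + (∫ q in d.domain, d.integrand k φ q) + ∫ q in δ.domain, δ.integrand k φ q =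
    -source δ k φ
      - ((S i₃).dens k * graphIntegral p.μ p.lo (Ioi p.a) (flux p.μ p.lo (S i₃).vel) φ
        - (S i₁).dens k * graphIntegral p.μ p.lo (Ioi p.a) (flux p.μ p.lo (S i₁).vel) φ)
      - ((S i₁).dens k * graphIntegral p.μ p.hi (Ioi p.a) (flux p.μ p.hi (S i₁).vel) φ
        - (S i₂).dens k * graphIntegral p.μ p.hi (Ioi p.a) (flux p.μ p.hi (S i₂).vel) φ) := by
  intro d
  obtain ⟨hK₂, hK₃⟩ := h.flux_bound
  obtain ⟨h1, h2⟩ := integral_horizontal_univ (p := p) hρ hφ hφc k h.lo_left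
  obtain ⟨h3, h4⟩ := integral_curved h.isDelta h.range h.terminates h.slow h.lo_curve
    h.deriv_curve h.slant_pos h.image_Iio h.injOn (by rw [h.left]; exact hK₃)
    (by rw [h.right]; exact hK₂) hφ hφc k
  refine ⟨h1, h3, ?_⟩
  rw [sum_integral_region S (((finite_singleton _).insert _).countable)
    (fun ξ hξ => h.differentiableAt hξ) hK₂ hK₃ hφ hφc k, h2, h4, h.left, h.right]
  have hsplit : ∀ U, (∃ K, ∀ ξ, |flux p.μ p.lo U ξ| ≤ K) →
      graphIntegral p.μ p.lo (Iio p.a) (flux p.μ p.lo U) φ =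
      graphIntegral p.μ p.lo (Iio (slant p.μ (avg (S i₂) (S i₃)))) (flux p.μ p.lo U) φ +
      graphIntegral p.μ p.lo (Ioo (slant p.μ (avg (S i₂) (S i₃))) p.a) (flux p.μ p.lo U) φ := by
    rintro U ⟨K, hK⟩
    rw [← graphIntegral_union p.continuous_lo (measurable_flux _ p.continuous_lo.measurable _) hK
      hφ.continuous hφc measurableSet_Ioo
      (disjoint_left.2 fun y h1 h2 => lt_asymm (mem_Iio.1 h1) h2.1),
      ← graphIntegral_union_singleton p.μ p.lo (_ ∪ _) (slant p.μ (avg (S i₂) (S i₃))),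
      ← insert_union, Iio_insert, Iic_union_Ioo_eq_Iio h.lt]
  rw [hsplit _ hK₂, hsplit _ hK₃]
  ring

/-- Two delta shocks arriving at the interaction point. -/
theorem isGlobalSolution_two_deltas (h : p.Carries S δ (avg (S i₂) (S i₃)))
    (hρ : ∀ i, 0 < (S i).ρ) {C C' : ℝ × ℝ} (hA : p.A = avg (S i₁) (S i₂) + C) (h1 : C.1 = 0)
    (h2 : 0 < C.2) (hA' : p.A = avg (S i₃) (S i₁) + C') (h1' : 0 < C'.1) (h2' : C'.2 = 0)
    (hd : IsDeltaShock S (straightDelta S i₁ i₂ C (Ici 0)))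
    (hd' : IsDeltaShock S (straightDelta S i₃ i₁ C' (Ici 0)))
    (hd'' : IsDeltaShock S (straightDelta S i₂ i₃ (-1, 0) univ))
    (hsum : ∀ k, δ.dens k 0 = (straightDelta S i₁ i₂ C (Ici 0)).dens k 0 +
      (straightDelta S i₃ i₁ C' (Ici 0)).dens k 0) :
    IsGlobalSolution S p.region [straightDelta S i₁ i₂ C (Ici 0), straightDelta S i₃ i₁ C' (Ici 0),
      straightDelta S i₂ i₃ (-1, 0) univ, δ] [] {p.A, avg (S i₂) (S i₃)} := by
  have s1 := support_vertical_Ici (S := S) (l := i₁) (r := i₂) hA h1 h2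
  have s2 := support_horizontal_Ici (S := S) (l := i₃) (r := i₁) hA' h1' h2'
  have s3 := support_horizontal_univ h.lo_left
  have s4 := h.support_curve
  have hlt := h.lt
  refine ⟨p.isOpen_region, p.pairwise_disjoint_region, ?_, ?_, fun i d hd =>
    p.eventually_mem_region i hd, ?_, ?_, by simp, by simp, ?_, ?_⟩
  · simp only [List.mem_cons, List.not_mem_nil, or_false, iUnion_iUnion_eq_or_left,
      iUnion_iUnion_eq_left, s1, s2, s3, s4, h.compl_iUnion_region, iUnion_of_empty,
      arc_insert_right p p.lo_a, arc_insert_right p p.hi_a]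
    ext Q
    simp only [mem_union, mem_insert_iff, mem_singleton_iff]
    simp
    tauto
  · have hN : ({p.A} : Set (ℝ × ℝ)) ⊆ {p.A, avg (S i₂) (S i₃)} := by simp
    simp only [List.map_cons, List.map_nil, List.append_nil, List.pairwise_cons, s1, s2, s3, s4,
      List.mem_cons, List.not_mem_nil, or_false, forall_eq_or_imp, forall_eq]
    refine ⟨⟨?_, ?_, ?_⟩, ⟨?_, ?_⟩, ?_, ?_⟩
    · exact (inter_comm _ _).trans_subset ((p.arc_lo_inter_arc_hi le_rfl).trans hN)
    · exact (inter_comm _ _).trans_subset ((p.arc_lo_inter_arc_hi le_rfl).trans hN)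
    · exact (inter_comm _ _).trans_subset ((p.arc_lo_inter_arc_hi le_rfl).trans hN)
    · refine (arc_lo_inter_subset fun z hz => ?_).trans hN
      exact absurd (mem_Iio.1 hz.2) (not_lt.2 (hlt.le.trans hz.1))
    · refine (arc_lo_inter_subset fun z hz => ?_).trans hN
      exact le_antisymm hz.2.2 hz.1
    · refine (arc_lo_inter_subset fun z hz => ?_).trans hN
      exact absurd (mem_Iio.1 hz.1) (lt_asymm hz.2.1)
    · simp
  · simp only [List.mem_cons, List.not_mem_nil, or_false, forall_eq_or_imp, forall_eq]
    exact ⟨hd, hd', hd'', h.isDelta⟩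
  · simp only [List.mem_cons, List.not_mem_nil, or_false, forall_eq_or_imp, forall_eq]
    exact ⟨sides_vertical_Ici hA h1 h2, sides_horizontal_Ici hA' h1' h2', h.sides_exterior,
      h.sides_curve⟩
  · intro φ hφ hφc k
    obtain ⟨i3, i4, e⟩ := h.weak_aux hρ hφ hφc k
    obtain ⟨i1, e1⟩ := integral_vertical_Ici (S := S) hρ hφ hφc k hA h1 h2
    obtain ⟨i2, e2⟩ := integral_horizontal_Ici (S := S) hρ hφ hφc k hA' h1' h2'
    refine ⟨?_, ?_⟩
    · simp only [List.mem_cons, List.not_mem_nil, or_false, forall_eq_or_imp, forall_eq]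
      exact ⟨i1, i2, i3, i4⟩
    · simp only [List.map_cons, List.map_nil, List.sum_cons, List.sum_nil, e1, e2]
      -- Conservation at `A`: all three shocks pass through `A` at parameter `0`, so their sources
      -- test `φ` on the same ray and only the weights matter.
      have hz : source δ k φ = source (straightDelta S i₁ i₂ C (Ici 0)) k φ +
          source (straightDelta S i₃ i₁ C' (Ici 0)) k φ := by
        have z1 : (straightDelta S i₁ i₂ C (Ici 0)).Ξ 0 = p.A := by simp [straightDelta, hA]
        have z2 : (straightDelta S i₃ i₁ C' (Ici 0)).Ξ 0 = p.A := by simp [straightDelta, hA']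
        rw [source_eq, source_eq, source_eq, h.start, z1, z2, hsum k]
        ring
      rw [hz] at e
      linarith
  · filter_upwards [p.ae_mem_region] with P hP
    exact hP.imp fun i hi => ⟨hi, hρ i⟩

/-- A contact discontinuity and a delta shock arriving at the interaction point. -/
theorem isGlobalSolution_contact_delta (h : p.Carries S δ (avg (S i₂) (S i₃)))
    (hρ : ∀ i, 0 < (S i).ρ) {C' : ℝ × ℝ} (hA : (S i₁).u = p.A.1) (hA₂ : (S i₂).u = p.A.1)
    (hA' : p.A = avg (S i₃) (S i₁) + C') (h1' : 0 < C'.1) (h2' : C'.2 = 0)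
    (hd' : IsDeltaShock S (straightDelta S i₃ i₁ C' (Ici 0)))
    (hd'' : IsDeltaShock S (straightDelta S i₂ i₃ (-1, 0) univ))
    (hsum : ∀ k, δ.dens k 0 = (straightDelta S i₃ i₁ C' (Ici 0)).dens k 0) :
    IsGlobalSolution S p.region [straightDelta S i₃ i₁ C' (Ici 0),
      straightDelta S i₂ i₃ (-1, 0) univ, δ] [⟨i₁, i₂, p.A, (0, -1), Iio 0⟩]
      {p.A, avg (S i₂) (S i₃)} := by
  have s1 := support_contact_vertical (p := p) i₁ i₂
  have s2 := support_horizontal_Ici (S := S) (l := i₃) (r := i₁) hA' h1' h2'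
  have s3 := support_horizontal_univ h.lo_left
  have s4 := h.support_curve
  have hlt := h.lt
  refine ⟨p.isOpen_region, p.pairwise_disjoint_region, ?_, ?_, fun i d hd =>
    p.eventually_mem_region i hd, ?_, ?_, ?_, ?_, ?_, ?_⟩
  · simp only [List.mem_cons, List.not_mem_nil, or_false, iUnion_iUnion_eq_or_left,
      iUnion_iUnion_eq_left, s1, s2, s3, s4, h.compl_iUnion_region, arc_insert_right p p.lo_a]
    ext Q
    simp only [mem_union, mem_insert_iff, mem_singleton_iff]
    tauto
  · have hN : ({p.A} : Set (ℝ × ℝ)) ⊆ {p.A, avg (S i₂) (S i₃)} := by simp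
    simp only [List.map_cons, List.map_nil, List.cons_append, List.nil_append, List.pairwise_cons,
      s1, s2, s3, s4, List.mem_cons, List.not_mem_nil, or_false, forall_eq_or_imp, forall_eq]
    refine ⟨⟨?_, ?_, ?_⟩, ⟨?_, ?_⟩, ?_, ?_⟩
    · refine (arc_lo_inter_subset fun z hz => ?_).trans hN
      exact absurd (mem_Iio.1 hz.2) (not_lt.2 (hlt.le.trans hz.1))
    · refine (arc_lo_inter_subset fun z hz => ?_).trans hN
      exact le_antisymm hz.2.2 hz.1
    · exact (p.arc_lo_inter_arc_hi Ioi_subset_Ici_self).trans hN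
    · refine (arc_lo_inter_subset fun z hz => ?_).trans hN
      exact absurd (mem_Iio.1 hz.1) (lt_asymm hz.2.1)
    · exact (p.arc_lo_inter_arc_hi Ioi_subset_Ici_self).trans hN
    · exact (p.arc_lo_inter_arc_hi Ioi_subset_Ici_self).trans hN
    · simp
  · simp only [List.mem_cons, List.not_mem_nil, or_false, forall_eq_or_imp, forall_eq]
    exact ⟨hd', hd'', h.isDelta⟩
  · simp only [List.mem_cons, List.not_mem_nil, or_false, forall_eq_or_imp, forall_eq]
    exact ⟨sides_horizontal_Ici hA' h1' h2', h.sides_exterior, h.sides_curve⟩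
  · simp only [List.mem_cons, List.not_mem_nil, or_false, forall_eq]
    exact isContact_vertical hA hA₂
  · simp only [List.mem_cons, List.not_mem_nil, or_false, forall_eq]
    exact contactSides_vertical
  · intro φ hφ hφc k
    obtain ⟨i3, i4, e⟩ := h.weak_aux hρ hφ hφc k
    obtain ⟨i2, e2⟩ := integral_horizontal_Ici (S := S) hρ hφ hφc k hA' h1' h2'
    refine ⟨?_, ?_⟩
    · simp only [List.mem_cons, List.not_mem_nil, or_false, forall_eq_or_imp, forall_eq]
      exact ⟨i2, i3, i4⟩
    · simp only [List.map_cons, List.map_nil, List.sum_cons, List.sum_nil, e2]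
      have hz : source δ k φ = source (straightDelta S i₃ i₁ C' (Ici 0)) k φ := by
        have z2 : (straightDelta S i₃ i₁ C' (Ici 0)).Ξ 0 = p.A := by simp [straightDelta, hA']
        rw [source_eq, source_eq, h.start, z2, hsum k]
      -- The contact discontinuity carries no measure, but neither adjacent state has any flux
      -- through it.
      have z1 : ∀ U : ℝ × ℝ, U.1 = p.A.1 →
          graphIntegral p.μ p.hi (Ioi p.a) (flux p.μ p.hi U) φ = 0 := fun U hU =>
        graphIntegral_eq_zero (fun ξ hξ => by rw [p.flux_hi_right hξ, hU]; simp) φ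
      rw [hz, z1 (S i₁).vel hA, z1 (S i₂).vel hA₂] at e
      linarith
  · filter_upwards [p.ae_mem_region] with P hP
    exact hP.imp fun i hi => ⟨hi, hρ i⟩

/-- Two contact discontinuities arriving at the interaction point. -/
theorem isGlobalSolution_two_contacts (h : p.Carries S δ (avg (S i₂) (S i₃)))
    (hρ : ∀ i, 0 < (S i).ρ) (hA : (S i₁).u = p.A.1) (hA₂ : (S i₂).u = p.A.1)
    (hB : (S i₁).v = p.A.2) (hB₃ : (S i₃).v = p.A.2)
    (hd'' : IsDeltaShock S (straightDelta S i₂ i₃ (-1, 0) univ))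
    (hsum : ∀ k, δ.dens k 0 = 0) :
    IsGlobalSolution S p.region [straightDelta S i₂ i₃ (-1, 0) univ, δ]
      [⟨i₁, i₂, p.A, (0, -1), Iio 0⟩, ⟨i₃, i₁, p.A, (-1, 0), Iio 0⟩]
      {p.A, avg (S i₂) (S i₃)} := by
  have s1 := support_contact_vertical (p := p) i₁ i₂
  have s2 : (⟨i₃, i₁, p.A, (-1, 0), Iio 0⟩ : Contact).support = p.arc p.lo (Ioi p.a) :=
    support_contact_right (p := p) i₃ i₁ le_rfl rfl
  have s3 := support_horizontal_univ h.lo_left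
  have s4 := h.support_curve
  have hlt := h.lt
  refine ⟨p.isOpen_region, p.pairwise_disjoint_region, ?_, ?_, fun i d hd =>
    p.eventually_mem_region i hd, ?_, ?_, ?_, ?_, ?_, ?_⟩
  · simp only [List.mem_cons, List.not_mem_nil, or_false, iUnion_iUnion_eq_or_left,
      iUnion_iUnion_eq_left, s1, s2, s3, s4, h.compl_iUnion_region]
    ext Q
    simp only [mem_union, mem_insert_iff, mem_singleton_iff]
    tauto
  · have hN : ({p.A} : Set (ℝ × ℝ)) ⊆ {p.A, avg (S i₂) (S i₃)} := by simp
    simp only [List.map_cons, List.map_nil, List.cons_append, List.nil_append, List.pairwise_cons,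
      s1, s2, s3, s4, List.mem_cons, List.not_mem_nil, or_false, forall_eq_or_imp, forall_eq]
    refine ⟨⟨?_, ?_, ?_⟩, ⟨?_, ?_⟩, ?_, ?_⟩
    · refine (arc_lo_inter_subset fun z hz => ?_).trans hN
      exact absurd (mem_Iio.1 hz.1) (lt_asymm hz.2.1)
    · exact (p.arc_lo_inter_arc_hi Ioi_subset_Ici_self).trans hN
    · refine (arc_lo_inter_subset fun z hz => ?_).trans hN
      exact absurd (mem_Iio.1 hz.1) (lt_asymm (hlt.trans hz.2))
    · exact (p.arc_lo_inter_arc_hi Ioi_subset_Ici_self).trans hN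
    · refine (arc_lo_inter_subset fun z hz => ?_).trans hN
      exact absurd (mem_Ioi.1 hz.2) (not_lt.2 hz.1.2)
    · exact (inter_comm _ _).trans_subset ((p.arc_lo_inter_arc_hi Ioi_subset_Ici_self).trans hN)
    · simp
  · simp only [List.mem_cons, List.not_mem_nil, or_false, forall_eq_or_imp, forall_eq]
    exact ⟨hd'', h.isDelta⟩
  · simp only [List.mem_cons, List.not_mem_nil, or_false, forall_eq_or_imp, forall_eq]
    exact ⟨h.sides_exterior, h.sides_curve⟩
  · simp only [List.mem_cons, List.not_mem_nil, or_false, forall_eq_or_imp, forall_eq]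
    exact ⟨isContact_vertical hA hA₂, isContact_horizontal (by norm_num) hB₃ hB⟩
  · simp only [List.mem_cons, List.not_mem_nil, or_false, forall_eq_or_imp, forall_eq]
    exact ⟨contactSides_vertical, contactSides_right le_rfl rfl⟩
  · intro φ hφ hφc k
    obtain ⟨i3, i4, e⟩ := h.weak_aux hρ hφ hφc k
    refine ⟨?_, ?_⟩
    · simp only [List.mem_cons, List.not_mem_nil, or_false, forall_eq_or_imp, forall_eq]
      exact ⟨i3, i4⟩
    · simp only [List.map_cons, List.map_nil, List.sum_cons, List.sum_nil]
      -- All four fluxes through the two contact discontinuities vanish, and the new shock starts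
      -- without a source.
      have z1 : ∀ U : ℝ × ℝ, U.1 = p.A.1 →
          graphIntegral p.μ p.hi (Ioi p.a) (flux p.μ p.hi U) φ = 0 := fun U hU =>
        graphIntegral_eq_zero (fun ξ hξ => by rw [p.flux_hi_right hξ, hU]; simp) φ
      have z2 : ∀ U : ℝ × ℝ, U.2 = p.A.2 →
          graphIntegral p.μ p.lo (Ioi p.a) (flux p.μ p.lo U) φ = 0 := fun U hU =>
        graphIntegral_eq_zero (fun ξ hξ => by rw [p.flux_lo_right hξ, hU]; simp) φ
      rw [source_eq, hsum, z1 (S i₁).vel hA, z1 (S i₂).vel hA₂, z2 (S i₁).vel hB,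
        z2 (S i₃).vel hB₃] at e
      linarith
  · filter_upwards [p.ae_mem_region] with P hP
    exact hP.imp fun i hi => ⟨hi, hρ i⟩

end Carries

end Profile

namespace Profile

variable {p : Profile} {S : Fin 3 → GasState}

/-! #### A straight lower boundary -/

theorem support_contact_flat (hlo : ∀ ξ, p.lo ξ = p.A.2) {J : Contact} {T : Set ℝ}
    (hb : J.base.2 = p.A.2) (hd : J.dir.2 = 0)
    (himg : (fun τ : ℝ => slant p.μ J.base + τ * J.dir.1) '' J.range = T) :
    J.support = p.arc p.lo T := by
  have hs : slant p.μ J.dir = J.dir.1 := by simp [slant, hd]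
  refine support_contact (by rw [hs, himg]) fun τ _ => ?_
  rw [hlo, hd, hb]
  ring

theorem sides_flat_left (hlo : ∀ ξ, p.lo ξ = p.A.2) {P W : ℝ × ℝ}
    (hP : P ∈ p.arc p.lo (Iio p.a)) (hW : W.2 < 0) :
    ∀ᶠ ε : ℝ in 𝓝[>] 0, P + ε • W ∈ p.region i₃ ∧ P - ε • W ∈ p.region i₂ := by
  have h : p.lo = fun _ => p.A.2 := funext hlo
  refine p.sides_lo_left hP (l := 0) ?_ (by rwa [zero_mul])
  rw [h]
  exact hasDerivAt_const _ _

/-- All states move parallel to the horizontal boundary, so nothing crosses it, and the fluxes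
through the vertical ray are absorbed by the single delta shock. -/
theorem weak_flat (hlo : ∀ ξ, p.lo ξ = p.A.2) (hρ : ∀ i, 0 < (S i).ρ)
    (hA : p.A = avg (S i₁) (S i₂)) (hv : ∀ i, (S i).v = p.A.2) :
    IsWeakSolution S p.region [straightDelta S i₁ i₂ (0, 1) univ] := by
  intro φ hφ hφc k
  have h : p.lo = fun _ => p.A.2 := funext hlo
  obtain ⟨i1, e1⟩ := integral_vertical_univ (S := S) hρ hφ hφc k hA
  have hf : ∀ i ξ, flux p.μ p.lo (S i).vel ξ = 0 := fun i ξ => by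
    have : deriv p.lo ξ = 0 := by rw [h]; exact deriv_const _ _
    rw [flux, this, hlo, GasState.vel, hv i]
    ring
  have hK : ∀ i, ∃ K, ∀ ξ, |flux p.μ p.lo (S i).vel ξ| ≤ K := fun i =>
    ⟨0, fun ξ => by rw [hf, abs_zero]⟩
  have e := sum_integral_region (p := p) S countable_empty
    (fun ξ _ => by rw [h]; exact differentiableAt_const _) (hK i₂) (hK i₃) hφ hφc k
  have hz : ∀ i T, graphIntegral p.μ p.lo T (flux p.μ p.lo (S i).vel) φ = 0 := fun i T =>
    graphIntegral_eq_zero (fun ξ _ => hf i ξ) φ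
  rw [hz, hz, hz, hz] at e
  simp only [List.mem_cons, List.not_mem_nil, or_false, forall_eq, List.map_cons, List.map_nil,
    List.sum_cons, List.sum_nil, e1]
  exact ⟨i1, by linarith⟩

theorem arc_lo_inter_subset_of_disjoint {T T' : Set ℝ} (h : Disjoint T T') (N : Set (ℝ × ℝ)) :
    p.arc p.lo T ∩ p.arc p.lo T' ⊆ N := by
  rw [arc_inter, h.inter_eq]
  exact fun Q hQ => absurd hQ.1 (notMem_empty _)

theorem image_add_Ioo (b d : ℝ) : (fun τ : ℝ => b + τ * 1) '' Ioo 0 d = Ioo b (b + d) := by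
  ext x
  simp only [mul_one, mem_image, mem_Ioo]
  constructor
  · rintro ⟨τ, ⟨h1, h2⟩, rfl⟩
    exact ⟨by linarith, by linarith⟩
  · rintro ⟨h1, h2⟩
    exact ⟨x - b, ⟨by linarith, by linarith⟩, by ring⟩

theorem image_sub_Ioo (b d : ℝ) : (fun τ : ℝ => b + τ * (-1)) '' Ioo 0 d = Ioo (b - d) b := by
  ext x
  simp only [mem_image, mem_Ioo]
  constructor
  · rintro ⟨τ, ⟨h1, h2⟩, rfl⟩
    exact ⟨by linarith, by linarith⟩
  · rintro ⟨h1, h2⟩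
    exact ⟨b - x, ⟨by linarith, by linarith⟩, by ring⟩

/-- The lower boundary is one horizontal line. It is cut at `U*₁₂`, where the adjacent upper state
changes, and at `Ξ₃`, where the contact coming from the right ends; if these points coincide, the
middle piece is empty. -/
theorem isGlobalSolution_flat_right (hlo : ∀ ξ, p.lo ξ = p.A.2) (hρ : ∀ i, 0 < (S i).ρ)
    (hA : p.A = avg (S i₁) (S i₂)) (hv : ∀ i, (S i).v = p.A.2)
    (hd : IsDeltaShock S (straightDelta S i₁ i₂ (0, 1) univ)) (hle : p.A.1 ≤ (S i₃).u) :
    IsGlobalSolution S p.region [straightDelta S i₁ i₂ (0, 1) univ]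
      [⟨i₂, i₃, p.A, (1, 0), Iio 0⟩, ⟨i₁, i₃, p.A, (1, 0), Ioo 0 ((S i₃).u - p.A.1)⟩,
        ⟨i₃, i₁, (S i₃).vel, (-1, 0), Iio 0⟩] {p.A, (S i₃).vel} := by
  set b := slant p.μ (S i₃).vel with hb
  have hB : (S i₃).vel.2 = p.A.2 := hv i₃
  have hab : p.a + ((S i₃).u - p.A.1) = b := by
    rw [hb, slant, hB, a, slant]
    simp only [GasState.vel]
    ring
  have hle' : p.a ≤ b := by linarith
  have s0 := support_vertical_univ (S := S) (l := i₁) (r := i₂) hA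
  have s1 : (⟨i₂, i₃, p.A, (1, 0), Iio 0⟩ : Contact).support = p.arc p.lo (Iio p.a) :=
    support_contact_flat hlo rfl rfl (image_affine_Iio_of_pos p.a one_pos)
  have s2 : (⟨i₁, i₃, p.A, (1, 0), Ioo 0 ((S i₃).u - p.A.1)⟩ : Contact).support =
      p.arc p.lo (Ioo p.a b) :=
    support_contact_flat hlo rfl rfl (by rw [← hab]; exact image_add_Ioo p.a _)
  have s3 : (⟨i₃, i₁, (S i₃).vel, (-1, 0), Iio 0⟩ : Contact).support = p.arc p.lo (Ioi b) :=
    support_contact_right i₃ i₁ hle' hB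
  refine ⟨p.isOpen_region, p.pairwise_disjoint_region, ?_, ?_, fun i d hd =>
    p.eventually_mem_region i hd, ?_, ?_, ?_, ?_, weak_flat hlo hρ hA hv, ?_⟩
  · have h1 : p.arc p.lo {p.a} = {p.A} := p.arc_singleton (hlo _)
    have h2 : p.arc p.lo {b} = {(S i₃).vel} := p.arc_singleton (by rw [hlo, hB])
    have h3 : (univ : Set ℝ) = Iio p.a ∪ {p.a} ∪ Ioo p.a b ∪ {b} ∪ Ioi b := by
      ext z
      simp only [mem_univ, mem_union, mem_Iio, mem_singleton_iff, mem_Ioo, mem_Ioi, true_iff]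
      rcases lt_trichotomy z p.a with h | h | h <;> rcases lt_trichotomy z b with h' | h' | h' <;>
        tauto
    simp only [List.mem_cons, List.not_mem_nil, or_false, iUnion_iUnion_eq_or_left,
      iUnion_iUnion_eq_left, s0, s1, s2, s3, p.compl_iUnion_region, arc_insert_right p p.hi_a]
    simp only [h3, arc_union, h1, h2]
    ext Q
    simp only [mem_union, mem_insert_iff, mem_singleton_iff]
    tauto
  · have hN : ({p.A} : Set (ℝ × ℝ)) ⊆ {p.A, (S i₃).vel} := by simp
    simp only [List.map_cons, List.map_nil, List.cons_append, List.nil_append, List.pairwise_cons,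
      s0, s1, s2, s3, List.mem_cons, List.not_mem_nil, or_false, forall_eq_or_imp, forall_eq]
    refine ⟨⟨?_, ?_, ?_⟩, ⟨?_, ?_⟩, ?_, ?_⟩
    · exact (inter_comm _ _).trans_subset ((p.arc_lo_inter_arc_hi Ioi_subset_Ici_self).trans hN)
    · exact (inter_comm _ _).trans_subset ((p.arc_lo_inter_arc_hi Ioi_subset_Ici_self).trans hN)
    · exact (inter_comm _ _).trans_subset ((p.arc_lo_inter_arc_hi Ioi_subset_Ici_self).trans hN)
    · exact arc_lo_inter_subset_of_disjoint (disjoint_left.2 fun z h h' =>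
        lt_asymm (mem_Iio.1 h) (mem_Ioo.1 h').1) _
    · exact arc_lo_inter_subset_of_disjoint (disjoint_left.2 fun z h h' =>
        lt_asymm (mem_Iio.1 h) (hle'.trans_lt (mem_Ioi.1 h'))) _
    · exact arc_lo_inter_subset_of_disjoint (disjoint_left.2 fun z h h' =>
        lt_asymm (mem_Ioo.1 h).2 (mem_Ioi.1 h')) _
    · simp
  · simpa only [List.mem_cons, List.not_mem_nil, or_false, forall_eq] using hd
  · simp only [List.mem_cons, List.not_mem_nil, or_false, forall_eq]
    exact sides_vertical_univ hA
  · simp only [List.mem_cons, List.not_mem_nil, or_false, forall_eq_or_imp, forall_eq]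
    exact ⟨isContact_horizontal one_ne_zero (hv _) (hv _),
      isContact_horizontal one_ne_zero (hv _) (hv _),
      isContact_horizontal (by norm_num) (by rw [hv, hB]) (by rw [hv, hB])⟩
  · simp only [List.mem_cons, List.not_mem_nil, or_false, forall_eq_or_imp, forall_eq, s1, s2]
    refine ⟨fun Q hQ => ?_, fun Q hQ => ?_, contactSides_right hle' hB⟩
    · exact sides_of_opposite (sides_flat_left hlo hQ (by simp [rot]))
    · exact sides_of_opposite (p.sides_lo_right (p.arc_mono _ Ioo_subset_Ioi_self hQ)
        (by simp [rot]))
  · filter_upwards [p.ae_mem_region] with P hP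
    exact hP.imp fun i hi => ⟨hi, hρ i⟩

theorem isGlobalSolution_flat_left (hlo : ∀ ξ, p.lo ξ = p.A.2) (hρ : ∀ i, 0 < (S i).ρ)
    (hA : p.A = avg (S i₁) (S i₂)) (hv : ∀ i, (S i).v = p.A.2)
    (hd : IsDeltaShock S (straightDelta S i₁ i₂ (0, 1) univ)) (hle : (S i₃).u ≤ p.A.1) :
    IsGlobalSolution S p.region [straightDelta S i₁ i₂ (0, 1) univ]
      [⟨i₃, i₁, p.A, (-1, 0), Iio 0⟩, ⟨i₃, i₂, p.A, (-1, 0), Ioo 0 (p.A.1 - (S i₃).u)⟩,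
        ⟨i₂, i₃, (S i₃).vel, (1, 0), Iio 0⟩] {p.A, (S i₃).vel} := by
  set b := slant p.μ (S i₃).vel with hb
  have hB : (S i₃).vel.2 = p.A.2 := hv i₃
  have hab : p.a - (p.A.1 - (S i₃).u) = b := by
    rw [hb, slant, hB, a, slant]
    simp only [GasState.vel]
    ring
  have hle' : b ≤ p.a := by linarith
  have s0 := support_vertical_univ (S := S) (l := i₁) (r := i₂) hA
  have s1 : (⟨i₃, i₁, p.A, (-1, 0), Iio 0⟩ : Contact).support = p.arc p.lo (Ioi p.a) :=
    support_contact_right i₃ i₁ le_rfl rfl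
  have s2 : (⟨i₃, i₂, p.A, (-1, 0), Ioo 0 (p.A.1 - (S i₃).u)⟩ : Contact).support =
      p.arc p.lo (Ioo b p.a) :=
    support_contact_flat hlo rfl rfl (by rw [← hab]; exact image_sub_Ioo p.a _)
  have s3 : (⟨i₂, i₃, (S i₃).vel, (1, 0), Iio 0⟩ : Contact).support = p.arc p.lo (Iio b) :=
    support_contact_flat hlo hB rfl (image_affine_Iio_of_pos b one_pos)
  refine ⟨p.isOpen_region, p.pairwise_disjoint_region, ?_, ?_, fun i d hd =>
    p.eventually_mem_region i hd, ?_, ?_, ?_, ?_, weak_flat hlo hρ hA hv, ?_⟩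
  · have h1 : p.arc p.lo {p.a} = {p.A} := p.arc_singleton (hlo _)
    have h2 : p.arc p.lo {b} = {(S i₃).vel} := p.arc_singleton (by rw [hlo, hB])
    have h3 : (univ : Set ℝ) = Iio b ∪ {b} ∪ Ioo b p.a ∪ {p.a} ∪ Ioi p.a := by
      ext z
      simp only [mem_univ, mem_union, mem_Iio, mem_singleton_iff, mem_Ioo, mem_Ioi, true_iff]
      rcases lt_trichotomy z p.a with h | h | h <;> rcases lt_trichotomy z b with h' | h' | h' <;>
        tauto
    simp only [List.mem_cons, List.not_mem_nil, or_false, iUnion_iUnion_eq_or_left,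
      iUnion_iUnion_eq_left, s0, s1, s2, s3, p.compl_iUnion_region, arc_insert_right p p.hi_a]
    simp only [h3, arc_union, h1, h2]
    ext Q
    simp only [mem_union, mem_insert_iff, mem_singleton_iff]
    tauto
  · have hN : ({p.A} : Set (ℝ × ℝ)) ⊆ {p.A, (S i₃).vel} := by simp
    simp only [List.map_cons, List.map_nil, List.cons_append, List.nil_append, List.pairwise_cons,
      s0, s1, s2, s3, List.mem_cons, List.not_mem_nil, or_false, forall_eq_or_imp, forall_eq]
    refine ⟨⟨?_, ?_, ?_⟩, ⟨?_, ?_⟩, ?_, ?_⟩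
    · exact (inter_comm _ _).trans_subset ((p.arc_lo_inter_arc_hi Ioi_subset_Ici_self).trans hN)
    · exact (inter_comm _ _).trans_subset ((p.arc_lo_inter_arc_hi Ioi_subset_Ici_self).trans hN)
    · exact (inter_comm _ _).trans_subset ((p.arc_lo_inter_arc_hi Ioi_subset_Ici_self).trans hN)
    · exact arc_lo_inter_subset_of_disjoint (disjoint_left.2 fun z h h' =>
        lt_asymm (mem_Ioi.1 h) (mem_Ioo.1 h').2) _
    · exact arc_lo_inter_subset_of_disjoint (disjoint_left.2 fun z h h' =>
        lt_asymm (hle'.trans_lt (mem_Ioi.1 h)) (mem_Iio.1 h')) _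
    · exact arc_lo_inter_subset_of_disjoint (disjoint_left.2 fun z h h' =>
        lt_asymm (mem_Ioo.1 h).1 (mem_Iio.1 h')) _
    · simp
  · simpa only [List.mem_cons, List.not_mem_nil, or_false, forall_eq] using hd
  · simp only [List.mem_cons, List.not_mem_nil, or_false, forall_eq]
    exact sides_vertical_univ hA
  · simp only [List.mem_cons, List.not_mem_nil, or_false, forall_eq_or_imp, forall_eq]
    exact ⟨isContact_horizontal (by norm_num) (hv _) (hv _),
      isContact_horizontal (by norm_num) (hv _) (hv _),
      isContact_horizontal one_ne_zero (by rw [hv, hB]) (by rw [hv, hB])⟩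
  · simp only [List.mem_cons, List.not_mem_nil, or_false, forall_eq_or_imp, forall_eq, s2, s3]
    refine ⟨contactSides_right le_rfl rfl, fun Q hQ => ?_, fun Q hQ => ?_⟩
    · exact sides_flat_left hlo (p.arc_mono _ Ioo_subset_Iio_self hQ) (by simp [rot])
    · exact sides_of_opposite (sides_flat_left hlo (p.arc_mono _ (Iio_subset_Iio hle') hQ)
        (by simp [rot]))
  · filter_upwards [p.ae_mem_region] with P hP
    exact hP.imp fun i hi => ⟨hi, hρ i⟩

end Profile

/-! ### From the data of the four cases to the interaction point. -/

theorem avg_comm (L R : GasState) : avg L R = avg R L := by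
  rw [avg, avg, add_comm √L.ρ, add_comm (√L.ρ • L.vel)]

theorem avg_fst_mem {L R : GasState} (hL : 0 < L.ρ) (hR : 0 < R.ρ) (h : L.u < R.u) :
    (avg L R).1 ∈ Ioo L.u R.u := by
  have h1 := Real.sqrt_pos.2 hL
  have h2 := Real.sqrt_pos.2 hR
  rw [avg_fst]
  constructor
  · rw [lt_div_iff₀ (by positivity)]
    nlinarith
  · rw [div_lt_iff₀ (by positivity)]
    nlinarith

theorem avg_snd_mem {L R : GasState} (hL : 0 < L.ρ) (hR : 0 < R.ρ) (h : L.v < R.v) :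
    (avg L R).2 ∈ Ioo L.v R.v := by
  have h1 := Real.sqrt_pos.2 hL
  have h2 := Real.sqrt_pos.2 hR
  rw [avg_snd]
  constructor
  · rw [lt_div_iff₀ (by positivity)]
    nlinarith
  · rw [div_lt_iff₀ (by positivity)]
    nlinarith

theorem tri_avg {L R : GasState} (hL : 0 < L.ρ) (hR : 0 < R.ρ) (P Q : ℝ × ℝ) :
    tri P Q (avg L R) = (√L.ρ * tri P Q L.vel + √R.ρ * tri P Q R.vel) / (√L.ρ + √R.ρ) := by
  have h1 := Real.sqrt_pos.2 hL
  have h2 := Real.sqrt_pos.2 hR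
  have h3 : √L.ρ + √R.ρ ≠ 0 := by positivity
  simp only [tri_eq, avg_fst, avg_snd, GasState.vel]
  field_simp
  ring

theorem cross_eq_neg_tri (A P Q : ℝ × ℝ) : cross (A - P) (Q - P) = -tri P Q A := by
  rw [tri_eq]
  simp only [cross, Prod.fst_sub, Prod.snd_sub]
  ring

theorem straight_Ξ_zero (S : Fin 3 → GasState) (l r : Fin 3) (A : ℝ × ℝ) (I : Set ℝ) :
    (straightDelta S l r (A - avg (S l) (S r)) I).Ξ 0 = A := by
  simp [straightDelta]

/-- The kinetic energy lost when two masses merge is nonnegative. -/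
theorem nsq_merge_le {m m' : ℝ} (hm : 0 < m) (hm' : 0 < m') (V V' : ℝ × ℝ) :
    (m + m') / 2 * nsq ((m * V.1 + m' * V'.1) / (m + m'), (m * V.2 + m' * V'.2) / (m + m')) ≤
      m / 2 * nsq V + m' / 2 * nsq V' := by
  have hW : 0 < m + m' := add_pos hm hm'
  have h : m / 2 * nsq V + m' / 2 * nsq V' - (m + m') / 2 *
      nsq ((m * V.1 + m' * V'.1) / (m + m'), (m * V.2 + m' * V'.2) / (m + m')) =
      m * m' / (2 * (m + m')) * nsq (V - V') := by
    simp only [nsq, Prod.fst_sub, Prod.snd_sub]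
    field_simp
    ring
  have h2 : 0 ≤ m * m' / (2 * (m + m')) * nsq (V - V') :=
    mul_nonneg (by positivity) (add_nonneg (sq_nonneg _) (sq_nonneg _))
  linarith

variable {S : Fin 3 → GasState}

theorem isDeltaShock_exterior_two_three (hρ : ∀ i, 0 < (S i).ρ) (hH : ∀ i, 0 ≤ (S i).H)
    (hv : (S i₂).v < (S i₃).v) : IsDeltaShock S (straightDelta S i₂ i₃ (-1, 0) univ) := by
  refine isDeltaShock_straight hρ hH ?_
  simp [cross, GasState.vel]
  exact hv

/-- The initial velocity `U₀` of the new shock is the mass-weighted mean of the two arriving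
velocities `V` and `V'`. The function `[U₂, U₃, ·]` is affine and negative at `V` and `V'`, hence at
`U₀`. Since `A` has the abscissa of `V` and the ordinate of `V'`, the larger ones of both, its value
at `A` is smaller still. These signs are the hypotheses of `exists_deltaShock`. -/
theorem exists_solution_three_deltas (hρ : ∀ i, 0 < (S i).ρ) (hH : ∀ i, 0 ≤ (S i).H)
    (hu31 : (S i₃).u < (S i₁).u) (hu12 : (S i₁).u < (S i₂).u) (hv21 : (S i₂).v < (S i₁).v)
    (hv13 : (S i₁).v < (S i₃).v) (htri : tri (S i₁).vel (S i₂).vel (S i₃).vel < 0)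
    {A : ℝ × ℝ} (hA : A = ((avg (S i₁) (S i₂)).1, (avg (S i₃) (S i₁)).2)) :
    ∃ (Ω : Fin 3 → Set (ℝ × ℝ)) (δ : DeltaShock), δ.left = i₃ ∧ δ.right = i₂ ∧
      EmergesFrom δ A [straightDelta S i₁ i₂ (A - avg (S i₁) (S i₂)) (Ici 0),
        straightDelta S i₃ i₁ (A - avg (S i₃) (S i₁)) (Ici 0)] ∧
      tri (S i₂).vel (S i₃).vel A < tri (S i₂).vel (S i₃).vel (δ.U 0) ∧
      tri (S i₂).vel (S i₃).vel (δ.U 0) < 0 ∧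
      δ.TerminatesAt (avg (S i₂) (S i₃)) ∧
      IsGlobalSolution S Ω [straightDelta S i₁ i₂ (A - avg (S i₁) (S i₂)) (Ici 0),
        straightDelta S i₃ i₁ (A - avg (S i₃) (S i₁)) (Ici 0),
        straightDelta S i₂ i₃ (-1, 0) univ, δ] [] {A, avg (S i₂) (S i₃)} := by
  obtain ⟨a1, a2⟩ := avg_fst_mem (hρ i₁) (hρ i₂) hu12
  obtain ⟨a3, a4⟩ := avg_snd_mem (hρ i₂) (hρ i₁) hv21
  rw [avg_comm] at a3 a4
  obtain ⟨b1, b2⟩ := avg_fst_mem (hρ i₃) (hρ i₁) hu31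
  obtain ⟨b3, b4⟩ := avg_snd_mem (hρ i₁) (hρ i₃) hv13
  rw [avg_comm] at b3 b4
  have htri' : tri (S i₂).vel (S i₃).vel (S i₁).vel < 0 := by
    rw [tri_eq] at htri ⊢
    linarith
  have hp₁ := Real.sqrt_pos.2 (hρ i₁)
  have hp₂ := Real.sqrt_pos.2 (hρ i₂)
  have hp₃ := Real.sqrt_pos.2 (hρ i₃)
  -- `U*₁₂` lies strictly between `U₁`, where the affine function is negative, and `U₂`, where it
  -- vanishes.
  have t1 : tri (S i₂).vel (S i₃).vel (avg (S i₁) (S i₂)) < 0 := by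
    rw [tri_avg (hρ _) (hρ _), show tri (S i₂).vel (S i₃).vel (S i₂).vel = 0 by rw [tri_eq]; ring]
    refine div_neg_of_neg_of_pos ?_ (by positivity)
    linarith [mul_neg_of_pos_of_neg hp₁ htri']
  have t2 : tri (S i₂).vel (S i₃).vel (avg (S i₃) (S i₁)) < 0 := by
    rw [tri_avg (hρ _) (hρ _), show tri (S i₂).vel (S i₃).vel (S i₃).vel = 0 by rw [tri_eq]; ring]
    refine div_neg_of_neg_of_pos ?_ (by positivity)
    linarith [mul_neg_of_pos_of_neg hp₁ htri']
  set V := avg (S i₁) (S i₂) with hV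
  set V' := avg (S i₃) (S i₁) with hV'
  have hc : A - V = (0, V'.2 - V.2) := by rw [hA]; ext <;> simp
  have hc' : A - V' = (V.1 - V'.1, 0) := by rw [hA]; ext <;> simp
  have hc2 : 0 < V'.2 - V.2 := by linarith
  have hc1 : 0 < V.1 - V'.1 := by linarith
  have hC : 0 < cross ((S i₂).vel - (S i₁).vel) (A - V) := by
    rw [hc]
    simp only [cross, GasState.vel, Prod.fst_sub, Prod.snd_sub, mul_zero, sub_zero]
    exact mul_pos (sub_pos.2 hu12) hc2
  have hC' : 0 < cross ((S i₁).vel - (S i₃).vel) (A - V') := by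
    rw [hc']
    simp only [cross, GasState.vel, Prod.fst_sub, Prod.snd_sub, mul_zero, zero_sub]
    linarith [mul_pos (sub_pos.2 hv13) hc1]
  set d := straightDelta S i₁ i₂ (A - V) (Ici 0) with hd
  set d' := straightDelta S i₃ i₁ (A - V') (Ici 0) with hd'
  have hm : 0 < d.m 0 := straightDelta_m_pos hρ hC 0
  have hm' : 0 < d'.m 0 := straightDelta_m_pos hρ hC' 0
  have hn : 0 < d.n 0 := straightDelta_n_pos hρ hH hC 0
  have hn' : 0 < d'.n 0 := straightDelta_n_pos hρ hH hC' 0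
  have hdens : ∀ k, d.dens k 0 =
      ![d.m 0, d.m 0 * V.1, d.m 0 * V.2, d.n 0 + d.m 0 / 2 * nsq V] k := fun _ => rfl
  have hdens' : ∀ k, d'.dens k 0 =
      ![d'.m 0, d'.m 0 * V'.1, d'.m 0 * V'.2, d'.n 0 + d'.m 0 / 2 * nsq V'] k := fun _ => rfl
  set m := d.m 0 with hmm
  set m' := d'.m 0 with hmm'
  have hW : 0 < m + m' := add_pos hm hm'
  set U₀ : ℝ × ℝ := ((m * V.1 + m' * V'.1) / (m + m'), (m * V.2 + m' * V'.2) / (m + m')) with hU₀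
  have hU1 : (m + m') * U₀.1 = m * V.1 + m' * V'.1 := mul_div_cancel₀ _ hW.ne'
  have hU2 : (m + m') * U₀.2 = m * V.2 + m' * V'.2 := mul_div_cancel₀ _ hW.ne'
  have hA1 : A.1 = V.1 := by rw [hA]
  have hA2 : A.2 = V'.2 := by rw [hA]
  have htU : (m + m') * tri (S i₂).vel (S i₃).vel U₀ =
      m * tri (S i₂).vel (S i₃).vel V + m' * tri (S i₂).vel (S i₃).vel V' := by
    simp only [tri_eq]
    linear_combination ((S i₃).vel.1 - (S i₂).vel.1) * hU2 - ((S i₃).vel.2 - (S i₂).vel.2) * hU1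
  have htU0 : tri (S i₂).vel (S i₃).vel U₀ < 0 := by
    refine neg_of_mul_neg_right (a := m + m') ?_ hW.le
    rw [htU]
    linarith [mul_neg_of_pos_of_neg hm t1, mul_neg_of_pos_of_neg hm' t2]
  have htA1 : tri (S i₂).vel (S i₃).vel A < tri (S i₂).vel (S i₃).vel V := by
    have := mul_pos (sub_pos.2 (hu31.trans hu12)) hc2
    simp only [tri_eq, hA1, hA2, GasState.vel]
    linarith
  have htA2 : tri (S i₂).vel (S i₃).vel A < tri (S i₂).vel (S i₃).vel V' := by
    have := mul_pos (sub_pos.2 (hv21.trans hv13)) hc1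
    simp only [tri_eq, hA1, hA2, GasState.vel]
    linarith
  have htAU : tri (S i₂).vel (S i₃).vel A < tri (S i₂).vel (S i₃).vel U₀ := by
    refine lt_of_mul_lt_mul_left (a := m + m') ?_ hW.le
    rw [htU]
    linarith [mul_lt_mul_of_pos_left htA1 hm, mul_lt_mul_of_pos_left htA2 hm']
  -- Seen from `U₀`, the point `A` lies to the upper right, `U₃` to the upper left and `U₂` to the
  -- lower right. Each entropy determinant at `A` is therefore a sum of two terms of the same sign.
  have g1 : 0 < A.1 - U₀.1 := by
    refine pos_of_mul_pos_right (a := m + m') ?_ hW.le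
    rw [mul_sub, hU1, hA1]
    linarith [mul_pos hm' hc1]
  have g2 : 0 < A.2 - U₀.2 := by
    refine pos_of_mul_pos_right (a := m + m') ?_ hW.le
    rw [mul_sub, hU2, hA2]
    linarith [mul_pos hm hc2]
  have g3 : 0 < U₀.1 - (S i₃).u := by
    refine pos_of_mul_pos_right (a := m + m') ?_ hW.le
    rw [mul_sub, hU1]
    have e1 : 0 < V.1 - (S i₃).u := by linarith
    linarith [mul_pos hm e1, mul_pos hm' (sub_pos.2 b1)]
  have g4 : 0 < (S i₂).u - U₀.1 := by linarith
  have g5 : 0 < U₀.2 - (S i₂).v := by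
    refine pos_of_mul_pos_right (a := m + m') ?_ hW.le
    rw [mul_sub, hU2]
    have e1 : 0 < V'.2 - (S i₂).v := by linarith
    linarith [mul_pos hm' e1, mul_pos hm (sub_pos.2 a3)]
  have g6 : 0 < (S i₃).v - U₀.2 := by linarith
  obtain ⟨δ, hl, hr, hI, hΞ, hU, hδd, hδ, hT, hs⟩ := exists_deltaShock S hρ hH A U₀ (m + m')
    (d.n 0 + m / 2 * nsq V + (d'.n 0 + m' / 2 * nsq V')) hW
    (by linarith [nsq_merge_le hm hm' V V'])
    (by rw [cross_eq_neg_tri]; linarith) (by rw [cross_eq_neg_tri]; linarith)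
    (by
      rw [tri_eq]
      simp only [GasState.vel]
      linarith [mul_pos g3 g2, mul_pos g6 g1])
    (by
      rw [tri_eq]
      simp only [GasState.vel]
      linarith [mul_pos g4 g2, mul_pos g5 g1])
  have hsum : ∀ k, δ.dens k 0 = d.dens k 0 + d'.dens k 0 := by
    intro k
    rw [hδd, hdens, hdens', hU1, hU2]
    fin_cases k <;> rfl
  obtain ⟨p, hpA, hp⟩ := exists_carries hρ hδ hl hr hI (hu31.trans hu12) (hv21.trans hv13) hT hs
  rw [hΞ] at hpA
  refine ⟨p.region, δ, hl, hr, ⟨hI, hΞ, ?_, ?_⟩, by rw [hU]; exact htAU, by rw [hU]; exact htU0, hT,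
    ?_⟩
  · simp only [List.mem_cons, List.not_mem_nil, or_false, forall_eq_or_imp, forall_eq]
    exact ⟨straight_Ξ_zero _ _ _ _ _, straight_Ξ_zero _ _ _ _ _⟩
  · intro k
    simp [hsum k]
  · have := hp.isGlobalSolution_two_deltas hρ (C := A - V) (C' := A - V') (by rw [hpA]; abel)
      (by rw [hc]) (by rw [hc]; exact hc2) (by rw [hpA]; abel) (by rw [hc']; exact hc1)
      (by rw [hc']) (isDeltaShock_straight hρ hH hC) (isDeltaShock_straight hρ hH hC')
      (isDeltaShock_exterior_two_three hρ hH (hv21.trans hv13)) hsum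
    rwa [hpA] at this

/-- Only one delta shock arrives, so the new one inherits its velocity `U*₃₁`. The sign of the
triangle is automatic: `U₁` lies vertically above `U₂`, and `U₃` lies to the left. -/
theorem exists_solution_contact_delta (hρ : ∀ i, 0 < (S i).ρ) (hH : ∀ i, 0 ≤ (S i).H)
    (hu31 : (S i₃).u < (S i₁).u) (hu12 : (S i₁).u = (S i₂).u) (hv21 : (S i₂).v < (S i₁).v)
    (hv13 : (S i₁).v < (S i₃).v) {A : ℝ × ℝ} (hA : A = ((S i₁).u, (avg (S i₃) (S i₁)).2)) :
    ∃ (Ω : Fin 3 → Set (ℝ × ℝ)) (δ : DeltaShock), δ.left = i₃ ∧ δ.right = i₂ ∧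
      EmergesFrom δ A [straightDelta S i₃ i₁ (A - avg (S i₃) (S i₁)) (Ici 0)] ∧
      δ.TerminatesAt (avg (S i₂) (S i₃)) ∧
      IsGlobalSolution S Ω [straightDelta S i₃ i₁ (A - avg (S i₃) (S i₁)) (Ici 0),
        straightDelta S i₂ i₃ (-1, 0) univ, δ] [⟨i₁, i₂, A, (0, -1), Iio 0⟩]
        {A, avg (S i₂) (S i₃)} := by
  obtain ⟨b1, b2⟩ := avg_fst_mem (hρ i₃) (hρ i₁) hu31
  obtain ⟨b3, b4⟩ := avg_snd_mem (hρ i₁) (hρ i₃) hv13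
  rw [avg_comm] at b3 b4
  have hp₁ := Real.sqrt_pos.2 (hρ i₁)
  have hp₃ := Real.sqrt_pos.2 (hρ i₃)
  have htri' : tri (S i₂).vel (S i₃).vel (S i₁).vel < 0 := by
    simp only [tri_eq, GasState.vel, ← hu12]
    linarith [mul_pos (sub_pos.2 hu31) (sub_pos.2 hv21)]
  have t2 : tri (S i₂).vel (S i₃).vel (avg (S i₃) (S i₁)) < 0 := by
    rw [tri_avg (hρ _) (hρ _), show tri (S i₂).vel (S i₃).vel (S i₃).vel = 0 by rw [tri_eq]; ring]
    refine div_neg_of_neg_of_pos ?_ (by positivity)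
    linarith [mul_neg_of_pos_of_neg hp₁ htri']
  set V' := avg (S i₃) (S i₁) with hV'
  have hc' : A - V' = ((S i₁).u - V'.1, 0) := by rw [hA]; ext <;> simp
  have hc1 : 0 < (S i₁).u - V'.1 := by linarith
  have hC' : 0 < cross ((S i₁).vel - (S i₃).vel) (A - V') := by
    rw [hc']
    simp only [cross, GasState.vel, Prod.fst_sub, Prod.snd_sub, mul_zero, zero_sub]
    linarith [mul_pos (sub_pos.2 hv13) hc1]
  set d' := straightDelta S i₃ i₁ (A - V') (Ici 0) with hd'
  have hm' : 0 < d'.m 0 := straightDelta_m_pos hρ hC' 0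
  have hn' : 0 < d'.n 0 := straightDelta_n_pos hρ hH hC' 0
  have hA1 : A.1 = (S i₁).u := by rw [hA]
  have hA2 : A.2 = V'.2 := by rw [hA]
  obtain ⟨δ, hl, hr, hI, hΞ, hU, hδd, hδ, hT, hs⟩ := exists_deltaShock S hρ hH A V' (d'.m 0)
    (d'.n 0 + d'.m 0 / 2 * nsq V') hm' (by linarith)
    (by
      rw [cross_eq_neg_tri]
      simp only [tri_eq, GasState.vel, hA1, hA2, ← hu12]
      linarith [mul_pos (sub_pos.2 hu31) (sub_pos.2 (hv21.trans b3))])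
    (by rw [cross_eq_neg_tri]; linarith)
    (by
      simp only [tri_eq, GasState.vel, hA1, hA2]
      linarith [mul_pos (sub_pos.2 b4) hc1])
    (by
      simp only [tri_eq, GasState.vel, hA1, hA2]
      linarith [mul_pos (sub_pos.2 (hv21.trans b3)) hc1])
  obtain ⟨p, hpA, hp⟩ := exists_carries hρ hδ hl hr hI (hu12 ▸ hu31) (hv21.trans hv13) hT hs
  rw [hΞ] at hpA
  have hsum : ∀ k, δ.dens k 0 = d'.dens k 0 := hδd
  refine ⟨p.region, δ, hl, hr, ⟨hI, hΞ, ?_, ?_⟩, hT, ?_⟩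
  · simp only [List.mem_cons, List.not_mem_nil, or_false, forall_eq]
    exact straight_Ξ_zero _ _ _ _ _
  · intro k
    simp [hsum k]
  · have := hp.isGlobalSolution_contact_delta hρ (C' := A - V') (by rw [hpA, hA1])
      (by rw [hpA, hA1, hu12]) (by rw [hpA]; abel) (by rw [hc']; exact hc1)
      (by rw [hc']) (isDeltaShock_straight hρ hH hC')
      (isDeltaShock_exterior_two_three hρ hH (hv21.trans hv13)) hsum
    rwa [hpA] at this

/-- With a flat lower boundary no wave is slanted, and any positive slant would do. -/
theorem exists_solution_no_new_delta (hρ : ∀ i, 0 < (S i).ρ) (hH : ∀ i, 0 ≤ (S i).H)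
    (hu12 : (S i₁).u < (S i₂).u) (hv12 : (S i₁).v = (S i₂).v) (hv23 : (S i₂).v = (S i₃).v)
    {A : ℝ × ℝ} (hA : A = avg (S i₁) (S i₂)) :
    ∃ Ω : Fin 3 → Set (ℝ × ℝ),
      (A.1 ≤ (S i₃).u → IsGlobalSolution S Ω [straightDelta S i₁ i₂ (0, 1) univ]
        [⟨i₂, i₃, A, (1, 0), Iio 0⟩, ⟨i₁, i₃, A, (1, 0), Ioo 0 ((S i₃).u - A.1)⟩,
        ⟨i₃, i₁, (S i₃).vel, (-1, 0), Iio 0⟩] {A, (S i₃).vel}) ∧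
      ((S i₃).u ≤ A.1 → IsGlobalSolution S Ω [straightDelta S i₁ i₂ (0, 1) univ]
        [⟨i₃, i₁, A, (-1, 0), Iio 0⟩, ⟨i₃, i₂, A, (-1, 0), Ioo 0 (A.1 - (S i₃).u)⟩,
        ⟨i₂, i₃, (S i₃).vel, (1, 0), Iio 0⟩] {A, (S i₃).vel}) := by
  have hp₁ := Real.sqrt_pos.2 (hρ i₁)
  have hp₂ := Real.sqrt_pos.2 (hρ i₂)
  have hA2 : A.2 = (S i₁).v := by
    have h3 : √(S i₁).ρ + √(S i₂).ρ ≠ 0 := by positivity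
    rw [hA, avg_snd, ← hv12]
    field_simp
  let p : Profile :=
    { μ := 1
      A := A
      lo := fun _ => A.2
      μ_pos := one_pos
      continuous_lo := continuous_const
      bounded_lo := ⟨|A.2|, fun _ => le_rfl⟩
      lo_of_ge := fun _ _ => rfl }
  have hv : ∀ i, (S i).v = p.A.2 := by
    intro i
    change _ = A.2
    fin_cases i
    · exact hA2.symm
    · exact (hA2.trans hv12).symm
    · exact (hA2.trans (hv12.trans hv23)).symm
  have hd : IsDeltaShock S (straightDelta S i₁ i₂ (0, 1) univ) := by
    refine isDeltaShock_straight hρ hH ?_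
    simp [cross, GasState.vel]
    exact hu12
  exact ⟨p.region,
    fun h => Profile.isGlobalSolution_flat_right (p := p) (fun _ => rfl) hρ hA hv hd h,
    fun h => Profile.isGlobalSolution_flat_left (p := p) (fun _ => rfl) hρ hA hv hd h⟩

/-- Without arriving mass the accretion system cannot be started, since it requires a positive
initial mass. Instead, the straight segment from `Ξ₁` to `U*₂₃` carries a shock with zero initial
weights; it is entropic because its cross product with the velocity jump is `(u₁ - u₃)(v₁ - v₂) >
0`. -/
theorem exists_solution_two_contacts (hρ : ∀ i, 0 < (S i).ρ) (hH : ∀ i, 0 ≤ (S i).H)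
    (hu31 : (S i₃).u < (S i₁).u) (hu12 : (S i₁).u = (S i₂).u) (hv21 : (S i₂).v < (S i₁).v)
    (hv13 : (S i₁).v = (S i₃).v) :
    ∃ (Ω : Fin 3 → Set (ℝ × ℝ)) (δ : DeltaShock), δ.left = i₃ ∧ δ.right = i₂ ∧
      EmergesFrom δ (S i₁).vel [] ∧ δ.TerminatesAt (avg (S i₂) (S i₃)) ∧
      IsGlobalSolution S Ω [straightDelta S i₂ i₃ (-1, 0) univ, δ]
        [⟨i₁, i₂, (S i₁).vel, (0, -1), Iio 0⟩, ⟨i₃, i₁, (S i₁).vel, (-1, 0), Iio 0⟩]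
        {(S i₁).vel, avg (S i₂) (S i₃)} := by
  set C := (S i₁).vel - avg (S i₃) (S i₂) with hCdef
  have hC : 0 < cross ((S i₂).vel - (S i₃).vel) C := by
    have hp₂ := Real.sqrt_pos.2 (hρ i₂)
    have hp₃ := Real.sqrt_pos.2 (hρ i₃)
    have h3 : √(S i₃).ρ + √(S i₂).ρ ≠ 0 := by positivity
    have h4 : cross ((S i₂).vel - (S i₃).vel) C =
        ((S i₁).u - (S i₃).u) * ((S i₁).v - (S i₂).v) := by
      simp only [hCdef, cross, GasState.vel, Prod.fst_sub, Prod.snd_sub, avg_fst, avg_snd, ← hu12,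
        ← hv13]
      field_simp
      ring
    rw [h4]
    exact mul_pos (sub_pos.2 hu31) (sub_pos.2 hv21)
  have hδ := isDeltaShock_nascent hρ hH hC
  have hv23 : (S i₂).v < (S i₃).v := hv13 ▸ hv21
  have hT : (nascentDelta S i₃ i₂ C).TerminatesAt (avg (S i₂) (S i₃)) := by
    rw [avg_comm]
    exact terminatesAt_straight S i₃ i₂ C (Iic 0)
  have hΞ : (nascentDelta S i₃ i₂ C).Ξ 0 = (S i₁).vel := straight_Ξ_zero S i₃ i₂ _ (Iic 0)
  have hsum : ∀ k, (nascentDelta S i₃ i₂ C).dens k 0 = 0 := fun k => by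
    rw [nascentDelta_dens hρ]
    simp
  obtain ⟨p, hpA, hp⟩ := exists_carries hρ hδ rfl rfl rfl (hu12 ▸ hu31) hv23 hT
    (slowGrowth_nascent hρ)
  rw [hΞ] at hpA
  refine ⟨p.region, nascentDelta S i₃ i₂ C, rfl, rfl, ⟨rfl, hΞ, by simp, by simpa using hsum⟩,
    hT, ?_⟩
  have := hp.isGlobalSolution_two_contacts hρ (by rw [hpA]; rfl) (by rw [hpA, ← hu12]; rfl)
    (by rw [hpA]; rfl) (by rw [hpA, ← hv13]; rfl)
    (isDeltaShock_exterior_two_three hρ hH hv23) hsum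
  rwa [hpA] at this

end ZeroPressure

theorem mainTheorem3 (S : Fin 3 → GasState) (hρ : ∀ i, 0 < (S i).ρ) (hH : ∀ i, 0 ≤ (S i).H) :
    -- `u₃ < u₁ < u₂`: three exterior delta shocks
    ((S i₃).u < (S i₁).u → (S i₁).u < (S i₂).u → (S i₂).v < (S i₁).v → (S i₁).v < (S i₃).v →
      tri (S i₁).vel (S i₂).vel (S i₃).vel < 0 →
      let A : ℝ × ℝ := ((avg (S i₁) (S i₂)).1, (avg (S i₃) (S i₁)).2)
      let δ₁₂ := straightDelta S i₁ i₂ (A - avg (S i₁) (S i₂)) (Ici 0)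
      let δ₃₁ := straightDelta S i₃ i₁ (A - avg (S i₃) (S i₁)) (Ici 0)
      let δ₂₃ := straightDelta S i₂ i₃ (-1, 0) univ
      ∃ (Ω : Fin 3 → Set (ℝ × ℝ)) (δ : DeltaShock), δ.left = i₃ ∧ δ.right = i₂ ∧
        EmergesFrom δ A [δ₁₂, δ₃₁] ∧
        tri (S i₂).vel (S i₃).vel A < tri (S i₂).vel (S i₃).vel (δ.U 0) ∧
        tri (S i₂).vel (S i₃).vel (δ.U 0) < 0 ∧
        δ.TerminatesAt (avg (S i₂) (S i₃)) ∧ δ₂₃.TerminatesAt (avg (S i₂) (S i₃)) ∧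
        IsGlobalSolution S Ω [δ₁₂, δ₃₁, δ₂₃, δ] [] {A, avg (S i₂) (S i₃)}) ∧
    -- `u₃ < u₁ = u₂`: two exterior delta shocks and a contact discontinuity
    ((S i₃).u < (S i₁).u → (S i₁).u = (S i₂).u → (S i₂).v < (S i₁).v → (S i₁).v < (S i₃).v →
      let A : ℝ × ℝ := ((S i₁).u, (avg (S i₃) (S i₁)).2)
      let J₁₂ : Contact := ⟨i₁, i₂, A, (0, -1), Iio 0⟩
      let δ₃₁ := straightDelta S i₃ i₁ (A - avg (S i₃) (S i₁)) (Ici 0)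
      let δ₂₃ := straightDelta S i₂ i₃ (-1, 0) univ
      ∃ (Ω : Fin 3 → Set (ℝ × ℝ)) (δ : DeltaShock), δ.left = i₃ ∧ δ.right = i₂ ∧
        EmergesFrom δ A [δ₃₁] ∧
        δ.TerminatesAt (avg (S i₂) (S i₃)) ∧ δ₂₃.TerminatesAt (avg (S i₂) (S i₃)) ∧
        IsGlobalSolution S Ω [δ₃₁, δ₂₃, δ] [J₁₂] {A, avg (S i₂) (S i₃)}) ∧
    -- `v₁ = v₂ = v₃`: one exterior delta shock, no new delta shock
    ((S i₁).u < (S i₂).u → (S i₁).v = (S i₂).v → (S i₂).v = (S i₃).v →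
      let A : ℝ × ℝ := avg (S i₁) (S i₂)
      let δ₁₂ := straightDelta S i₁ i₂ (0, 1) univ
      ∃ Ω : Fin 3 → Set (ℝ × ℝ), δ₁₂.TerminatesAt A ∧
        (A.1 ≤ (S i₃).u →
          let J₂₃ : Contact := ⟨i₂, i₃, A, (1, 0), Iio 0⟩
          let J₁₃ : Contact := ⟨i₁, i₃, A, (1, 0), Ioo 0 ((S i₃).u - A.1)⟩
          let J₃₁ : Contact := ⟨i₃, i₁, (S i₃).vel, (-1, 0), Iio 0⟩
          IsGlobalSolution S Ω [δ₁₂] [J₂₃, J₁₃, J₃₁] {A, (S i₃).vel}) ∧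
        ((S i₃).u ≤ A.1 →
          let J₃₁ : Contact := ⟨i₃, i₁, A, (-1, 0), Iio 0⟩
          let J₃₂ : Contact := ⟨i₃, i₂, A, (-1, 0), Ioo 0 (A.1 - (S i₃).u)⟩
          let J₂₃ : Contact := ⟨i₂, i₃, (S i₃).vel, (1, 0), Iio 0⟩
          IsGlobalSolution S Ω [δ₁₂] [J₃₁, J₃₂, J₂₃] {A, (S i₃).vel})) ∧
    -- `u₃ < u₁ = u₂`, `v₁ = v₃`: one exterior delta shock, two contact discontinuities
    ((S i₃).u < (S i₁).u → (S i₁).u = (S i₂).u → (S i₂).v < (S i₁).v → (S i₁).v = (S i₃).v →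
      let J₁₂ : Contact := ⟨i₁, i₂, (S i₁).vel, (0, -1), Iio 0⟩
      let J₃₁ : Contact := ⟨i₃, i₁, (S i₁).vel, (-1, 0), Iio 0⟩
      let δ₂₃ := straightDelta S i₂ i₃ (-1, 0) univ
      ∃ (Ω : Fin 3 → Set (ℝ × ℝ)) (δ : DeltaShock), δ.left = i₃ ∧ δ.right = i₂ ∧
        EmergesFrom δ (S i₁).vel [] ∧
        δ.TerminatesAt (avg (S i₂) (S i₃)) ∧ δ₂₃.TerminatesAt (avg (S i₂) (S i₃)) ∧
        IsGlobalSolution S Ω [δ₂₃, δ] [J₁₂, J₃₁] {(S i₁).vel, avg (S i₂) (S i₃)}) := by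
  refine ⟨?_, ?_, ?_, ?_⟩
  · intro h1 h2 h3 h4 h5 A δ₁₂ δ₃₁ δ₂₃
    obtain ⟨Ω, δ, hl, hr, he, ht, ht', hT, hG⟩ :=
      exists_solution_three_deltas hρ hH h1 h2 h3 h4 h5 (A := A) rfl
    exact ⟨Ω, δ, hl, hr, he, ht, ht', hT, terminatesAt_straight _ _ _ _ _, hG⟩
  · intro h1 h2 h3 h4 A J₁₂ δ₃₁ δ₂₃
    obtain ⟨Ω, δ, hl, hr, he, hT, hG⟩ :=
      exists_solution_contact_delta hρ hH h1 h2 h3 h4 (A := A) rfl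
    exact ⟨Ω, δ, hl, hr, he, hT, terminatesAt_straight _ _ _ _ _, hG⟩
  · intro h1 h2 h3 A δ₁₂
    obtain ⟨Ω, hr, hl⟩ := exists_solution_no_new_delta hρ hH h1 h2 h3 (A := A) rfl
    exact ⟨Ω, terminatesAt_straight _ _ _ _ _, hr, hl⟩
  · intro h1 h2 h3 h4 J₁₂ J₃₁ δ₂₃
    obtain ⟨Ω, δ, hl, hr, he, hT, hG⟩ := exists_solution_two_contacts hρ hH h1 h2 h3 h4
    exact ⟨Ω, δ, hl, hr, he, hT, terminatesAt_straight _ _ _ _ _, hG⟩
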